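/- Let $\mathcal C$ be a symmetric monoidal bicategory, with tensor product $\otimes$, unit $1$ and braiding $\tau$. Composites below are written up to the coherence equivalences of $\mathcal C$. **Cores, Picard groupoids.** An object $X$ of a monoidal bicategory is *invertible* if there is an object $Y$ with $X\otimes Y\simeq 1\simeq Y\otimes X$. A *dual* of $X$ is an object $X^*$ with 1-morphisms $\mathrm{ev}_X: X\otimes X^*\to 1$ and $\mathrm{coev}_X: 1\to X^*\otimes X$ such that the two zigzag composites $X\to X$ and $X^*\to X^*$ are isomorphic to identities by chosen invertible 2-morphisms. $X$ is *fully dualizable* if it has a dual for which $\mathrm{ev}_X$ and $\mathrm{coev}_X$ both have left and right adjoints. For a monoidal bicategory $\mathcal B$, the *Picard groupoid* $\mathrm{Pic}(\mathcal B)$ is the monoidal sub-bigroupoid of invertible objects, equivalences between them and invertible 2-morphisms; $\mathrm{core}(\mathcal C^{\mathrm{fd}})$ is the monoidal sub-bigroupoid of $\mathcal C$ of fully dualizable objects, equivalences and invertible 2-morphisms. Every invertible object is fully dualizable, so $\mathrm{Pic}(\mathcal C)\subseteq\mathrm{core}(\mathcal C^{\mathrm{fd}})$. **Serre automorphism.**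 For a fully dualizable $X$ with chosen duality data, and $\mathrm{ev}_X^R$ the right adjoint of $\mathrm{ev}_X$, $$S_X=\Bigl(X\simeq X\otimes 1\xrightarrow{X\otimes \mathrm{ev}_X^R}X\otimes X\otimes X^*\xrightarrow{\tau_{X,X}\otimes X^*}X\otimes X\otimes X^*\xrightarrow{X\otimes\mathrm{ev}_X}X\otimes 1\simeq X\Bigr).$$ **Circle actions.** $\Pi_2(SO(2))$ is equivalent to the monoidal bicategory with one object, $\mathbb Z$ as 1-morphisms and only identity 2-morphisms. Accordingly, an $SO(2)$-action on a monoidal bicategory $\mathcal B$ (acting by the identity pseudofunctor on the object) means here: monoidal pseudonatural transformations $\alpha^n:\mathrm{id}_{\mathcal B}\to\mathrm{id}_{\mathcal B}$ for $n\in\mathbb Z$ and invertible monoidal modifications $\alpha^0\cong\mathrm{id}$, $\alpha^{m+n}\cong\alpha^m\circ\alpha^n$ that are unital and associative. A *Serre action* on $\mathrm{core}(\mathcal C^{\mathrm{fd}})$ is such an action for which the component of $\alpha^1$ at every $X$ is the Serre automorphism $S_X$, for some choice of duality data for each $X$. **Homotopy fixed points.** The bicategory $\mathcal B^{SO(2)}$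 of homotopy fixed points (the trilimit of the action) is the following. * Objects: tuples $(c,\Theta,(\Theta_n)_{n\in\mathbb Z},\Pi,M)$ of an object $c$ of $\mathcal B$, a 1-morphism $\Theta:c\to c$, and invertible 2-morphisms $\Theta_n:\alpha^n_c\circ\Theta\to\Theta$, $\Pi:\Theta\circ\Theta\to\Theta$ and $M:\Theta\to\mathrm{id}_c$, such that $(\Theta_n)$ is compatible with $\alpha^0\cong\mathrm{id}$ and $\alpha^{m+n}\cong\alpha^m\circ\alpha^n$, $\Pi$ satisfies the modification equation, $\Pi\circ(\mathrm{id}_\Theta*\Pi)=\Pi\circ(\Pi*\mathrm{id}_\Theta)$, and $\Pi=\mathrm{id}_\Theta*M=M*\mathrm{id}_\Theta$. * 1-morphisms: pairs $(f,m)$ of a 1-morphism $f:c\to c'$ and an invertible 2-morphism $m:f\circ\Theta\to\Theta'\circ f$ compatible with all $\Theta_n,\Theta_n'$ (the modification equation), with $\Pi,\Pi'$ and with $M,M'$. * 2-morphisms $(f,m)\to(g,n)$: 2-morphisms $\beta:f\to g$ of $\mathcal B$ compatible with $m$ and $n$. It is a monoidal bicategory with the structure induced from $\mathcal B$: the tensor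 product of two fixed points lies over $c\otimes c'$ and has the 1-morphism $\Theta\otimes\Theta'$, the 2-morphism $M\otimes M'$, and as trivializations of $\alpha^n_{c\otimes c'}\cong\alpha^n_c\otimes\alpha^n_{c'}$ the tensor products of the trivializations $\lambda_n:\alpha^n_c\cong\mathrm{id}_c$ and $\lambda'_n$ that are given by $\Theta_n,M$ and $\Theta'_n,M'$; all remaining structure lies over that of $\mathcal B$. **Lemma.** For every symmetric monoidal bicategory $\mathcal C$ and every Serre action of $SO(2)$ on $\mathrm{core}(\mathcal C^{\mathrm{fd}})$, there is an equivalence of monoidal bicategories (a monoidal pseudofunctor whose underlying pseudofunctor is a biequivalence) $$\mathrm{Pic}\bigl(\mathrm{core}(\mathcal C^{\mathrm{fd}})^{SO(2)}\bigr)\;\simeq\;\mathrm{Pic}(\mathcal C)^{SO(2)},$$ where $SO(2)$ acts on $\mathrm{Pic}(\mathcal C)\subseteq\mathrm{core}(\mathcal C^{\mathrm{fd}})$ by the restriction of the given action. -/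

import Mathlib

open CategoryTheory Category Bicategory

universe w v u w' v' u' w₁ v₁ u₁

/-! ### Squares and cubes in a bicategory -/

section Squares

variable {C : Type u} [Bicategory.{w, v} C]

/-- A square of 1-morphisms filled by an invertible 2-morphism. -/
abbrev Sq {a a' b b' : C} (f : a ⟶ a') (p : a ⟶ b) (p' : a' ⟶ b') (g : b ⟶ b') :=
  f ≫ p' ≅ p ≫ g

namespace Sq

/-- The identity square on `p`. -/
def idTop {a b : C} (p : a ⟶ b) : Sq (𝟙 a) p p (𝟙 b) := λ_ p ≪≫ (ρ_ p).symm

/-- The identity square on `f`. -/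
def idSide {a b : C} (f : a ⟶ b) : Sq f (𝟙 a) (𝟙 b) f := ρ_ f ≪≫ (λ_ f).symm

/-- Pasting two squares along the 1-morphism `p'`. -/
def vcomp {a a' a'' b b' b'' : C} {f : a ⟶ a'} {f' : a' ⟶ a''} {p : a ⟶ b} {p' : a' ⟶ b'}
    {p'' : a'' ⟶ b''} {g : b ⟶ b'} {g' : b' ⟶ b''} (s : Sq f p p' g) (t : Sq f' p' p'' g') :
    Sq (f ≫ f') p p'' (g ≫ g') :=
  α_ f f' p'' ≪≫ whiskerLeftIso f t ≪≫ (α_ f p' g').symm ≪≫ whiskerRightIso s g' ≪≫ α_ p g g'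

/-- Pasting two squares along the 1-morphism `g`. -/
def hcomp {a a' b b' c c' : C} {f : a ⟶ a'} {p : a ⟶ b} {p' : a' ⟶ b'} {g : b ⟶ b'}
    {q : b ⟶ c} {q' : b' ⟶ c'} {h : c ⟶ c'} (s : Sq f p p' g) (t : Sq g q q' h) :
    Sq f (p ≫ q) (p' ≫ q') h :=
  (α_ f p' q').symm ≪≫ whiskerRightIso s q' ≪≫ α_ p g q' ≪≫ whiskerLeftIso p t ≪≫ (α_ p q h).symm

/-- The square for the inverse equivalences. -/
def inverse {a a' b b' : C} {f : a ⟶ a'} {e : a ≌ b} {e' : a' ≌ b'} {g : b ⟶ b'}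
    (s : Sq f e.hom e'.hom g) : Sq g e.inv e'.inv f :=
  (λ_ _).symm ≪≫ whiskerRightIso e.counit.symm (g ≫ e'.inv) ≪≫ α_ _ _ _ ≪≫
    whiskerLeftIso e.inv ((α_ _ _ _).symm ≪≫ whiskerRightIso s.symm e'.inv ≪≫ α_ _ _ _ ≪≫
      whiskerLeftIso f e'.unit.symm ≪≫ ρ_ f)

/-- Two squares `s` and `t`, joined by 2-morphisms between their corresponding edges, form a
commutative cube. -/
def Cube {a a' b b' : C} {f k : a ⟶ a'} {p q : a ⟶ b} {p' q' : a' ⟶ b'} {g l : b ⟶ b'}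
    (s : Sq f p p' g) (t : Sq k q q' l) (η : f ⟶ k) (μ : p ⟶ q) (μ' : p' ⟶ q') (θ : g ⟶ l) :
    Prop :=
  (η ▷ p' ≫ k ◁ μ') ≫ t.hom = s.hom ≫ p ◁ θ ≫ μ ▷ l

end Sq

end Squares

/-! ### Tensor products on a bicategory -/

/-- The data of a tensor product pseudofunctor and a unit object on a bicategory. -/
class TensorBicategory (C : Type u) [Bicategory.{w, v} C] where
  /-- The tensor product. -/
  tensor : (C × C) ⥤ᵖ C
  /-- The unit object. -/
  one : C

namespace TensorBicategory

variable {C : Type u} [Bicategory.{w, v} C] [TensorBicategory C]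

/-- The tensor product of objects. -/
def tObj (X Y : C) : C := tensor.obj (X, Y)

infixr:70 " ⊠ " => TensorBicategory.tObj

/-- The tensor product of 1-morphisms. -/
def tHom {X X' Y Y' : C} (f : X ⟶ X') (g : Y ⟶ Y') : X ⊠ Y ⟶ X' ⊠ Y' :=
  (tensor (C := C)).map (X := (X, Y)) (Y := (X', Y')) (f, g)

infixr:81 " ⊠₁ " => TensorBicategory.tHom

/-- The tensor product of 2-morphisms. -/
def tHom₂ {X X' Y Y' : C} {f f' : X ⟶ X'} {g g' : Y ⟶ Y'} (η : f ⟶ f') (θ : g ⟶ g') :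
    f ⊠₁ g ⟶ f' ⊠₁ g' :=
  (tensor (C := C)).map₂ (a := (X, Y)) (b := (X', Y')) (f := (f, g)) (g := (f', g')) (η, θ)

infixr:81 " ⊠₂ " => TensorBicategory.tHom₂

theorem tHom₂_id {X X' Y Y' : C} (f : X ⟶ X') (g : Y ⟶ Y') : 𝟙 f ⊠₂ 𝟙 g = 𝟙 (f ⊠₁ g) :=
  (tensor (C := C)).map₂_id (a := (X, Y)) (b := (X', Y')) (f, g)

theorem tHom₂_comp {X X' Y Y' : C} {f f' f'' : X ⟶ X'} {g g' g'' : Y ⟶ Y'} (η : f ⟶ f')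
    (η' : f' ⟶ f'') (θ : g ⟶ g') (θ' : g' ⟶ g'') :
    (η ≫ η') ⊠₂ (θ ≫ θ') = (η ⊠₂ θ) ≫ (η' ⊠₂ θ') :=
  (tensor (C := C)).map₂_comp (a := (X, Y)) (b := (X', Y')) (f := (f, g)) (g := (f', g'))
    (h := (f'', g'')) (η, θ) (η', θ')

/-- The tensor product of invertible 2-morphisms. -/
@[simps]
def tIso {X X' Y Y' : C} {f f' : X ⟶ X'} {g g' : Y ⟶ Y'} (η : f ≅ f') (θ : g ≅ g') :
    f ⊠₁ g ≅ f' ⊠₁ g' where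
  hom := η.hom ⊠₂ θ.hom
  inv := η.inv ⊠₂ θ.inv
  hom_inv_id := by rw [← tHom₂_comp, η.hom_inv_id, θ.hom_inv_id, tHom₂_id]
  inv_hom_id := by rw [← tHom₂_comp, η.inv_hom_id, θ.inv_hom_id, tHom₂_id]

/-- Compatibility of the tensor product with identities. -/
def tId (X Y : C) : 𝟙 X ⊠₁ 𝟙 Y ≅ 𝟙 (X ⊠ Y) :=
  (tensor (C := C)).mapId (X, Y)

/-- Compatibility of the tensor product with composition. -/
def tComp {X X' X'' Y Y' Y'' : C} (f : X ⟶ X') (f' : X' ⟶ X'') (g : Y ⟶ Y') (g' : Y' ⟶ Y'') :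
    (f ≫ f') ⊠₁ (g ≫ g') ≅ f ⊠₁ g ≫ f' ⊠₁ g' :=
  (tensor (C := C)).mapComp (a := (X, Y)) (b := (X', Y')) (c := (X'', Y'')) (f, g) (f', g')

/-- The 1-morphism `X ⊗ f`. -/
abbrev wl (X : C) {Y Y' : C} (f : Y ⟶ Y') : X ⊠ Y ⟶ X ⊠ Y' := 𝟙 X ⊠₁ f

/-- The 1-morphism `f ⊗ Y`. -/
abbrev wr {X X' : C} (f : X ⟶ X') (Y : C) : X ⊠ Y ⟶ X' ⊠ Y := f ⊠₁ 𝟙 Y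

/-- The invertible 2-morphism `X ⊗ η`. -/
abbrev wlIso (X : C) {Y Y' : C} {f f' : Y ⟶ Y'} (η : f ≅ f') : wl X f ≅ wl X f' :=
  tIso (Iso.refl _) η

/-- The invertible 2-morphism `η ⊗ Y`. -/
abbrev wrIso {X X' : C} {f f' : X ⟶ X'} (η : f ≅ f') (Y : C) : wr f Y ≅ wr f' Y :=
  tIso η (Iso.refl _)

/-- `X ⊗ (f ≫ g) ≅ (X ⊗ f) ≫ (X ⊗ g)`. -/
def wlComp (X : C) {Y Y' Y'' : C} (f : Y ⟶ Y') (g : Y' ⟶ Y'') :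
    wl X (f ≫ g) ≅ wl X f ≫ wl X g :=
  tIso (λ_ (𝟙 X)).symm (Iso.refl _) ≪≫ tComp _ _ _ _

/-- `(f ≫ g) ⊗ Y ≅ (f ⊗ Y) ≫ (g ⊗ Y)`. -/
def wrComp {X X' X'' : C} (f : X ⟶ X') (g : X' ⟶ X'') (Y : C) :
    wr (f ≫ g) Y ≅ wr f Y ≫ wr g Y :=
  tIso (Iso.refl _) (λ_ (𝟙 Y)).symm ≪≫ tComp _ _ _ _

/-- `X ⊗ (f ≫ g ≫ h) ≅ (X ⊗ f) ≫ (X ⊗ g) ≫ (X ⊗ h)`. -/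
def wlComp₃ (X : C) {Y Y' Y'' Y''' : C} (f : Y ⟶ Y') (g : Y' ⟶ Y'') (h : Y'' ⟶ Y''') :
    wl X (f ≫ g ≫ h) ≅ wl X f ≫ wl X g ≫ wl X h :=
  wlComp X f (g ≫ h) ≪≫ whiskerLeftIso _ (wlComp X g h)

/-- `(f ≫ g ≫ h) ⊗ Y ≅ (f ⊗ Y) ≫ (g ⊗ Y) ≫ (h ⊗ Y)`. -/
def wrComp₃ {X X' X'' X''' : C} (f : X ⟶ X') (g : X' ⟶ X'') (h : X'' ⟶ X''') (Y : C) :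
    wr (f ≫ g ≫ h) Y ≅ wr f Y ≫ wr g Y ≫ wr h Y :=
  wrComp f (g ≫ h) Y ≪≫ whiskerLeftIso _ (wrComp g h Y)

/-- The interchange `(f ⊗ Y) ≫ (X' ⊗ g) ≅ (X ⊗ g) ≫ (f ⊗ Y')`. -/
def interchange {X X' Y Y' : C} (f : X ⟶ X') (g : Y ⟶ Y') :
    wr f Y ≫ wl X' g ≅ wl X g ≫ wr f Y' :=
  (tComp _ _ _ _).symm ≪≫ tIso (ρ_ f ≪≫ (λ_ f).symm) (λ_ g ≪≫ (ρ_ g).symm) ≪≫ tComp _ _ _ _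

/-- The tensor product of squares. -/
def sqT {a a' b b' c c' d d' : C} {f : a ⟶ a'} {p : a ⟶ b} {p' : a' ⟶ b'} {g : b ⟶ b'}
    {k : c ⟶ c'} {q : c ⟶ d} {q' : c' ⟶ d'} {l : d ⟶ d'} (s : Sq f p p' g) (t : Sq k q q' l) :
    Sq (f ⊠₁ k) (p ⊠₁ q) (p' ⊠₁ q') (g ⊠₁ l) :=
  (tComp _ _ _ _).symm ≪≫ tIso s t ≪≫ tComp _ _ _ _

/-- The square `(f ⊗ k) ≫ (X' ⊗ q') ≅ (X ⊗ q) ≫ (f ⊗ l)`. -/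
def sqL {X X' c c' d d' : C} (f : X ⟶ X') {k : c ⟶ c'} {q : c ⟶ d} {q' : c' ⟶ d'} {l : d ⟶ d'}
    (t : Sq k q q' l) : Sq (f ⊠₁ k) (wl X q) (wl X' q') (f ⊠₁ l) :=
  sqT (Sq.idSide f) t

/-- The square `(f ⊗ k) ≫ (p' ⊗ Y') ≅ (p ⊗ Y) ≫ (g ⊗ k)`. -/
def sqR {Y Y' a a' b b' : C} {f : a ⟶ a'} {p : a ⟶ b} {p' : a' ⟶ b'} {g : b ⟶ b'}
    (s : Sq f p p' g) (k : Y ⟶ Y') : Sq (f ⊠₁ k) (wr p Y) (wr p' Y') (g ⊠₁ k) :=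
  sqT s (Sq.idSide k)

end TensorBicategory

open TensorBicategory

/-! ### Monoidal bicategories -/

/-- The data of a monoidal bicategory: associativity and unit equivalences, pseudonatural in all
arguments, and the components of the pentagonator and of the three 2-unitors. -/
class MonoidalBicategoryData (C : Type u) [Bicategory.{w, v} C] extends TensorBicategory C where
  /-- The associativity equivalences. -/
  assoc (X Y Z : C) : (X ⊠ Y) ⊠ Z ≌ X ⊠ (Y ⊠ Z)
  /-- The pseudonaturality squares of `assoc`. -/
  assocNat {X X' Y Y' Z Z' : C} (f : X ⟶ X') (g : Y ⟶ Y') (h : Z ⟶ Z') :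
    Sq ((f ⊠₁ g) ⊠₁ h) (assoc X Y Z).hom (assoc X' Y' Z').hom (f ⊠₁ (g ⊠₁ h))
  /-- The left unit equivalences. -/
  lUnit (X : C) : one ⊠ X ≌ X
  /-- The pseudonaturality squares of `lUnit`. -/
  lUnitNat {X X' : C} (f : X ⟶ X') : Sq (wl one f) (lUnit X).hom (lUnit X').hom f
  /-- The right unit equivalences. -/
  rUnit (X : C) : X ⊠ one ≌ X
  /-- The pseudonaturality squares of `rUnit`. -/
  rUnitNat {X X' : C} (f : X ⟶ X') : Sq (wr f one) (rUnit X).hom (rUnit X').hom f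
  /-- The pentagonator. -/
  pent (X Y Z W : C) : (assoc (X ⊠ Y) Z W).hom ≫ (assoc X Y (Z ⊠ W)).hom ≅
    wr (assoc X Y Z).hom W ≫ (assoc X (Y ⊠ Z) W).hom ≫ wl X (assoc Y Z W).hom
  /-- The middle 2-unitor. -/
  midUnitor (X Y : C) : (assoc X one Y).hom ≫ wl X (lUnit Y).hom ≅ wr (rUnit X).hom Y
  /-- The left 2-unitor. -/
  leftUnitor₂ (X Y : C) : (assoc one X Y).hom ≫ (lUnit (X ⊠ Y)).hom ≅ wr (lUnit X).hom Y
  /-- The right 2-unitor. -/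
  rightUnitor₂ (X Y : C) : (assoc X Y one).hom ≫ wl X (rUnit Y).hom ≅ (rUnit (X ⊠ Y)).hom

namespace MonoidalBicategoryData

section

variable {C : Type u} [Bicategory.{w, v} C] [MonoidalBicategoryData C]

/-- The associativity 1-morphism. -/
abbrev as (X Y Z : C) : (X ⊠ Y) ⊠ Z ⟶ X ⊠ (Y ⊠ Z) := (assoc X Y Z).hom

/-- The inverse associativity 1-morphism. -/
abbrev as' (X Y Z : C) : X ⊠ (Y ⊠ Z) ⟶ (X ⊠ Y) ⊠ Z := (assoc X Y Z).inv

/-- Naturality of the associativity in the first variable. -/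
def asNat₁ {X X' : C} (f : X ⟶ X') (Y Z : C) : Sq (wr (wr f Y) Z) (as X Y Z) (as X' Y Z)
    (wr f (Y ⊠ Z)) :=
  assocNat f (𝟙 Y) (𝟙 Z) ≪≫ whiskerLeftIso _ (tIso (Iso.refl f) (tId Y Z))

/-- Naturality of the associativity in the second variable. -/
def asNat₂ (X : C) {Y Y' : C} (f : Y ⟶ Y') (Z : C) : Sq (wr (wl X f) Z) (as X Y Z) (as X Y' Z)
    (wl X (wr f Z)) :=
  assocNat (𝟙 X) f (𝟙 Z)

/-- Naturality of the associativity in the third variable. -/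
def asNat₃ (X Y : C) {Z Z' : C} (f : Z ⟶ Z') : Sq (wl (X ⊠ Y) f) (as X Y Z) (as X Y Z')
    (wl X (wl Y f)) :=
  whiskerRightIso (tIso (tId X Y).symm (Iso.refl f)) _ ≪≫ assocNat (𝟙 X) (𝟙 Y) f

end

end MonoidalBicategoryData

open MonoidalBicategoryData

/-- A monoidal bicategory. -/
class MonoidalBicategory (C : Type u) [Bicategory.{w, v} C] extends MonoidalBicategoryData C where
  -- pseudonaturality of the associativity and unit equivalences
  assoc_naturality {X X' Y Y' Z Z' : C} {f f' : X ⟶ X'} {g g' : Y ⟶ Y'} {h h' : Z ⟶ Z'}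
    (η : f ⟶ f') (θ : g ⟶ g') (κ : h ⟶ h') :
    Sq.Cube (assocNat f g h) (assocNat f' g' h') ((η ⊠₂ θ) ⊠₂ κ) (𝟙 _) (𝟙 _) (η ⊠₂ (θ ⊠₂ κ))
  assoc_id (X Y Z : C) : Sq.Cube (assocNat (𝟙 X) (𝟙 Y) (𝟙 Z)) (Sq.idTop (as X Y Z))
    ((tId X Y).hom ⊠₂ 𝟙 _ ≫ (tId _ Z).hom) (𝟙 _) (𝟙 _) (𝟙 _ ⊠₂ (tId Y Z).hom ≫ (tId X _).hom)
  assoc_comp {X X' X'' Y Y' Y'' Z Z' Z'' : C} (f : X ⟶ X') (f' : X' ⟶ X'') (g : Y ⟶ Y')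
    (g' : Y' ⟶ Y'') (h : Z ⟶ Z') (h' : Z' ⟶ Z'') :
    Sq.Cube (assocNat (f ≫ f') (g ≫ g') (h ≫ h')) (Sq.vcomp (assocNat f g h) (assocNat f' g' h'))
      ((tComp f f' g g').hom ⊠₂ 𝟙 _ ≫ (tComp _ _ h h').hom) (𝟙 _) (𝟙 _)
      (𝟙 _ ⊠₂ (tComp g g' h h').hom ≫ (tComp f f' _ _).hom)
  lUnit_naturality {X X' : C} {f f' : X ⟶ X'} (η : f ⟶ f') :
    Sq.Cube (lUnitNat f) (lUnitNat f') (𝟙 _ ⊠₂ η) (𝟙 _) (𝟙 _) η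
  lUnit_id (X : C) : Sq.Cube (lUnitNat (𝟙 X)) (Sq.idTop _) (tId _ X).hom (𝟙 _) (𝟙 _) (𝟙 _)
  lUnit_comp {X X' X'' : C} (f : X ⟶ X') (f' : X' ⟶ X'') :
    Sq.Cube (lUnitNat (f ≫ f')) (Sq.vcomp (lUnitNat f) (lUnitNat f')) (wlComp _ f f').hom
      (𝟙 _) (𝟙 _) (𝟙 _)
  rUnit_naturality {X X' : C} {f f' : X ⟶ X'} (η : f ⟶ f') :
    Sq.Cube (rUnitNat f) (rUnitNat f') (η ⊠₂ 𝟙 _) (𝟙 _) (𝟙 _) η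
  rUnit_id (X : C) : Sq.Cube (rUnitNat (𝟙 X)) (Sq.idTop _) (tId X _).hom (𝟙 _) (𝟙 _) (𝟙 _)
  rUnit_comp {X X' X'' : C} (f : X ⟶ X') (f' : X' ⟶ X'') :
    Sq.Cube (rUnitNat (f ≫ f')) (Sq.vcomp (rUnitNat f) (rUnitNat f')) (wrComp f f' _).hom
      (𝟙 _) (𝟙 _) (𝟙 _)
  -- the pentagonator and the 2-unitors are modifications
  pent_naturality {X X' Y Y' Z Z' W W' : C} (f : X ⟶ X') (g : Y ⟶ Y') (h : Z ⟶ Z') (k : W ⟶ W') :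
    Sq.Cube (Sq.hcomp (assocNat (f ⊠₁ g) h k) (assocNat f g (h ⊠₁ k)))
      (Sq.hcomp (sqR (assocNat f g h) k)
        (Sq.hcomp (assocNat f (g ⊠₁ h) k) (sqL f (assocNat g h k))))
      (𝟙 _) (pent X Y Z W).hom (pent X' Y' Z' W').hom (𝟙 _)
  midUnitor_naturality {X X' Y Y' : C} (f : X ⟶ X') (g : Y ⟶ Y') :
    Sq.Cube (Sq.hcomp (assocNat f (𝟙 one) g) (sqL f (lUnitNat g))) (sqR (rUnitNat f) g)
      (𝟙 _) (midUnitor X Y).hom (midUnitor X' Y').hom (𝟙 _)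
  leftUnitor₂_naturality {X X' Y Y' : C} (f : X ⟶ X') (g : Y ⟶ Y') :
    Sq.Cube (Sq.hcomp (assocNat (𝟙 one) f g) (lUnitNat (f ⊠₁ g))) (sqR (lUnitNat f) g)
      (𝟙 _) (leftUnitor₂ X Y).hom (leftUnitor₂ X' Y').hom (𝟙 _)
  rightUnitor₂_naturality {X X' Y Y' : C} (f : X ⟶ X') (g : Y ⟶ Y') :
    Sq.Cube (Sq.hcomp (assocNat f g (𝟙 one)) (sqL f (rUnitNat g))) (rUnitNat (f ⊠₁ g))
      (𝟙 _) (rightUnitor₂ X Y).hom (rightUnitor₂ X' Y').hom (𝟙 _)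
  /-- The nonabelian 4-cocycle condition. -/
  cocycle (X Y Z W V : C) :
    as ((X ⊠ Y) ⊠ Z) W V ◁ (pent X Y Z (W ⊠ V)).hom ⊗≫
      (asNat₁ (as X Y Z) W V).inv ▷ (as X (Y ⊠ Z) (W ⊠ V) ≫ wl X (as Y Z (W ⊠ V))) ⊗≫
      wr (wr (as X Y Z) W) V ◁ ((pent X (Y ⊠ Z) W V).hom ▷ wl X (as Y Z (W ⊠ V))) ⊗≫
      wr (wr (as X Y Z) W) V ◁ wr (as X (Y ⊠ Z) W) V ◁ as X ((Y ⊠ Z) ⊠ W) V ◁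
        ((wlComp X _ _).inv ≫ (wlIso X (pent Y Z W V)).hom ≫ (wlComp₃ X _ _ _).hom) ⊗≫
      wr (wr (as X Y Z) W) V ◁ wr (as X (Y ⊠ Z) W) V ◁
        ((asNat₂ X (as Y Z W) V).inv ▷ (wl X (as Y (Z ⊠ W) V) ≫ wl X (wl Y (as Z W V)))) ⊗≫
      𝟙 (wr (wr (as X Y Z) W) V ≫ wr (as X (Y ⊠ Z) W) V ≫ wr (wl X (as Y Z W)) V ≫
        as X (Y ⊠ (Z ⊠ W)) V ≫ wl X (as Y (Z ⊠ W) V) ≫ wl X (wl Y (as Z W V))) =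
    𝟙 (as ((X ⊠ Y) ⊠ Z) W V ≫ as (X ⊠ Y) Z (W ⊠ V) ≫ as X Y (Z ⊠ (W ⊠ V))) ⊗≫
      (pent (X ⊠ Y) Z W V).hom ▷ as X Y (Z ⊠ (W ⊠ V)) ⊗≫
      wr (as (X ⊠ Y) Z W) V ◁ as (X ⊠ Y) (Z ⊠ W) V ◁ (asNat₃ X Y (as Z W V)).hom ⊗≫
      wr (as (X ⊠ Y) Z W) V ◁ ((pent X Y (Z ⊠ W) V).hom ▷ wl X (wl Y (as Z W V))) ⊗≫
      ((wrComp _ _ V).inv ≫ (wrIso (pent X Y Z W) V).hom ≫ (wrComp₃ _ _ _ V).hom) ▷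
        (as X (Y ⊠ (Z ⊠ W)) V ≫ wl X (as Y (Z ⊠ W) V) ≫ wl X (wl Y (as Z W V))) ⊗≫
      𝟙 (wr (wr (as X Y Z) W) V ≫ wr (as X (Y ⊠ Z) W) V ≫ wr (wl X (as Y Z W)) V ≫
        as X (Y ⊠ (Z ⊠ W)) V ≫ wl X (as Y (Z ⊠ W) V) ≫ wl X (wl Y (as Z W V)))
  /-- The left normalization condition. -/
  left_normalization (X Y Z : C) :
    as (X ⊠ one) Y Z ◁ (midUnitor X (Y ⊠ Z)).hom ⊗≫ (asNat₁ (rUnit X).hom Y Z).inv =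
    𝟙 (as (X ⊠ one) Y Z ≫ as X one (Y ⊠ Z) ≫ wl X (lUnit (Y ⊠ Z)).hom) ⊗≫
      (pent X one Y Z).hom ▷ wl X (lUnit (Y ⊠ Z)).hom ⊗≫
      wr (as X one Y) Z ◁ as X (one ⊠ Y) Z ◁
        ((wlComp X _ _).inv ≫ (wlIso X (leftUnitor₂ Y Z)).hom) ⊗≫
      wr (as X one Y) Z ◁ (asNat₂ X (lUnit Y).hom Z).inv ⊗≫
      ((wrComp _ _ Z).inv ≫ (wrIso (midUnitor X Y) Z).hom) ▷ as X Y Z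
  /-- The right normalization condition. -/
  right_normalization (X Y Z : C) :
    as (X ⊠ Y) one Z ◁ (asNat₃ X Y (lUnit Z).hom).inv ⊗≫ (midUnitor (X ⊠ Y) Z).hom ▷ as X Y Z =
    𝟙 (as (X ⊠ Y) one Z ≫ as X Y (one ⊠ Z) ≫ wl X (wl Y (lUnit Z).hom)) ⊗≫
      (pent X Y one Z).hom ▷ wl X (wl Y (lUnit Z).hom) ⊗≫
      wr (as X Y one) Z ◁ as X (Y ⊠ one) Z ◁
        ((wlComp X _ _).inv ≫ (wlIso X (midUnitor Y Z)).hom) ⊗≫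
      wr (as X Y one) Z ◁ (asNat₂ X (rUnit Y).hom Z).inv ⊗≫
      ((wrComp _ _ Z).inv ≫ (wrIso (rightUnitor₂ X Y) Z).hom) ▷ as X Y Z

/-! ### Symmetric monoidal bicategories -/

section Mates

variable {C : Type u} [Bicategory.{w, v} C]

/-- The unit of a composite of equivalences. -/
def unitComp {A B D : C} {p : A ⟶ B} {p' : B ⟶ A} {q : B ⟶ D} {q' : D ⟶ B}
    (c : 𝟙 A ≅ p ≫ p') (d : 𝟙 B ≅ q ≫ q') : 𝟙 A ≅ (p ≫ q) ≫ q' ≫ p' :=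
  c ≪≫ whiskerLeftIso p ((λ_ p').symm ≪≫ whiskerRightIso d p' ≪≫ α_ q q' p') ≪≫
    (α_ p q (q' ≫ p')).symm

/-- The counit of a composite of equivalences. -/
def counitComp {A B D : C} {p : A ⟶ B} {p' : B ⟶ A} {q : B ⟶ D} {q' : D ⟶ B}
    (c : p' ≫ p ≅ 𝟙 B) (d : q' ≫ q ≅ 𝟙 D) : (q' ≫ p') ≫ p ≫ q ≅ 𝟙 D :=
  α_ q' p' (p ≫ q) ≪≫ whiskerLeftIso q' ((α_ p' p q).symm ≪≫ whiskerRightIso c q ≪≫ λ_ q) ≪≫ d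

/-- The mate of an invertible 2-morphism between equivalences. -/
def mateIso {A B : C} {p q : A ⟶ B} {p' q' : B ⟶ A} (c : p' ≫ p ≅ 𝟙 B) (d : 𝟙 A ≅ q ≫ q')
    (θ : p ≅ q) : p' ≅ q' :=
  (ρ_ p').symm ≪≫ whiskerLeftIso p' (d ≪≫ whiskerRightIso θ.symm q') ≪≫ (α_ p' p q').symm ≪≫
    whiskerRightIso c q' ≪≫ λ_ q'

end Mates

namespace TensorBicategory

variable {C : Type u} [Bicategory.{w, v} C] [TensorBicategory C]

/-- The unit of the equivalence `X ⊗ e`. -/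
def wlUnit (X : C) {Y Z : C} (e : Y ≌ Z) : 𝟙 (X ⊠ Y) ≅ wl X e.hom ≫ wl X e.inv :=
  (tId X Y).symm ≪≫ wlIso X e.unit ≪≫ wlComp X _ _

/-- The counit of the equivalence `X ⊗ e`. -/
def wlCounit (X : C) {Y Z : C} (e : Y ≌ Z) : wl X e.inv ≫ wl X e.hom ≅ 𝟙 (X ⊠ Z) :=
  (wlComp X _ _).symm ≪≫ wlIso X e.counit ≪≫ tId X Z

/-- The unit of the equivalence `e ⊗ X`. -/
def wrUnit {Y Z : C} (e : Y ≌ Z) (X : C) : 𝟙 (Y ⊠ X) ≅ wr e.hom X ≫ wr e.inv X :=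
  (tId Y X).symm ≪≫ wrIso e.unit X ≪≫ wrComp _ _ X

/-- The counit of the equivalence `e ⊗ X`. -/
def wrCounit {Y Z : C} (e : Y ≌ Z) (X : C) : wr e.inv X ≫ wr e.hom X ≅ 𝟙 (Z ⊠ X) :=
  (wrComp _ _ X).symm ≪≫ wrIso e.counit X ≪≫ tId Z X

/-- Compatibility of `X ⊗ -` with fivefold composites. -/
def wlComp₅ (X : C) {Y₀ Y₁ Y₂ Y₃ Y₄ Y₅ : C} (f₁ : Y₀ ⟶ Y₁) (f₂ : Y₁ ⟶ Y₂) (f₃ : Y₂ ⟶ Y₃)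
    (f₄ : Y₃ ⟶ Y₄) (f₅ : Y₄ ⟶ Y₅) :
    wl X (f₁ ≫ f₂ ≫ f₃ ≫ f₄ ≫ f₅) ≅ wl X f₁ ≫ wl X f₂ ≫ wl X f₃ ≫ wl X f₄ ≫ wl X f₅ :=
  wlComp₃ X _ _ _ ≪≫ whiskerLeftIso _ (whiskerLeftIso _ (wlComp₃ X _ _ _))

/-- Compatibility of `- ⊗ X` with fivefold composites. -/
def wrComp₅ {Y₀ Y₁ Y₂ Y₃ Y₄ Y₅ : C} (f₁ : Y₀ ⟶ Y₁) (f₂ : Y₁ ⟶ Y₂) (f₃ : Y₂ ⟶ Y₃)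
    (f₄ : Y₃ ⟶ Y₄) (f₅ : Y₄ ⟶ Y₅) (X : C) :
    wr (f₁ ≫ f₂ ≫ f₃ ≫ f₄ ≫ f₅) X ≅ wr f₁ X ≫ wr f₂ X ≫ wr f₃ X ≫ wr f₄ X ≫ wr f₅ X :=
  wrComp₃ _ _ _ X ≪≫ whiskerLeftIso _ (whiskerLeftIso _ (wrComp₃ _ _ _ X))

end TensorBicategory

namespace MonoidalBicategoryData

variable {C : Type u} [Bicategory.{w, v} C] [MonoidalBicategoryData C]

/-- The pentagonator for the inverse associativities. -/
def pent' (X Y Z W : C) : as' X Y (Z ⊠ W) ≫ as' (X ⊠ Y) Z W ≅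
    (wl X (as' Y Z W) ≫ as' X (Y ⊠ Z) W) ≫ wr (as' X Y Z) W :=
  mateIso (counitComp (assoc (X ⊠ Y) Z W).counit (assoc X Y (Z ⊠ W)).counit)
    (unitComp (wrUnit (assoc X Y Z) W)
      (unitComp (assoc X (Y ⊠ Z) W).unit (wlUnit X (assoc Y Z W)))) (pent X Y Z W)

/-- A variant of the pentagonator. -/
def pentA (X Y Z W : C) : wr (as' X Y Z) W ≫ as (X ⊠ Y) Z W ≫ as X Y (Z ⊠ W) ≅
    as X (Y ⊠ Z) W ≫ wl X (as Y Z W) :=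
  whiskerLeftIso _ (pent X Y Z W) ≪≫ (α_ _ _ _).symm ≪≫
    whiskerRightIso (wrCounit (assoc X Y Z) W) _ ≪≫ λ_ _

/-- A variant of the pentagonator for the inverse associativities. -/
def pentB (X Y Z W : C) : as X Y (Z ⊠ W) ≫ wl X (as' Y Z W) ≫ as' X (Y ⊠ Z) W ≅
    as' (X ⊠ Y) Z W ≫ wr (as X Y Z) W :=
  (ρ_ _).symm ≪≫ whiskerLeftIso _ (wrCounit (assoc X Y Z) W).symm ≪≫
    (α_ _ _ _) ≪≫ whiskerLeftIso _ ((α_ _ _ _).symm ≪≫ whiskerRightIso (pent' X Y Z W).symm _ ≪≫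
      α_ _ _ _) ≪≫ (α_ _ _ _).symm ≪≫ whiskerRightIso (assoc X Y (Z ⊠ W)).unit.symm _ ≪≫ λ_ _

end MonoidalBicategoryData

/-- The data of a symmetric monoidal bicategory: a pseudonatural braiding equivalence, the
components of the two hexagonators and of the syllepsis. -/
class SymmetricMonoidalBicategoryData (C : Type u) [Bicategory.{w, v} C] extends
    MonoidalBicategory C where
  /-- The braiding equivalences. -/
  braid (X Y : C) : X ⊠ Y ≌ Y ⊠ X
  /-- The pseudonaturality squares of the braiding. -/
  braidNat {X X' Y Y' : C} (f : X ⟶ X') (g : Y ⟶ Y') :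
    Sq (f ⊠₁ g) (braid X Y).hom (braid X' Y').hom (g ⊠₁ f)
  /-- The hexagonator for braiding one object past two. -/
  hexR (X Y Z : C) : as X Y Z ≫ (braid X (Y ⊠ Z)).hom ≫ as Y Z X ≅
    wr (braid X Y).hom Z ≫ as Y X Z ≫ wl Y (braid X Z).hom
  /-- The hexagonator for braiding two objects past one. -/
  hexS (X Y Z : C) : as' X Y Z ≫ (braid (X ⊠ Y) Z).hom ≫ as' Z X Y ≅
    wl X (braid Y Z).hom ≫ as' X Z Y ≫ wr (braid X Z).hom Y
  /-- The syllepsis. -/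
  syl (X Y : C) : 𝟙 (X ⊠ Y) ≅ (braid X Y).hom ≫ (braid Y X).hom

namespace SymmetricMonoidalBicategoryData

variable {C : Type u} [Bicategory.{w, v} C] [SymmetricMonoidalBicategoryData C]

/-- The braiding 1-morphism. -/
abbrev br (X Y : C) : X ⊠ Y ⟶ Y ⊠ X := (braid X Y).hom

/-- Naturality of the braiding in the second variable. -/
def brNat₂ (X : C) {Y Y' : C} (f : Y ⟶ Y') : Sq (wl X f) (br X Y) (br X Y') (wr f X) :=
  braidNat (𝟙 X) f

/-- Naturality of the braiding in the first variable. -/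
def brNat₁ {X X' : C} (f : X ⟶ X') (Y : C) : Sq (wr f Y) (br X Y) (br X' Y) (wl Y f) :=
  braidNat f (𝟙 Y)

/-- The braiding of one object past two, expressed through `hexR`. -/
def brR (X Y Z : C) : br X (Y ⊠ Z) ≅
    as' X Y Z ≫ wr (br X Y) Z ≫ as Y X Z ≫ wl Y (br X Z) ≫ as' Y Z X :=
  (λ_ _).symm ≪≫ whiskerRightIso (assoc X Y Z).counit.symm _ ≪≫ α_ _ _ _ ≪≫
    whiskerLeftIso _ (whiskerLeftIso _ ((ρ_ _).symm ≪≫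
      whiskerLeftIso _ (assoc Y Z X).unit ≪≫ (α_ _ _ _).symm) ≪≫ (α_ _ _ _).symm ≪≫
      whiskerRightIso (hexR X Y Z) _ ≪≫ α_ _ _ _ ≪≫ whiskerLeftIso _ (α_ _ _ _))

/-- The braiding of two objects past one, expressed through `hexS`. -/
def brS (X Y Z : C) : br (X ⊠ Y) Z ≅
    as X Y Z ≫ wl X (br Y Z) ≫ as' X Z Y ≫ wr (br X Z) Y ≫ as Z X Y :=
  (λ_ _).symm ≪≫ whiskerRightIso (assoc X Y Z).unit _ ≪≫ α_ _ _ _ ≪≫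
    whiskerLeftIso _ (whiskerLeftIso _ ((ρ_ _).symm ≪≫
      whiskerLeftIso _ (assoc Z X Y).counit.symm ≪≫ (α_ _ _ _).symm) ≪≫ (α_ _ _ _).symm ≪≫
      whiskerRightIso (hexS X Y Z) _ ≪≫ α_ _ _ _ ≪≫ whiskerLeftIso _ (α_ _ _ _))

end SymmetricMonoidalBicategoryData

open SymmetricMonoidalBicategoryData

/-- A symmetric monoidal bicategory. -/
class SymmetricMonoidalBicategory (C : Type u) [Bicategory.{w, v} C] extends
    SymmetricMonoidalBicategoryData C where
  -- pseudonaturality of the braiding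
  braid_naturality {X X' Y Y' : C} {f f' : X ⟶ X'} {g g' : Y ⟶ Y'} (η : f ⟶ f') (θ : g ⟶ g') :
    Sq.Cube (braidNat f g) (braidNat f' g') (η ⊠₂ θ) (𝟙 _) (𝟙 _) (θ ⊠₂ η)
  braid_id (X Y : C) : Sq.Cube (braidNat (𝟙 X) (𝟙 Y)) (Sq.idTop (br X Y)) (tId X Y).hom
    (𝟙 _) (𝟙 _) (tId Y X).hom
  braid_comp {X X' X'' Y Y' Y'' : C} (f : X ⟶ X') (f' : X' ⟶ X'') (g : Y ⟶ Y') (g' : Y' ⟶ Y'') :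
    Sq.Cube (braidNat (f ≫ f') (g ≫ g')) (Sq.vcomp (braidNat f g) (braidNat f' g'))
      (tComp f f' g g').hom (𝟙 _) (𝟙 _) (tComp g g' f f').hom
  -- the hexagonators and the syllepsis are modifications
  hexR_naturality {X X' Y Y' Z Z' : C} (f : X ⟶ X') (g : Y ⟶ Y') (h : Z ⟶ Z') :
    Sq.Cube (Sq.hcomp (assocNat f g h) (Sq.hcomp (braidNat f (g ⊠₁ h)) (assocNat g h f)))
      (Sq.hcomp (sqR (braidNat f g) h) (Sq.hcomp (assocNat g f h) (sqL g (braidNat f h))))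
      (𝟙 _) (hexR X Y Z).hom (hexR X' Y' Z').hom (𝟙 _)
  hexS_naturality {X X' Y Y' Z Z' : C} (f : X ⟶ X') (g : Y ⟶ Y') (h : Z ⟶ Z') :
    Sq.Cube (Sq.hcomp (Sq.inverse (assocNat f g h))
        (Sq.hcomp (braidNat (f ⊠₁ g) h) (Sq.inverse (assocNat h f g))))
      (Sq.hcomp (sqL f (braidNat g h))
        (Sq.hcomp (Sq.inverse (assocNat f h g)) (sqR (braidNat f h) g)))
      (𝟙 _) (hexS X Y Z).hom (hexS X' Y' Z').hom (𝟙 _)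
  syl_naturality {X X' Y Y' : C} (f : X ⟶ X') (g : Y ⟶ Y') :
    Sq.Cube (Sq.idSide (f ⊠₁ g)) (Sq.hcomp (braidNat f g) (braidNat g f))
      (𝟙 _) (syl X Y).hom (syl X' Y').hom (𝟙 _)
  /-- The two ways of braiding one object past three agree. -/
  braid_one_three (X Y Z W : C) :
    𝟙 (wr (as X Y Z) W ≫ as X (Y ⊠ Z) W ≫ wl X (as Y Z W) ≫ br X (Y ⊠ (Z ⊠ W)) ≫
        as Y (Z ⊠ W) X ≫ wl Y (as Z W X)) ⊗≫
      wr (as X Y Z) W ◁ as X (Y ⊠ Z) W ◁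
        ((brNat₂ X (as Y Z W)).hom ▷ (as Y (Z ⊠ W) X ≫ wl Y (as Z W X))) ⊗≫
      wr (as X Y Z) W ◁ as X (Y ⊠ Z) W ◁ br X ((Y ⊠ Z) ⊠ W) ◁ (pent Y Z W X).inv ⊗≫
      wr (as X Y Z) W ◁ ((hexR X (Y ⊠ Z) W).hom ▷ as Y Z (W ⊠ X)) ⊗≫
      wr (as X Y Z) W ◁ wr (br X (Y ⊠ Z)) W ◁ as (Y ⊠ Z) X W ◁ (asNat₃ Y Z (br X W)).hom ⊗≫
      wr (as X Y Z) W ◁ wr (br X (Y ⊠ Z)) W ◁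
        ((pent Y Z X W).hom ▷ wl Y (wl Z (br X W))) ⊗≫
      ((wrComp₃ _ _ _ W).inv ≫ (wrIso (hexR X Y Z) W).hom ≫ (wrComp₃ _ _ _ W).hom) ▷
        (as Y (Z ⊠ X) W ≫ wl Y (as Z X W) ≫ wl Y (wl Z (br X W))) ⊗≫
      𝟙 (wr (wr (br X Y) Z) W ≫ wr (as Y X Z) W ≫ wr (wl Y (br X Z)) W ≫ as Y (Z ⊠ X) W ≫
        wl Y (as Z X W) ≫ wl Y (wl Z (br X W))) =
    𝟙 (wr (as X Y Z) W ≫ as X (Y ⊠ Z) W ≫ wl X (as Y Z W) ≫ br X (Y ⊠ (Z ⊠ W)) ≫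
        as Y (Z ⊠ W) X ≫ wl Y (as Z W X)) ⊗≫
      (pent X Y Z W).inv ▷ (br X (Y ⊠ (Z ⊠ W)) ≫ as Y (Z ⊠ W) X ≫ wl Y (as Z W X)) ⊗≫
      as (X ⊠ Y) Z W ◁ ((hexR X Y (Z ⊠ W)).hom ▷ wl Y (as Z W X)) ⊗≫
      (asNat₁ (br X Y) Z W).inv ▷ (as Y X (Z ⊠ W) ≫ wl Y (br X (Z ⊠ W)) ≫ wl Y (as Z W X)) ⊗≫
      wr (wr (br X Y) Z) W ◁
        ((pent Y X Z W).hom ▷ (wl Y (br X (Z ⊠ W)) ≫ wl Y (as Z W X))) ⊗≫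
      wr (wr (br X Y) Z) W ◁ wr (as Y X Z) W ◁ as Y (X ⊠ Z) W ◁
        ((wlComp₃ Y _ _ _).inv ≫ (wlIso Y (hexR X Z W)).hom ≫ (wlComp₃ Y _ _ _).hom) ⊗≫
      wr (wr (br X Y) Z) W ◁ wr (as Y X Z) W ◁
        ((asNat₂ Y (br X Z) W).inv ▷ (wl Y (as Z X W) ≫ wl Y (wl Z (br X W)))) ⊗≫
      𝟙 (wr (wr (br X Y) Z) W ≫ wr (as Y X Z) W ≫ wr (wl Y (br X Z)) W ≫ as Y (Z ⊠ X) W ≫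
        wl Y (as Z X W) ≫ wl Y (wl Z (br X W)))
  /-- The two ways of braiding three objects past one agree. -/
  braid_three_one (X Y Z W : C) :
    𝟙 (wl X (as' Y Z W) ≫ as' X (Y ⊠ Z) W ≫ wr (as' X Y Z) W ≫ br ((X ⊠ Y) ⊠ Z) W ≫
        as' W (X ⊠ Y) Z ≫ wr (as' W X Y) Z) ⊗≫
      wl X (as' Y Z W) ◁ as' X (Y ⊠ Z) W ◁
        ((brNat₁ (as' X Y Z) W).hom ▷ (as' W (X ⊠ Y) Z ≫ wr (as' W X Y) Z)) ⊗≫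
      wl X (as' Y Z W) ◁ as' X (Y ⊠ Z) W ◁ br (X ⊠ (Y ⊠ Z)) W ◁ (pent' W X Y Z).inv ⊗≫
      wl X (as' Y Z W) ◁ ((hexS X (Y ⊠ Z) W).hom ▷ as' (W ⊠ X) Y Z) ⊗≫
      wl X (as' Y Z W) ◁ wl X (br (Y ⊠ Z) W) ◁ as' X W (Y ⊠ Z) ◁
        (Sq.inverse (asNat₁ (br X W) Y Z)).hom ⊗≫
      wl X (as' Y Z W) ◁ wl X (br (Y ⊠ Z) W) ◁
        ((pent' X W Y Z).hom ▷ wr (wr (br X W) Y) Z) ⊗≫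
      ((wlComp₃ X _ _ _).inv ≫ (wlIso X (hexS Y Z W)).hom ≫ (wlComp₃ X _ _ _).hom) ▷
        (as' X (W ⊠ Y) Z ≫ wr (as' X W Y) Z ≫ wr (wr (br X W) Y) Z) ⊗≫
      𝟙 (wl X (wl Y (br Z W)) ≫ wl X (as' Y W Z) ≫ wl X (wr (br Y W) Z) ≫ as' X (W ⊠ Y) Z ≫
        wr (as' X W Y) Z ≫ wr (wr (br X W) Y) Z) =
    𝟙 (wl X (as' Y Z W) ≫ as' X (Y ⊠ Z) W ≫ wr (as' X Y Z) W ≫ br ((X ⊠ Y) ⊠ Z) W ≫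
        as' W (X ⊠ Y) Z ≫ wr (as' W X Y) Z) ⊗≫
      (pent' X Y Z W).inv ▷ (br ((X ⊠ Y) ⊠ Z) W ≫ as' W (X ⊠ Y) Z ≫ wr (as' W X Y) Z) ⊗≫
      as' X Y (Z ⊠ W) ◁ ((hexS (X ⊠ Y) Z W).hom ▷ wr (as' W X Y) Z) ⊗≫
      (Sq.inverse (asNat₃ X Y (br Z W))).inv ▷
        (as' (X ⊠ Y) W Z ≫ wr (br (X ⊠ Y) W) Z ≫ wr (as' W X Y) Z) ⊗≫
      wl X (wl Y (br Z W)) ◁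
        ((pent' X Y W Z).hom ▷ (wr (br (X ⊠ Y) W) Z ≫ wr (as' W X Y) Z)) ⊗≫
      wl X (wl Y (br Z W)) ◁ wl X (as' Y W Z) ◁ as' X (Y ⊠ W) Z ◁
        ((wrComp₃ _ _ _ Z).inv ≫ (wrIso (hexS X Y W) Z).hom ≫ (wrComp₃ _ _ _ Z).hom) ⊗≫
      wl X (wl Y (br Z W)) ◁ wl X (as' Y W Z) ◁
        ((Sq.inverse (asNat₂ X (br Y W) Z)).inv ▷ (wr (as' X W Y) Z ≫ wr (wr (br X W) Y) Z)) ⊗≫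
      𝟙 (wl X (wl Y (br Z W)) ≫ wl X (as' Y W Z) ≫ wl X (wr (br Y W) Z) ≫ as' X (W ⊠ Y) Z ≫
        wr (as' X W Y) Z ≫ wr (wr (br X W) Y) Z)
  /-- The two ways of braiding two objects past two agree. -/
  braid_two_two (X Y Z W : C) :
    as (X ⊠ Y) Z W ◁ ((brR (X ⊠ Y) Z W).hom ▷ as' (Z ⊠ W) X Y) ⊗≫
      (assoc (X ⊠ Y) Z W).unit.inv ▷ (wr (br (X ⊠ Y) Z) W ≫ as Z (X ⊠ Y) W ≫
        wl Z (br (X ⊠ Y) W) ≫ as' Z W (X ⊠ Y) ≫ as' (Z ⊠ W) X Y) ⊗≫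
      wr (br (X ⊠ Y) Z) W ◁ as Z (X ⊠ Y) W ◁ wl Z (br (X ⊠ Y) W) ◁ (pent' Z W X Y).hom ⊗≫
      wr (br (X ⊠ Y) Z) W ◁ as Z (X ⊠ Y) W ◁
        (((wlIso Z (brS X Y W)).hom ≫ (wlComp₅ Z _ _ _ _ _).hom) ▷
          (wl Z (as' W X Y) ≫ as' Z (W ⊠ X) Y ≫ wr (as' Z W X) Y)) ⊗≫
      wr (br (X ⊠ Y) Z) W ◁ as Z (X ⊠ Y) W ◁ wl Z (as X Y W) ◁ wl Z (wl X (br Y W)) ◁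
        wl Z (as' X W Y) ◁ wl Z (wr (br X W) Y) ◁
          ((wlUnit Z (assoc W X Y)).inv ▷ (as' Z (W ⊠ X) Y ≫ wr (as' Z W X) Y)) ⊗≫
      ((wrIso (brS X Y Z) W).hom ≫ (wrComp₅ _ _ _ _ _ W).hom) ▷
        (as Z (X ⊠ Y) W ≫ wl Z (as X Y W) ≫ wl Z (wl X (br Y W)) ≫ wl Z (as' X W Y) ≫
          wl Z (wr (br X W) Y) ≫ as' Z (W ⊠ X) Y ≫ wr (as' Z W X) Y) ⊗≫
      wr (as X Y Z) W ◁ wr (wl X (br Y Z)) W ◁ wr (as' X Z Y) W ◁ wr (wr (br X Z) Y) W ◁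
        ((pent Z X Y W).inv ▷ (wl Z (wl X (br Y W)) ≫ wl Z (as' X W Y) ≫
          wl Z (wr (br X W) Y) ≫ as' Z (W ⊠ X) Y ≫ wr (as' Z W X) Y)) ⊗≫
      wr (as X Y Z) W ◁ wr (wl X (br Y Z)) W ◁ wr (as' X Z Y) W ◁
        ((asNat₁ (br X Z) Y W).hom ▷ (as Z X (Y ⊠ W) ≫ wl Z (wl X (br Y W)) ≫
          wl Z (as' X W Y) ≫ wl Z (wr (br X W) Y) ≫ as' Z (W ⊠ X) Y ≫ wr (as' Z W X) Y)) ⊗≫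
      wr (as X Y Z) W ◁ wr (wl X (br Y Z)) W ◁ wr (as' X Z Y) W ◁ as (X ⊠ Z) Y W ◁
        wr (br X Z) (Y ⊠ W) ◁ ((asNat₃ Z X (br Y W)).inv ▷
          (wl Z (as' X W Y) ≫ wl Z (wr (br X W) Y) ≫ as' Z (W ⊠ X) Y ≫ wr (as' Z W X) Y)) ⊗≫
      wr (as X Y Z) W ◁ wr (wl X (br Y Z)) W ◁ wr (as' X Z Y) W ◁ as (X ⊠ Z) Y W ◁
        wr (br X Z) (Y ⊠ W) ◁ wl (Z ⊠ X) (br Y W) ◁ as Z X (W ⊠ Y) ◁ wl Z (as' X W Y) ◁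
          ((Sq.inverse (asNat₂ Z (br X W) Y)).hom ▷ wr (as' Z W X) Y) ⊗≫
      wr (as X Y Z) W ◁ wr (wl X (br Y Z)) W ◁ wr (as' X Z Y) W ◁ as (X ⊠ Z) Y W ◁
        wr (br X Z) (Y ⊠ W) ◁ wl (Z ⊠ X) (br Y W) ◁
          ((pentB Z X W Y).hom ▷ (wr (wl Z (br X W)) Y ≫ wr (as' Z W X) Y)) ⊗≫
      wr (as X Y Z) W ◁ wr (wl X (br Y Z)) W ◁ wr (as' X Z Y) W ◁ as (X ⊠ Z) Y W ◁
        ((interchange (br X Z) (br Y W)).hom ▷ (as' (Z ⊠ X) W Y ≫ wr (as Z X W) Y ≫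
          wr (wl Z (br X W)) Y ≫ wr (as' Z W X) Y)) ⊗≫
      𝟙 (wr (as X Y Z) W ≫ wr (wl X (br Y Z)) W ≫ wr (as' X Z Y) W ≫ as (X ⊠ Z) Y W ≫
        wl (X ⊠ Z) (br Y W) ≫ wr (br X Z) (W ⊠ Y) ≫ as' (Z ⊠ X) W Y ≫ wr (as Z X W) Y ≫
          wr (wl Z (br X W)) Y ≫ wr (as' Z W X) Y) =
    as (X ⊠ Y) Z W ◁ ((brS X Y (Z ⊠ W)).hom ▷ as' (Z ⊠ W) X Y) ⊗≫
      as (X ⊠ Y) Z W ◁ as X Y (Z ⊠ W) ◁ wl X (br Y (Z ⊠ W)) ◁ as' X (Z ⊠ W) Y ◁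
        wr (br X (Z ⊠ W)) Y ◁ (assoc (Z ⊠ W) X Y).unit.inv ⊗≫
      (pent X Y Z W).hom ▷ (wl X (br Y (Z ⊠ W)) ≫ as' X (Z ⊠ W) Y ≫ wr (br X (Z ⊠ W)) Y) ⊗≫
      wr (as X Y Z) W ◁ as X (Y ⊠ Z) W ◁ wl X (as Y Z W) ◁
        (((wlIso X (brR Y Z W)).hom ≫ (wlComp₅ X _ _ _ _ _).hom) ▷
          (as' X (Z ⊠ W) Y ≫ wr (br X (Z ⊠ W)) Y)) ⊗≫
      wr (as X Y Z) W ◁ as X (Y ⊠ Z) W ◁ ((wlUnit X (assoc Y Z W)).inv ▷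
        (wl X (wr (br Y Z) W) ≫ wl X (as Z Y W) ≫ wl X (wl Z (br Y W)) ≫ wl X (as' Z W Y) ≫
          as' X (Z ⊠ W) Y ≫ wr (br X (Z ⊠ W)) Y)) ⊗≫
      wr (as X Y Z) W ◁ as X (Y ⊠ Z) W ◁ wl X (wr (br Y Z) W) ◁ wl X (as Z Y W) ◁
        wl X (wl Z (br Y W)) ◁ wl X (as' Z W Y) ◁ as' X (Z ⊠ W) Y ◁
          ((wrIso (brR X Z W) Y).hom ≫ (wrComp₅ _ _ _ _ _ Y).hom) ⊗≫
      wr (as X Y Z) W ◁ ((asNat₂ X (br Y Z) W).inv ▷ (wl X (as Z Y W) ≫ wl X (wl Z (br Y W)) ≫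
        wl X (as' Z W Y) ≫ as' X (Z ⊠ W) Y ≫ wr (as' X Z W) Y ≫ wr (wr (br X Z) W) Y ≫
          wr (as Z X W) Y ≫ wr (wl Z (br X W)) Y ≫ wr (as' Z W X) Y)) ⊗≫
      wr (as X Y Z) W ◁ wr (wl X (br Y Z)) W ◁ ((pentA X Z Y W).inv ▷ (wl X (wl Z (br Y W)) ≫
        wl X (as' Z W Y) ≫ as' X (Z ⊠ W) Y ≫ wr (as' X Z W) Y ≫ wr (wr (br X Z) W) Y ≫
          wr (as Z X W) Y ≫ wr (wl Z (br X W)) Y ≫ wr (as' Z W X) Y)) ⊗≫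
      wr (as X Y Z) W ◁ wr (wl X (br Y Z)) W ◁ wr (as' X Z Y) W ◁ as (X ⊠ Z) Y W ◁
        ((asNat₃ X Z (br Y W)).inv ▷ (wl X (as' Z W Y) ≫ as' X (Z ⊠ W) Y ≫ wr (as' X Z W) Y ≫
          wr (wr (br X Z) W) Y ≫ wr (as Z X W) Y ≫ wr (wl Z (br X W)) Y ≫ wr (as' Z W X) Y)) ⊗≫
      wr (as X Y Z) W ◁ wr (wl X (br Y Z)) W ◁ wr (as' X Z Y) W ◁ as (X ⊠ Z) Y W ◁
        wl (X ⊠ Z) (br Y W) ◁ as X Z (W ⊠ Y) ◁ ((pent' X Z W Y).inv ▷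
          (wr (wr (br X Z) W) Y ≫ wr (as Z X W) Y ≫ wr (wl Z (br X W)) Y ≫
            wr (as' Z W X) Y)) ⊗≫
      wr (as X Y Z) W ◁ wr (wl X (br Y Z)) W ◁ wr (as' X Z Y) W ◁ as (X ⊠ Z) Y W ◁
        wl (X ⊠ Z) (br Y W) ◁ ((assoc X Z (W ⊠ Y)).unit.inv ▷ (as' (X ⊠ Z) W Y ≫
          wr (wr (br X Z) W) Y ≫ wr (as Z X W) Y ≫ wr (wl Z (br X W)) Y ≫
            wr (as' Z W X) Y)) ⊗≫
      wr (as X Y Z) W ◁ wr (wl X (br Y Z)) W ◁ wr (as' X Z Y) W ◁ as (X ⊠ Z) Y W ◁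
        wl (X ⊠ Z) (br Y W) ◁ ((Sq.inverse (asNat₁ (br X Z) W Y)).inv ▷
          (wr (as Z X W) Y ≫ wr (wl Z (br X W)) Y ≫ wr (as' Z W X) Y)) ⊗≫
      𝟙 (wr (as X Y Z) W ≫ wr (wl X (br Y Z)) W ≫ wr (as' X Z Y) W ≫ as (X ⊠ Z) Y W ≫
        wl (X ⊠ Z) (br Y W) ≫ wr (br X Z) (W ⊠ Y) ≫ as' (Z ⊠ X) W Y ≫ wr (as Z X W) Y ≫
          wr (wl Z (br X W)) Y ≫ wr (as' Z W X) Y)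
  /-- The two proofs of the Yang–Baxter equation agree. -/
  yang_baxter (X Y Z : C) :
    𝟙 (wr (br X Y) Z ≫ as Y X Z ≫ wl Y (br X Z) ≫ as' Y Z X ≫ wr (br Y Z) X ≫ as Z Y X) ⊗≫
      (hexR X Y Z).inv ▷ (as' Y Z X ≫ wr (br Y Z) X ≫ as Z Y X) ⊗≫
      as X Y Z ◁ br X (Y ⊠ Z) ◁ ((assoc Y Z X).unit.inv ▷ (wr (br Y Z) X ≫ as Z Y X)) ⊗≫
      as X Y Z ◁ ((brNat₂ X (br Y Z)).inv ▷ as Z Y X) ⊗≫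
      as X Y Z ◁ wl X (br Y Z) ◁ ((assoc X Z Y).counit.inv ▷ (br X (Z ⊠ Y) ≫ as Z Y X)) ⊗≫
      as X Y Z ◁ wl X (br Y Z) ◁ as' X Z Y ◁ (hexR X Z Y).hom =
    wr (br X Y) Z ◁ as Y X Z ◁ (𝟙 _ ⊗≫ (hexS Y X Z).inv ▷ as Z Y X) ⊗≫
      wr (br X Y) Z ◁ ((assoc Y X Z).unit.inv ▷ (br (Y ⊠ X) Z ≫ as' Z Y X ≫ as Z Y X)) ⊗≫
      wr (br X Y) Z ◁ br (Y ⊠ X) Z ◁ (assoc Z Y X).counit.hom ⊗≫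
      (brNat₁ (br X Y) Z).hom ⊗≫
      (assoc X Y Z).unit.hom ▷ (br (X ⊠ Y) Z ≫ wl Z (br X Y)) ⊗≫
      as X Y Z ◁ as' X Y Z ◁ br (X ⊠ Y) Z ◁ ((assoc Z X Y).counit.inv ▷ wl Z (br X Y)) ⊗≫
      as X Y Z ◁ ((hexS X Y Z).hom ▷ (as Z X Y ≫ wl Z (br X Y))) ⊗≫
      𝟙 (as X Y Z ≫ wl X (br Y Z) ≫ as' X Z Y ≫ wr (br X Z) Y ≫ as Z X Y ≫ wl Z (br X Y))
  /-- Compatibility of the syllepsis with the tensor product in the second variable. -/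
  syl_one_two (X Y Z : C) :
    𝟙 ((as X Y Z ≫ br X (Y ⊠ Z) ≫ as Y Z X) ≫ as' Y Z X ≫ br (Y ⊠ Z) X ≫ as' X Y Z) ⊗≫
      as X Y Z ◁ br X (Y ⊠ Z) ◁ ((assoc Y Z X).unit.inv ▷ (br (Y ⊠ Z) X ≫ as' X Y Z)) ⊗≫
      as X Y Z ◁ ((syl X (Y ⊠ Z)).inv ▷ as' X Y Z) ⊗≫ (assoc X Y Z).unit.inv =
    (hexR X Y Z).hom ▷ (as' Y Z X ≫ br (Y ⊠ Z) X ≫ as' X Y Z) ⊗≫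
      wr (br X Y) Z ◁ as Y X Z ◁ wl Y (br X Z) ◁ (hexS Y Z X).hom ⊗≫
      wr (br X Y) Z ◁ as Y X Z ◁ (((wlComp Y _ _).inv ≫ (wlIso Y (syl X Z)).inv ≫
        (tId Y _).hom) ▷ (as' Y X Z ≫ wr (br Y X) Z)) ⊗≫
      wr (br X Y) Z ◁ ((assoc Y X Z).unit.inv ▷ wr (br Y X) Z) ⊗≫
      ((wrComp _ _ Z).inv ≫ (wrIso (syl X Y) Z).inv ≫ (tId _ Z).hom)
  /-- Compatibility of the syllepsis with the tensor product in the first variable. -/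
  syl_two_one (X Y Z : C) :
    𝟙 ((as' X Y Z ≫ br (X ⊠ Y) Z ≫ as' Z X Y) ≫ as Z X Y ≫ br Z (X ⊠ Y) ≫ as X Y Z) ⊗≫
      as' X Y Z ◁ br (X ⊠ Y) Z ◁ ((assoc Z X Y).counit.hom ▷ (br Z (X ⊠ Y) ≫ as X Y Z)) ⊗≫
      as' X Y Z ◁ ((syl (X ⊠ Y) Z).inv ▷ as X Y Z) ⊗≫ (assoc X Y Z).counit.hom =
    (hexS X Y Z).hom ▷ (as Z X Y ≫ br Z (X ⊠ Y) ≫ as X Y Z) ⊗≫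
      wl X (br Y Z) ◁ as' X Z Y ◁ wr (br X Z) Y ◁ (hexR Z X Y).hom ⊗≫
      wl X (br Y Z) ◁ as' X Z Y ◁ (((wrComp _ _ Y).inv ≫ (wrIso (syl X Z) Y).inv ≫
        (tId _ Y).hom) ▷ (as X Z Y ≫ wl X (br Z Y))) ⊗≫
      wl X (br Y Z) ◁ ((assoc X Z Y).counit.hom ▷ wl X (br Z Y)) ⊗≫
      ((wlComp X _ _).inv ≫ (wlIso X (syl Y Z)).inv ≫ (tId X _).hom)
  /-- The symmetry condition. -/
  syl_braid (X Y : C) :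
    (syl X Y).hom ▷ br X Y ⊗≫ 𝟙 (br X Y ≫ br Y X ≫ br X Y) =
      (λ_ (br X Y)).hom ≫ (ρ_ (br X Y)).inv ≫ br X Y ◁ (syl Y X).hom

open SymmetricMonoidalBicategoryData

/-! ### Bicategories of objects with additional structure -/

/-- A bicategory displayed over `B`: additional structure on objects and on 1-morphisms of `B`, and
a property of 2-morphisms of `B` that holds for every invertible 2-morphism. -/
structure Displayed (B : Type u) [Bicategory.{w, v} B] where
  /-- The structure on objects. -/
  Ob : B → Type u'
  /-- The structure on 1-morphisms. -/
  Hm {a b : B} (x : Ob a) (y : Ob b) (f : a ⟶ b) : Type v'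
  /-- The property of 2-morphisms. -/
  Two {a b : B} {x : Ob a} {y : Ob b} {f g : a ⟶ b} (p : Hm x y f) (q : Hm x y g) (η : f ⟶ g) :
    Prop
  /-- The identities. -/
  idH {a : B} (x : Ob a) : Hm x x (𝟙 a)
  /-- The composites. -/
  compH {a b c : B} {x : Ob a} {y : Ob b} {z : Ob c} {f : a ⟶ b} {g : b ⟶ c} (p : Hm x y f)
    (q : Hm y z g) : Hm x z (f ≫ g)
  /-- The inverses of equivalences. -/
  invH {a b : B} {x : Ob a} {y : Ob b} (e : a ≌ b) (p : Hm x y e.hom) : Hm y x e.inv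
  two_iso {a b : B} {x : Ob a} {y : Ob b} {f g : a ⟶ b} (p : Hm x y f) (q : Hm x y g)
    (e : f ≅ g) : Two p q e.hom
  two_comp {a b : B} {x : Ob a} {y : Ob b} {f g h : a ⟶ b} {p : Hm x y f} {q : Hm x y g}
    {r : Hm x y h} {η : f ⟶ g} {θ : g ⟶ h} (_ : Two p q η) (_ : Two q r θ) : Two p r (η ≫ θ)
  two_whiskerLeft {a b c : B} {x : Ob a} {y : Ob b} {z : Ob c} {f : a ⟶ b} (r : Hm x y f)
    {g h : b ⟶ c} {p : Hm y z g} {q : Hm y z h} {η : g ⟶ h} (_ : Two p q η) :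
    Two (compH r p) (compH r q) (f ◁ η)
  two_whiskerRight {a b c : B} {x : Ob a} {y : Ob b} {z : Ob c} {f g : a ⟶ b} {p : Hm x y f}
    {q : Hm x y g} {η : f ⟶ g} (_ : Two p q η) {h : b ⟶ c} (r : Hm y z h) :
    Two (compH p r) (compH q r) (η ▷ h)

namespace Displayed

section

variable {B : Type u} [Bicategory.{w, v} B] (D : Displayed.{w, v, u, u', v'} B)

/-- The objects of the total bicategory: objects of `B` with additional structure. -/
structure Total where
  /-- The underlying object. -/
  base : B
  /-- The additional structure. -/
  fib : D.Ob base

/-- The 1-morphisms of the total bicategory. -/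
structure Total.Hom (X Y : D.Total) where
  /-- The underlying 1-morphism. -/
  base : X.base ⟶ Y.base
  /-- The additional structure. -/
  fib : D.Hm X.fib Y.fib base

/-- The 2-morphisms of the total bicategory. -/
@[ext]
structure Total.Hom₂ {X Y : D.Total} (f g : Total.Hom D X Y) where
  /-- The underlying 2-morphism. -/
  val : f.base ⟶ g.base
  /-- The property. -/
  property : D.Two f.fib g.fib val

instance : CategoryStruct D.Total where
  Hom X Y := Total.Hom D X Y
  id X := ⟨𝟙 X.base, D.idH X.fib⟩
  comp f g := ⟨f.base ≫ g.base, D.compH f.fib g.fib⟩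

instance (X Y : D.Total) : Category (X ⟶ Y) where
  Hom f g := Total.Hom₂ D f g
  id f := ⟨𝟙 f.base, D.two_iso _ _ (Iso.refl f.base)⟩
  comp η θ := ⟨η.val ≫ θ.val, D.two_comp η.property θ.property⟩
  id_comp η := Total.Hom₂.ext (Category.id_comp η.val)
  comp_id η := Total.Hom₂.ext (Category.comp_id η.val)
  assoc η θ κ := Total.Hom₂.ext (Category.assoc η.val θ.val κ.val)

variable {D}

/-- The underlying 1-morphism. -/
def b₁ {X Y : D.Total} (f : X ⟶ Y) : X.base ⟶ Y.base := Total.Hom.base f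

/-- The additional structure of a 1-morphism. -/
def fib₁ {X Y : D.Total} (f : X ⟶ Y) : D.Hm X.fib Y.fib (b₁ f) := Total.Hom.fib f

/-- The underlying 2-morphism. -/
def b₂ {X Y : D.Total} {f g : X ⟶ Y} (η : f ⟶ g) : b₁ f ⟶ b₁ g := Total.Hom₂.val η

theorem prop₂ {X Y : D.Total} {f g : X ⟶ Y} (η : f ⟶ g) : D.Two (fib₁ f) (fib₁ g) (b₂ η) :=
  Total.Hom₂.property η

/-- Construct a 1-morphism of the total bicategory. -/
def mk₁ {X Y : D.Total} (f : X.base ⟶ Y.base) (p : D.Hm X.fib Y.fib f) : X ⟶ Y :=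
  Total.Hom.mk f p

/-- Construct a 2-morphism of the total bicategory. -/
def mk₂ {X Y : D.Total} {f g : X ⟶ Y} (η : b₁ f ⟶ b₁ g) (h : D.Two (fib₁ f) (fib₁ g) η) : f ⟶ g :=
  Total.Hom₂.mk η h

theorem ext₂ {X Y : D.Total} {f g : X ⟶ Y} {η θ : f ⟶ g} (h : b₂ η = b₂ θ) : η = θ :=
  Total.Hom₂.ext h

/-- Invertible 2-morphisms lift to the total bicategory. -/
def liftIso {X Y : D.Total} {f g : X ⟶ Y} (e : b₁ f ≅ b₁ g) : f ≅ g where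
  hom := mk₂ e.hom (D.two_iso _ _ e)
  inv := mk₂ e.inv (D.two_iso _ _ e.symm)
  hom_inv_id := ext₂ e.hom_inv_id
  inv_hom_id := ext₂ e.inv_hom_id

/-- The invertible 2-morphism underlying an invertible 2-morphism. -/
def baseIso {X Y : D.Total} {f g : X ⟶ Y} (e : f ≅ g) : b₁ f ≅ b₁ g where
  hom := b₂ e.hom
  inv := b₂ e.inv
  hom_inv_id := congrArg b₂ e.hom_inv_id
  inv_hom_id := congrArg b₂ e.inv_hom_id

instance : Bicategory D.Total where
  homCategory X Y := inferInstanceAs (Category (X ⟶ Y))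
  whiskerLeft f _ _ η := mk₂ (b₁ f ◁ b₂ η) (D.two_whiskerLeft (fib₁ f) (prop₂ η))
  whiskerRight η h := mk₂ (b₂ η ▷ b₁ h) (D.two_whiskerRight (prop₂ η) (fib₁ h))
  associator f g h := liftIso (α_ (b₁ f) (b₁ g) (b₁ h))
  leftUnitor f := liftIso (λ_ (b₁ f))
  rightUnitor f := liftIso (ρ_ (b₁ f))
  whiskerLeft_id f g := ext₂ (Bicategory.whiskerLeft_id (b₁ f) (b₁ g))
  whiskerLeft_comp f _ _ _ η θ := ext₂ (Bicategory.whiskerLeft_comp (b₁ f) (b₂ η) (b₂ θ))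
  id_whiskerLeft η := ext₂ (Bicategory.id_whiskerLeft (b₂ η))
  comp_whiskerLeft f g _ _ η := ext₂ (Bicategory.comp_whiskerLeft (b₁ f) (b₁ g) (b₂ η))
  id_whiskerRight f g := ext₂ (Bicategory.id_whiskerRight (b₁ f) (b₁ g))
  comp_whiskerRight η θ i := ext₂ (Bicategory.comp_whiskerRight (b₂ η) (b₂ θ) (b₁ i))
  whiskerRight_id η := ext₂ (Bicategory.whiskerRight_id (b₂ η))
  whiskerRight_comp η g h := ext₂ (Bicategory.whiskerRight_comp (b₂ η) (b₁ g) (b₁ h))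
  whisker_assoc f _ _ η h := ext₂ (Bicategory.whisker_assoc (b₁ f) (b₂ η) (b₁ h))
  whisker_exchange η θ := ext₂ (Bicategory.whisker_exchange (b₂ η) (b₂ θ))
  pentagon f g h i := ext₂ (Bicategory.pentagon (b₁ f) (b₁ g) (b₁ h) (b₁ i))
  triangle f g := ext₂ (Bicategory.triangle (b₁ f) (b₁ g))

/-- Equivalences lift to the total bicategory. -/
def liftEquiv {X Y : D.Total} (e : X.base ≌ Y.base) (p : D.Hm X.fib Y.fib e.hom) : X ≌ Y where
  hom := mk₁ e.hom p
  inv := mk₁ e.inv (D.invH e p)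
  unit := liftIso e.unit
  counit := liftIso e.counit
  left_triangle := Iso.ext (ext₂ e.left_triangle_hom)

end

/-- Compatibility of a displayed bicategory with the tensor product. -/
structure Monoidal {B : Type u} [Bicategory.{w, v} B] [MonoidalBicategory B]
    (D : Displayed.{w, v, u, u', v'} B) where
  /-- The tensor product of objects. -/
  obT {a b : B} (x : D.Ob a) (y : D.Ob b) : D.Ob (a ⊠ b)
  /-- The unit. -/
  obOne : D.Ob (one : B)
  /-- The tensor product of 1-morphisms. -/
  hmT {a a' b b' : B} {x : D.Ob a} {x' : D.Ob a'} {y : D.Ob b} {y' : D.Ob b'} {f : a ⟶ a'}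
    {g : b ⟶ b'} (p : D.Hm x x' f) (q : D.Hm y y' g) : D.Hm (obT x y) (obT x' y') (f ⊠₁ g)
  two_tensor {a a' b b' : B} {x : D.Ob a} {x' : D.Ob a'} {y : D.Ob b} {y' : D.Ob b'}
    {f f' : a ⟶ a'} {g g' : b ⟶ b'} {p : D.Hm x x' f} {p' : D.Hm x x' f'} {q : D.Hm y y' g}
    {q' : D.Hm y y' g'} {η : f ⟶ f'} {θ : g ⟶ g'} (_ : D.Two p p' η) (_ : D.Two q q' θ) :
    D.Two (hmT p q) (hmT p' q') (η ⊠₂ θ)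
  /-- The associativity. -/
  hmAssoc {a b c : B} (x : D.Ob a) (y : D.Ob b) (z : D.Ob c) :
    D.Hm (obT (obT x y) z) (obT x (obT y z)) (as a b c)
  /-- The left unit. -/
  hmLUnit {a : B} (x : D.Ob a) : D.Hm (obT obOne x) x (lUnit a).hom
  /-- The right unit. -/
  hmRUnit {a : B} (x : D.Ob a) : D.Hm (obT x obOne) x (rUnit a).hom

namespace Monoidal

variable {B : Type u} [Bicategory.{w, v} B] [MonoidalBicategory B]
  {D : Displayed.{w, v, u, u', v'} B}

/-- The tensor product of the total bicategory. -/
abbrev tensorBicategory (T : D.Monoidal) : TensorBicategory D.Total where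
  tensor :=
    { obj X := ⟨X.1.base ⊠ X.2.base, T.obT X.1.fib X.2.fib⟩
      map f := mk₁ (b₁ f.1 ⊠₁ b₁ f.2) (T.hmT (fib₁ f.1) (fib₁ f.2))
      map₂ η := mk₂ (b₂ η.1 ⊠₂ b₂ η.2) (T.two_tensor (prop₂ η.1) (prop₂ η.2))
      map₂_id f := ext₂ (tHom₂_id (b₁ f.1) (b₁ f.2))
      map₂_comp η θ := ext₂ (tHom₂_comp (b₂ η.1) (b₂ θ.1) (b₂ η.2) (b₂ θ.2))
      mapId X := liftIso (tId X.1.base X.2.base)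
      mapComp f g := liftIso (tComp (b₁ f.1) (b₁ g.1) (b₁ f.2) (b₁ g.2))
      map₂_whisker_left {a b c} f {g h} η := ext₂
        ((tensor (C := B)).map₂_whisker_left (a := (a.1.base, a.2.base))
          (b := (b.1.base, b.2.base)) (c := (c.1.base, c.2.base)) (b₁ f.1, b₁ f.2)
          (g := (b₁ g.1, b₁ g.2)) (h := (b₁ h.1, b₁ h.2)) (b₂ η.1, b₂ η.2))
      map₂_whisker_right {a b c} {f g} η h := ext₂
        ((tensor (C := B)).map₂_whisker_right (a := (a.1.base, a.2.base))
          (b := (b.1.base, b.2.base)) (c := (c.1.base, c.2.base))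
          (f := (b₁ f.1, b₁ f.2)) (g := (b₁ g.1, b₁ g.2)) (b₂ η.1, b₂ η.2)
          (b₁ h.1, b₁ h.2))
      map₂_associator {a b c d} f g h := ext₂
        ((tensor (C := B)).map₂_associator (a := (a.1.base, a.2.base))
          (b := (b.1.base, b.2.base)) (c := (c.1.base, c.2.base)) (d := (d.1.base, d.2.base))
          (b₁ f.1, b₁ f.2) (b₁ g.1, b₁ g.2) (b₁ h.1, b₁ h.2))
      map₂_left_unitor {a b} f := ext₂
        ((tensor (C := B)).map₂_left_unitor (a := (a.1.base, a.2.base))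
          (b := (b.1.base, b.2.base)) (b₁ f.1, b₁ f.2))
      map₂_right_unitor {a b} f := ext₂
        ((tensor (C := B)).map₂_right_unitor (a := (a.1.base, a.2.base))
          (b := (b.1.base, b.2.base)) (b₁ f.1, b₁ f.2)) }
  one := ⟨one, T.obOne⟩

/-- The structure 1- and 2-morphisms of the total monoidal bicategory. -/
abbrev monoidalBicategoryData (T : D.Monoidal) : MonoidalBicategoryData D.Total :=
  letI := T.tensorBicategory
  { assoc X Y Z := liftEquiv (X := (X ⊠ Y) ⊠ Z) (Y := X ⊠ (Y ⊠ Z))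
      (MonoidalBicategoryData.assoc X.base Y.base Z.base) (T.hmAssoc X.fib Y.fib Z.fib)
    assocNat f g h := liftIso (assocNat (b₁ f) (b₁ g) (b₁ h))
    lUnit X := liftEquiv (X := one ⊠ X) (Y := X) (lUnit X.base) (T.hmLUnit X.fib)
    lUnitNat f := liftIso (lUnitNat (b₁ f))
    rUnit X := liftEquiv (X := X ⊠ one) (Y := X) (rUnit X.base) (T.hmRUnit X.fib)
    rUnitNat f := liftIso (rUnitNat (b₁ f))
    pent X Y Z W := liftIso (pent X.base Y.base Z.base W.base)
    midUnitor X Y := liftIso (midUnitor X.base Y.base)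
    leftUnitor₂ X Y := liftIso (leftUnitor₂ X.base Y.base)
    rightUnitor₂ X Y := liftIso (rightUnitor₂ X.base Y.base) }

/-- The total bicategory of a displayed bicategory compatible with the tensor product is
monoidal. -/
abbrev monoidalBicategory (T : D.Monoidal) : MonoidalBicategory D.Total :=
  letI := T.monoidalBicategoryData
  { assoc_naturality η θ κ := ext₂ (MonoidalBicategory.assoc_naturality (b₂ η) (b₂ θ) (b₂ κ))
    assoc_id X Y Z := ext₂ (MonoidalBicategory.assoc_id X.base Y.base Z.base)
    assoc_comp f f' g g' h h' :=
      ext₂ (MonoidalBicategory.assoc_comp (b₁ f) (b₁ f') (b₁ g) (b₁ g') (b₁ h) (b₁ h'))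
    lUnit_naturality η := ext₂ (MonoidalBicategory.lUnit_naturality (b₂ η))
    lUnit_id X := ext₂ (MonoidalBicategory.lUnit_id X.base)
    lUnit_comp f f' := ext₂ (MonoidalBicategory.lUnit_comp (b₁ f) (b₁ f'))
    rUnit_naturality η := ext₂ (MonoidalBicategory.rUnit_naturality (b₂ η))
    rUnit_id X := ext₂ (MonoidalBicategory.rUnit_id X.base)
    rUnit_comp f f' := ext₂ (MonoidalBicategory.rUnit_comp (b₁ f) (b₁ f'))
    pent_naturality f g h k :=
      ext₂ (MonoidalBicategory.pent_naturality (b₁ f) (b₁ g) (b₁ h) (b₁ k))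
    midUnitor_naturality f g := ext₂ (MonoidalBicategory.midUnitor_naturality (b₁ f) (b₁ g))
    leftUnitor₂_naturality f g :=
      ext₂ (MonoidalBicategory.leftUnitor₂_naturality (b₁ f) (b₁ g))
    rightUnitor₂_naturality f g :=
      ext₂ (MonoidalBicategory.rightUnitor₂_naturality (b₁ f) (b₁ g))
    cocycle X Y Z W V :=
      ext₂ (MonoidalBicategory.cocycle X.base Y.base Z.base W.base V.base)
    left_normalization X Y Z :=
      ext₂ (MonoidalBicategory.left_normalization X.base Y.base Z.base)
    right_normalization X Y Z :=
      ext₂ (MonoidalBicategory.right_normalization X.base Y.base Z.base) }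

end Monoidal

end Displayed

/-! ### The homotopy category of a monoidal bicategory -/

/-- The category with the same objects as a bicategory and the isomorphism classes of 1-morphisms as
morphisms. -/
structure Ho (C : Type u) where
  /-- The underlying object. -/
  of : C

namespace Ho

section

variable {C : Type u} [Bicategory.{w, v} C]

instance : Category (Ho C) where
  Hom X Y := Quotient (isIsomorphicSetoid (X.of ⟶ Y.of))
  id X := Quotient.mk _ (𝟙 X.of)
  comp := Quotient.map₂ (fun f g => f ≫ g) (fun _ _ ⟨e⟩ _ _ ⟨e'⟩ =>
    ⟨whiskerRightIso e _ ≪≫ whiskerLeftIso _ e'⟩)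
  id_comp f := Quotient.inductionOn f fun f => Quotient.sound ⟨λ_ f⟩
  comp_id f := Quotient.inductionOn f fun f => Quotient.sound ⟨ρ_ f⟩
  assoc f g h := Quotient.inductionOn₃ f g h fun f g h => Quotient.sound ⟨α_ f g h⟩

/-- The isomorphism class of a 1-morphism. -/
def cl {X Y : C} (f : X ⟶ Y) : (⟨X⟩ : Ho C) ⟶ ⟨Y⟩ := Quotient.mk _ f

theorem cl_eq {X Y : C} {f g : X ⟶ Y} (e : f ≅ g) : cl f = cl g := Quotient.sound ⟨e⟩

theorem cl_exact {X Y : C} {f g : X ⟶ Y} (e : cl f = cl g) : Nonempty (f ≅ g) := Quotient.exact e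

theorem cl_comp {X Y Z : C} (f : X ⟶ Y) (g : Y ⟶ Z) : cl f ≫ cl g = cl (f ≫ g) := rfl

theorem cl_id (X : C) : cl (𝟙 X) = 𝟙 _ := rfl

theorem cl_surj {X Y : Ho C} (f : X ⟶ Y) : ∃ g : X.of ⟶ Y.of, f = cl g :=
  Quotient.inductionOn f fun g => ⟨g, rfl⟩

/-- The isomorphism given by an equivalence. -/
@[simps]
def clIso {X Y : C} (e : X ≌ Y) : (⟨X⟩ : Ho C) ≅ ⟨Y⟩ where
  hom := cl e.hom
  inv := cl e.inv
  hom_inv_id := (cl_eq e.unit).symm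
  inv_hom_id := cl_eq e.counit

end

variable {C : Type u} [Bicategory.{w, v} C] [MonoidalBicategory C]

instance : MonoidalCategoryStruct (Ho C) where
  tensorObj X Y := ⟨X.of ⊠ Y.of⟩
  tensorHom := Quotient.map₂ (fun f g => f ⊠₁ g) 
    (fun _ _ (e : Nonempty _) _ _ (e' : Nonempty _) => e.elim fun e => e'.elim fun e' =>
      ⟨tIso e e'⟩)
  whiskerLeft X Y Z := Quotient.map (fun f : Y.of ⟶ Z.of => wl X.of f)
    (fun _ _ (e : Nonempty _) => e.elim fun e => ⟨wlIso _ e⟩)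
  whiskerRight {Y Z} f X := Quotient.map (fun f : Y.of ⟶ Z.of => wr f X.of)
    (fun _ _ (e : Nonempty _) => e.elim fun e => ⟨wrIso e _⟩) f
  tensorUnit := ⟨one⟩
  associator X Y Z := clIso (MonoidalBicategoryData.assoc X.of Y.of Z.of)
  leftUnitor X := clIso (lUnit X.of)
  rightUnitor X := clIso (rUnit X.of)

open MonoidalCategory in
instance : MonoidalCategory (Ho C) :=
  MonoidalCategory.ofTensorHom
    (id_tensorHom_id := fun X Y => cl_eq (tId X.of Y.of))
    (id_tensorHom := fun _ _ _ f => Quotient.inductionOn f fun _ => rfl)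
    (tensorHom_id := fun f _ => Quotient.inductionOn f fun _ => rfl)
    (tensorHom_comp_tensorHom := fun f₁ f₂ g₁ g₂ =>
      Quotient.inductionOn₂ f₁ f₂ fun f₁ f₂ => Quotient.inductionOn₂ g₁ g₂ fun g₁ g₂ =>
        (cl_eq (tComp f₁ g₁ f₂ g₂)).symm)
    (associator_naturality := fun f g h => Quotient.inductionOn₃ f g h fun f g h =>
      cl_eq (assocNat f g h))
    (leftUnitor_naturality := fun f => Quotient.inductionOn f fun f => cl_eq (lUnitNat f))
    (rightUnitor_naturality := fun f => Quotient.inductionOn f fun f => cl_eq (rUnitNat f))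
    (pentagon := fun X Y Z W => (cl_eq (pent X.of Y.of Z.of W.of)).symm)
    (triangle := fun X Y => cl_eq (midUnitor X.of Y.of))

end Ho

/-! ### Equivalences, dualizable objects and invertible objects -/

section Equivalences

variable {C : Type u} [Bicategory.{w, v} C]

/-- A 1-morphism that is an equivalence. -/
def IsEquivalence₁ {a b : C} (f : a ⟶ b) : Prop :=
  ∃ g : b ⟶ a, Nonempty (𝟙 a ≅ f ≫ g) ∧ Nonempty (g ≫ f ≅ 𝟙 b)

/-- A 1-morphism that has a left adjoint and a right adjoint. -/
def HasAdjoints {a b : C} (f : a ⟶ b) : Prop :=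
  (∃ l : b ⟶ a, Nonempty (Bicategory.Adjunction l f)) ∧
    ∃ r : b ⟶ a, Nonempty (Bicategory.Adjunction f r)

theorem IsEquivalence₁.exists_equivalence {a b : C} {f : a ⟶ b} (h : IsEquivalence₁ f) :
    ∃ e : a ≌ b, e.hom = f := by
  obtain ⟨g, ⟨η⟩, ⟨κ⟩⟩ := h
  exact ⟨Equivalence.mkOfAdjointifyCounit η κ, rfl⟩

theorem isEquivalence₁_hom {a b : C} (e : a ≌ b) : IsEquivalence₁ e.hom := ⟨e.inv, ⟨e.unit⟩, ⟨e.counit⟩⟩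

theorem IsEquivalence₁.symm {a b : C} {f : a ⟶ b} {g : b ⟶ a} (η : 𝟙 a ≅ f ≫ g) (κ : g ≫ f ≅ 𝟙 b) :
    IsEquivalence₁ g := ⟨f, ⟨κ.symm⟩, ⟨η.symm⟩⟩

theorem isEquivalence₁_inv {a b : C} (e : a ≌ b) : IsEquivalence₁ e.inv := IsEquivalence₁.symm e.unit e.counit

theorem isEquivalence₁_id (a : C) : IsEquivalence₁ (𝟙 a) := ⟨𝟙 a, ⟨(λ_ _).symm⟩, ⟨λ_ _⟩⟩

theorem isEquivalence₁_iff_isIso {a b : C} (f : a ⟶ b) : IsEquivalence₁ f ↔ IsIso (Ho.cl f) := by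
  constructor
  · rintro ⟨g, ⟨η⟩, ⟨κ⟩⟩
    exact ⟨Ho.cl g, (Ho.cl_eq η).symm, Ho.cl_eq κ⟩
  · rintro ⟨g, h₁, h₂⟩
    obtain ⟨g, rfl⟩ := Ho.cl_surj g
    exact ⟨g, Ho.cl_exact h₁.symm, Ho.cl_exact h₂⟩

theorem IsEquivalence₁.comp {a b c : C} {f : a ⟶ b} {g : b ⟶ c} (hf : IsEquivalence₁ f) (hg : IsEquivalence₁ g) :
    IsEquivalence₁ (f ≫ g) := by
  rw [isEquivalence₁_iff_isIso] at *
  rw [← Ho.cl_comp]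
  infer_instance

/-- Adjunctions are invariant under isomorphisms of 1-morphisms. -/
def adjOfIso {a b : C} {f f' : a ⟶ b} {g g' : b ⟶ a} (adj : Bicategory.Adjunction f g)
    (e : f ≅ f') (e' : g ≅ g') : Bicategory.Adjunction f' g' where
  unit := adj.unit ≫ e.hom ▷ g ≫ f' ◁ e'.hom
  counit := e'.inv ▷ f' ≫ g ◁ e.inv ≫ adj.counit
  left_triangle := by
    calc
      _ = adj.unit ▷ f' ⊗≫ e.hom ▷ g ▷ f' ⊗≫ f' ◁ ((e'.hom ≫ e'.inv) ▷ f' ≫ g ◁ e.inv) ⊗≫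
          f' ◁ adj.counit := by bicategory
      _ = adj.unit ▷ f' ⊗≫ (e.hom ▷ (g ≫ f') ≫ f' ◁ (g ◁ e.inv)) ⊗≫
          f' ◁ adj.counit := by rw [e'.hom_inv_id]; bicategory
      _ = 𝟙 _ ⊗≫ (adj.unit ▷ f' ≫ (f ≫ g) ◁ e.inv) ⊗≫ (e.hom ▷ (g ≫ f) ≫
          f' ◁ adj.counit) ⊗≫ 𝟙 _ := by rw [← whisker_exchange]; bicategory
      _ = 𝟙 _ ⊗≫ e.inv ⊗≫ leftZigzag adj.unit adj.counit ⊗≫ e.hom ⊗≫ 𝟙 _ := by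
        rw [← whisker_exchange, ← whisker_exchange]; bicategory
      _ = 𝟙 _ ⊗≫ (e.inv ≫ e.hom) ⊗≫ 𝟙 _ := by rw [adj.left_triangle]; bicategory
      _ = _ := by rw [e.inv_hom_id]; bicategory
  right_triangle := by
    calc
      _ = 𝟙 _ ⊗≫ (g' ◁ (adj.unit ≫ e.hom ▷ g ≫ f' ◁ e'.hom) ≫ e'.inv ▷ (f' ≫ g')) ⊗≫
          (g ◁ e.inv ≫ adj.counit) ▷ g' := by bicategory
      _ = 𝟙 _ ⊗≫ e'.inv ⊗≫ g ◁ adj.unit ⊗≫ g ◁ (e.hom ▷ g) ⊗≫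
          ((g ≫ f') ◁ e'.hom ≫ (g ◁ e.inv ≫ adj.counit) ▷ g') := by
        rw [whisker_exchange]; bicategory
      _ = 𝟙 _ ⊗≫ e'.inv ⊗≫ g ◁ adj.unit ⊗≫ g ◁ ((e.hom ≫ e.inv) ▷ g) ⊗≫
          adj.counit ▷ g ⊗≫ e'.hom ⊗≫ 𝟙 _ := by rw [whisker_exchange]; bicategory
      _ = 𝟙 _ ⊗≫ e'.inv ⊗≫ rightZigzag adj.unit adj.counit ⊗≫ e'.hom ⊗≫ 𝟙 _ := by
        rw [e.hom_inv_id]; bicategory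
      _ = 𝟙 _ ⊗≫ (e'.inv ≫ e'.hom) ⊗≫ 𝟙 _ := by rw [adj.right_triangle]; bicategory
      _ = _ := by rw [e'.inv_hom_id]; bicategory

theorem IsEquivalence₁.hasAdjoints {a b : C} {f : a ⟶ b} (h : IsEquivalence₁ f) : HasAdjoints f := by
  constructor
  · obtain ⟨g, ⟨η⟩, ⟨κ⟩⟩ := h
    let e := Equivalence.mkOfAdjointifyCounit κ.symm η.symm
    exact ⟨g, ⟨e.unit.hom, e.counit.hom, e.left_triangle_hom, e.right_triangle_hom⟩⟩
  · obtain ⟨e, rfl⟩ := h.exists_equivalence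
    exact ⟨e.inv, ⟨e.unit.hom, e.counit.hom, e.left_triangle_hom, e.right_triangle_hom⟩⟩

theorem HasAdjoints.comp {a b c : C} {f : a ⟶ b} {g : b ⟶ c} (hf : HasAdjoints f)
    (hg : HasAdjoints g) : HasAdjoints (f ≫ g) := by
  obtain ⟨⟨l, ⟨hl⟩⟩, ⟨r, ⟨hr⟩⟩⟩ := hf
  obtain ⟨⟨l', ⟨hl'⟩⟩, ⟨r', ⟨hr'⟩⟩⟩ := hg
  exact ⟨⟨l' ≫ l, ⟨hl'.comp hl⟩⟩, ⟨r' ≫ r, ⟨hr.comp hr'⟩⟩⟩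

theorem HasAdjoints.of_iso {a b : C} {f g : a ⟶ b} (hf : HasAdjoints f) (e : f ≅ g) :
    HasAdjoints g := by
  obtain ⟨⟨l, ⟨hl⟩⟩, ⟨r, ⟨hr⟩⟩⟩ := hf
  exact ⟨⟨l, ⟨adjOfIso hl (Iso.refl _) e⟩⟩, ⟨r, ⟨adjOfIso hr e (Iso.refl _)⟩⟩⟩

variable [MonoidalBicategory C]

theorem HasAdjoints.tensor {a a' b b' : C} {f : a ⟶ a'} {g : b ⟶ b'} (hf : HasAdjoints f)
    (hg : HasAdjoints g) : HasAdjoints (f ⊠₁ g) := by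
  obtain ⟨⟨l, ⟨hl⟩⟩, ⟨r, ⟨hr⟩⟩⟩ := hf
  obtain ⟨⟨l', ⟨hl'⟩⟩, ⟨r', ⟨hr'⟩⟩⟩ := hg
  have key {x x' y y' : C} {p : x ⟶ x'} {q : x' ⟶ x} {p' : y ⟶ y'} {q' : y' ⟶ y}
      (h : Bicategory.Adjunction p q) (h' : Bicategory.Adjunction p' q') :
      Nonempty (Bicategory.Adjunction (p ⊠₁ p') (q ⊠₁ q')) := by
    let j : @Bicategory.Adjunction (C × C) _ (x, y) (x', y') (p, p') (q, q') :=
      { unit := (h.unit, h'.unit)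
        counit := (h.counit, h'.counit)
        left_triangle := Prod.ext h.left_triangle h'.left_triangle
        right_triangle := Prod.ext h.right_triangle h'.right_triangle }
    exact ⟨(TensorBicategory.tensor (C := C)).mapAdjunction j⟩
  exact ⟨⟨_, key hl hl'⟩, ⟨_, key hr hr'⟩⟩

theorem IsEquivalence₁.tensor {a a' b b' : C} {f : a ⟶ a'} {g : b ⟶ b'} (hf : IsEquivalence₁ f)
    (hg : IsEquivalence₁ g) : IsEquivalence₁ (f ⊠₁ g) := by
  rw [isEquivalence₁_iff_isIso] at *
  exact inferInstanceAs (IsIso (MonoidalCategory.tensorHom (Ho.cl f) (Ho.cl g)))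

end Equivalences

section Duals

variable {C : Type u} [Bicategory.{w, v} C] [MonoidalBicategory C]

/-- A dual of an object `X`. -/
structure DualPair (X : C) where
  /-- The dual object. -/
  dual : C
  /-- The evaluation. -/
  ev : X ⊠ dual ⟶ one
  /-- The coevaluation. -/
  coev : one ⟶ dual ⊠ X
  /-- The first zigzag 2-morphism. -/
  α : (rUnit X).inv ≫ wl X coev ≫ as' X dual X ≫ wr ev X ≫ (lUnit X).hom ≅ 𝟙 X
  /-- The second zigzag 2-morphism. -/
  β : (lUnit dual).inv ≫ wr coev dual ≫ as dual X dual ≫ wl dual ev ≫ (rUnit dual).hom ≅ 𝟙 dual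

/-- Full duality data for an object `X`: a dual whose evaluation and coevaluation have left
adjoints and right adjoints. -/
structure FullDuality (X : C) extends DualPair X where
  /-- The left adjoint of the evaluation. -/
  evL : one ⟶ X ⊠ dual
  /-- The adjunction `evL ⊣ ev`. -/
  evLAdj : Bicategory.Adjunction evL ev
  /-- The right adjoint of the evaluation. -/
  evR : one ⟶ X ⊠ dual
  /-- The adjunction `ev ⊣ evR`. -/
  evRAdj : Bicategory.Adjunction ev evR
  /-- The left adjoint of the coevaluation. -/
  coevL : dual ⊠ X ⟶ one
  /-- The adjunction `coevL ⊣ coev`. -/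
  coevLAdj : Bicategory.Adjunction coevL coev
  /-- The right adjoint of the coevaluation. -/
  coevR : dual ⊠ X ⟶ one
  /-- The adjunction `coev ⊣ coevR`. -/
  coevRAdj : Bicategory.Adjunction coev coevR

/-- A fully dualizable object. -/
def FullyDualizable (X : C) : Prop := Nonempty (FullDuality X)

/-- An invertible object. -/
def Invertible₀ (X : C) : Prop := ∃ Y : C, Nonempty (X ⊠ Y ≌ one) ∧ Nonempty (Y ⊠ X ≌ one)

open MonoidalCategory

/-- A morphism of the homotopy category which has a left adjoint and a right adjoint. -/
def HAdj {X Y : Ho C} (q : X ⟶ Y) : Prop := ∃ f : X.of ⟶ Y.of, q = Ho.cl f ∧ HasAdjoints f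

theorem hAdj_cl {X Y : C} {f : X ⟶ Y} : HAdj (Ho.cl f) ↔ HasAdjoints f :=
  ⟨fun ⟨_, e, h⟩ => h.of_iso (Ho.cl_exact e.symm).some, fun h => ⟨f, rfl, h⟩⟩

theorem HAdj.comp {X Y Z : Ho C} {f : X ⟶ Y} {g : Y ⟶ Z} (hf : HAdj f) (hg : HAdj g) :
    HAdj (f ≫ g) := by
  obtain ⟨f, rfl, hf⟩ := hf
  obtain ⟨g, rfl, hg⟩ := hg
  exact ⟨_, rfl, hf.comp hg⟩

theorem HAdj.of_isIso {X Y : Ho C} (f : X ⟶ Y) [IsIso f] : HAdj f := by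
  obtain ⟨f, rfl⟩ := Ho.cl_surj f
  exact ⟨f, rfl, ((isEquivalence₁_iff_isIso f).2 inferInstance).hasAdjoints⟩

theorem HAdj.tensor {X Y X' Y' : Ho C} {f : X ⟶ Y} {g : X' ⟶ Y'} (hf : HAdj f) (hg : HAdj g) :
    HAdj (tensorHom f g) := by
  obtain ⟨f, rfl, hf⟩ := hf
  obtain ⟨g, rfl, hg⟩ := hg
  exact ⟨_, rfl, hf.tensor hg⟩

theorem HAdj.whiskerLeft (X : Ho C) {Y Z : Ho C} {f : Y ⟶ Z} (hf : HAdj f) :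
    HAdj (MonoidalCategory.whiskerLeft X f) := by
  rw [← id_tensorHom]
  exact (HAdj.of_isIso _).tensor hf

theorem HAdj.whiskerRight (X : Ho C) {Y Z : Ho C} {f : Y ⟶ Z} (hf : HAdj f) :
    HAdj (MonoidalCategory.whiskerRight f X) := by
  rw [← tensorHom_id]
  exact hf.tensor (HAdj.of_isIso _)

theorem fullyDualizable_iff (X : C) : FullyDualizable X ↔
    ∃ (A : Ho C) (p : ExactPairing A ⟨X⟩), HAdj p.evaluation' ∧ HAdj p.coevaluation' := by
  constructor
  · rintro ⟨d⟩
    have hα := Ho.cl_eq d.α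
    have hβ := Ho.cl_eq d.β
    refine ⟨⟨d.dual⟩, ⟨Ho.cl d.coev, Ho.cl d.ev, ?_, ?_⟩,
      hAdj_cl.2 ⟨⟨_, ⟨d.evLAdj⟩⟩, ⟨_, ⟨d.evRAdj⟩⟩⟩,
      hAdj_cl.2 ⟨⟨_, ⟨d.coevLAdj⟩⟩, ⟨_, ⟨d.coevRAdj⟩⟩⟩⟩
    · change (MonoidalCategory.rightUnitor (⟨X⟩ : Ho C)).inv ≫ _ ◁ Ho.cl d.coev ≫
        (MonoidalCategory.associator (⟨X⟩ : Ho C) ⟨d.dual⟩ ⟨X⟩).inv ≫ Ho.cl d.ev ▷ _ ≫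
        (MonoidalCategory.leftUnitor _).hom = 𝟙 _ at hα
      rw [Iso.inv_comp_eq, ← Category.assoc, ← Category.assoc, ← Iso.eq_comp_inv] at hα
      simpa using hα
    · change (λ_ (⟨d.dual⟩ : Ho C)).inv ≫ Ho.cl d.coev ▷ _ ≫
        (MonoidalCategory.associator (⟨d.dual⟩ : Ho C) ⟨X⟩ ⟨d.dual⟩).hom ≫ _ ◁ Ho.cl d.ev ≫
        (MonoidalCategory.rightUnitor _).hom = 𝟙 _ at hβ
      rw [Iso.inv_comp_eq, ← Category.assoc, ← Category.assoc, ← Iso.eq_comp_inv] at hβ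
      simpa using hβ
  · rintro ⟨A, p, ⟨ev, hev, ⟨⟨evL, ⟨evLAdj⟩⟩, ⟨evR, ⟨evRAdj⟩⟩⟩⟩,
      ⟨coev, hcoev, ⟨⟨coevL, ⟨coevLAdj⟩⟩, ⟨coevR, ⟨coevRAdj⟩⟩⟩⟩⟩
    have h₁ := p.coevaluation_evaluation'
    have h₂ := p.evaluation_coevaluation'
    rw [hev, hcoev] at h₁ h₂
    have e₁ : (MonoidalCategory.rightUnitor (⟨X⟩ : Ho C)).inv ≫ _ ◁ Ho.cl coev ≫ (MonoidalCategory.associator _ _ _).inv ≫ Ho.cl ev ▷ _ ≫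
        (MonoidalCategory.leftUnitor _).hom = 𝟙 _ := by
      have := congrArg (fun t => (MonoidalCategory.rightUnitor (⟨X⟩ : Ho C)).inv ≫ t ≫ (MonoidalCategory.leftUnitor _).hom) h₁
      simpa using this
    have e₂ : (MonoidalCategory.leftUnitor A).inv ≫ Ho.cl coev ▷ _ ≫ (MonoidalCategory.associator _ _ _).hom ≫ _ ◁ Ho.cl ev ≫
        (MonoidalCategory.rightUnitor _).hom = 𝟙 _ := by
      have := congrArg (fun t => (MonoidalCategory.leftUnitor A).inv ≫ t ≫ (MonoidalCategory.rightUnitor _).hom) h₂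
      simpa using this
    exact ⟨⟨⟨A.of, ev, coev, (Ho.cl_exact e₁).some, (Ho.cl_exact e₂).some⟩, evL, evLAdj, evR,
      evRAdj, coevL, coevLAdj, coevR, coevRAdj⟩⟩

theorem fullyDualizable_one : FullyDualizable (one : C) := by
  rw [fullyDualizable_iff]
  refine ⟨𝟙_ _, exactPairingUnit, ?_, ?_⟩
  · exact HAdj.of_isIso (MonoidalCategory.rightUnitor _).hom
  · exact HAdj.of_isIso (MonoidalCategory.rightUnitor _).inv

theorem hAdj_exactPairing {P Q A A' : Ho C} (p : ExactPairing A P) (q : ExactPairing A' Q)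
    (h₁ : HAdj p.evaluation') (h₂ : HAdj p.coevaluation') (h₁' : HAdj q.evaluation')
    (h₂' : HAdj q.coevaluation') :
    ∃ r : ExactPairing (A' ⊗ A) (P ⊗ Q), HAdj r.evaluation' ∧ HAdj r.coevaluation' := by
  refine ⟨ExactPairing.tensor, ?_, ?_⟩
  · change HAdj (monoidalComp (𝟙 ((P ⊗ Q) ⊗ (A' ⊗ A))) (monoidalComp
      (MonoidalCategory.whiskerLeft P (MonoidalCategory.whiskerRight q.evaluation' A))
      p.evaluation'))
    exact (HAdj.of_isIso _).comp ((HAdj.of_isIso _).comp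
      (((h₁'.whiskerRight _).whiskerLeft _).comp ((HAdj.of_isIso _).comp h₁)))
  · change HAdj (monoidalComp q.coevaluation' (monoidalComp (MonoidalCategory.whiskerRight
      (MonoidalCategory.whiskerLeft A' p.coevaluation') Q) (𝟙 ((A' ⊗ A) ⊗ (P ⊗ Q)))))
    exact h₂'.comp ((HAdj.of_isIso _).comp
      (((h₂.whiskerLeft _).whiskerRight _).comp ((HAdj.of_isIso _).comp (HAdj.of_isIso _))))

theorem FullyDualizable.tensor {X Y : C} (hX : FullyDualizable X) (hY : FullyDualizable Y) :
    FullyDualizable (X ⊠ Y) := by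
  rw [fullyDualizable_iff] at *
  obtain ⟨A, p, h₁, h₂⟩ := hX
  obtain ⟨A', p', h₁', h₂'⟩ := hY
  exact ⟨A' ⊗ A, hAdj_exactPairing p p' h₁ h₂ h₁' h₂'⟩

theorem leftZigzag_eq {D : Type u'} [Bicategory.{w', v'} D] {a b : D} {f : a ⟶ b} {g : b ⟶ a}
    (η : 𝟙 a ⟶ f ≫ g) (κ : g ≫ f ⟶ 𝟙 b) :
    leftZigzag η κ = Bicategory.whiskerRight η f ≫ (Bicategory.associator _ _ _).hom ≫
      Bicategory.whiskerLeft f κ := by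
  simp [bicategoricalComp]

theorem rightZigzag_eq {D : Type u'} [Bicategory.{w', v'} D] {a b : D} {f : a ⟶ b} {g : b ⟶ a}
    (η : 𝟙 a ⟶ f ≫ g) (κ : g ≫ f ⟶ 𝟙 b) :
    rightZigzag η κ = Bicategory.whiskerLeft g η ≫ (Bicategory.associator _ _ _).inv ≫
      Bicategory.whiskerRight κ g := by
  simp [bicategoricalComp]

theorem Invertible₀.fullyDualizable {X : C} (h : Invertible₀ X) : FullyDualizable X := by
  obtain ⟨Y, ⟨a⟩, ⟨b⟩⟩ := h
  rw [fullyDualizable_iff]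
  let e := Equivalence.mkOfAdjointifyCounit (B := MonoidalSingleObj (Ho C))
    (a := MonoidalSingleObj.star _) (b := MonoidalSingleObj.star _) (f := (⟨Y⟩ : Ho C))
    (g := (⟨X⟩ : Ho C)) (Ho.clIso b).symm (Ho.clIso a)
  have h₁ := e.left_triangle_hom
  have h₂ := e.right_triangle_hom
  rw [leftZigzag_eq] at h₁
  rw [rightZigzag_eq] at h₂
  let η : 𝟙_ (Ho C) ≅ (⟨Y⟩ : Ho C) ⊗ ⟨X⟩ := e.unit
  let κ : (⟨X⟩ : Ho C) ⊗ ⟨Y⟩ ≅ 𝟙_ (Ho C) := e.counit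
  exact ⟨⟨Y⟩, ⟨η.hom, κ.hom, h₂, h₁⟩, HAdj.of_isIso κ.hom, HAdj.of_isIso η.hom⟩

theorem invertible_iff (X : C) : Invertible₀ X ↔
    ∃ Y : Ho C, Nonempty (⟨X⟩ ⊗ Y ≅ 𝟙_ (Ho C)) ∧ Nonempty (Y ⊗ ⟨X⟩ ≅ 𝟙_ (Ho C)) := by
  have key {a b : C} (e : (⟨a⟩ : Ho C) ≅ ⟨b⟩) : Nonempty (a ≌ b) := by
    obtain ⟨f, hf⟩ := Ho.cl_surj e.hom
    have : IsIso (Ho.cl f) := hf ▸ inferInstance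
    obtain ⟨e', -⟩ := ((isEquivalence₁_iff_isIso f).2 this).exists_equivalence
    exact ⟨e'⟩
  constructor
  · rintro ⟨Y, ⟨a⟩, ⟨b⟩⟩
    exact ⟨⟨Y⟩, ⟨Ho.clIso a⟩, ⟨Ho.clIso b⟩⟩
  · rintro ⟨Y, ⟨a⟩, ⟨b⟩⟩
    exact ⟨Y.of, key a, key b⟩

theorem invertible_one : Invertible₀ (one : C) := ⟨one, ⟨lUnit one⟩, ⟨lUnit one⟩⟩

theorem Invertible₀.tensor {X Y : C} (hX : Invertible₀ X) (hY : Invertible₀ Y) :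
    Invertible₀ (X ⊠ Y) := by
  rw [invertible_iff] at *
  obtain ⟨X', ⟨a⟩, ⟨b⟩⟩ := hX
  obtain ⟨Y', ⟨a'⟩, ⟨b'⟩⟩ := hY
  have key {P Q Q' P' : Ho C} (e : Q ⊗ Q' ≅ 𝟙_ _) (e' : P ⊗ P' ≅ 𝟙_ _) :
      (P ⊗ Q) ⊗ (Q' ⊗ P') ≅ 𝟙_ _ :=
    MonoidalCategory.associator _ _ _ ≪≫ MonoidalCategory.whiskerLeftIso P ((MonoidalCategory.associator _ _ _).symm ≪≫
      MonoidalCategory.whiskerRightIso e P' ≪≫ MonoidalCategory.leftUnitor P') ≪≫ e'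
  exact ⟨Y' ⊗ X', ⟨key a' a⟩, ⟨key b b'⟩⟩

end Duals

/-! ### The core on a class of objects -/

section Core

variable {C : Type u} [Bicategory.{w, v} C]

/-- The equivalences and the invertible 2-morphisms between the objects satisfying `P`. -/
def coreDisplayed (P : C → Prop) : Displayed.{w, v, u, 0, 0} C where
  Ob a := PLift (P a)
  Hm _ _ f := PLift (IsEquivalence₁ f)
  Two _ _ η := IsIso η
  idH _ := ⟨isEquivalence₁_id _⟩
  compH p q := ⟨p.down.comp q.down⟩
  invH e _ := ⟨isEquivalence₁_inv e⟩
  two_iso _ _ _ := inferInstance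
  two_comp := fun h h' => by
    have := h
    have := h'
    infer_instance
  two_whiskerLeft _ _ _ _ _ _ h := by
    have := h
    infer_instance
  two_whiskerRight h _ _ := by
    have := h
    infer_instance

/-- The maximal sub-bigroupoid on the objects satisfying `P`: its 1-morphisms are the
equivalences, and its 2-morphisms are the invertible 2-morphisms. -/
abbrev CoreOn (P : C → Prop) := (coreDisplayed P).Total

variable [MonoidalBicategory C]

/-- A class of objects that contains the unit and is closed under tensor products. -/
class TensorClosed (P : C → Prop) : Prop where
  one : P one
  tensor {X Y : C} : P X → P Y → P (X ⊠ Y)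

/-- The core on a class of objects closed under tensor products is compatible with the tensor
product. -/
def coreMonoidal (P : C → Prop) [hP : TensorClosed P] : (coreDisplayed P).Monoidal where
  obT x y := ⟨hP.tensor x.down y.down⟩
  obOne := ⟨hP.one⟩
  hmT p q := ⟨p.down.tensor q.down⟩
  two_tensor {_ _ _ _ _ _ _ _ _ _ _ _ _ _ _ _ η θ} h h' := by
    have : IsIso η := h
    have : IsIso θ := h'
    exact (tIso (asIso η) (asIso θ)).isIso_hom
  hmAssoc _ _ _ := ⟨isEquivalence₁_hom _⟩
  hmLUnit _ := ⟨isEquivalence₁_hom _⟩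
  hmRUnit _ := ⟨isEquivalence₁_hom _⟩

instance (P : C → Prop) [TensorClosed P] : MonoidalBicategory (CoreOn P) :=
  (coreMonoidal P).monoidalBicategory

instance : TensorClosed (FullyDualizable (C := C)) where
  one := fullyDualizable_one
  tensor := FullyDualizable.tensor

instance : TensorClosed (Invertible₀ (C := C)) where
  one := invertible_one
  tensor := Invertible₀.tensor

variable (C)

/-- The core of the fully dualizable objects. -/
abbrev CoreFD := CoreOn (FullyDualizable (C := C))

/-- The Picard groupoid: the maximal sub-bigroupoid on the invertible objects. -/
abbrev Pic := CoreOn (Invertible₀ (C := C))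

end Core

/-! ### Monoidal transformations of the identity -/

/-- A monoidal pseudonatural transformation of the identity pseudofunctor of a monoidal
bicategory. -/
structure MonoidalIdTrans (D : Type u) [Bicategory.{w, v} D] [MonoidalBicategory D] where
  /-- The underlying pseudonatural transformation. -/
  trans : Pseudofunctor.StrongTrans (Pseudofunctor.id D) (Pseudofunctor.id D)
  /-- The compatibility with tensor products. -/
  tensorCell (X Y : D) : trans.app (X ⊠ Y) ≅ trans.app X ⊠₁ trans.app Y
  /-- The compatibility with the unit. -/
  unitCell : trans.app one ≅ 𝟙 one
  tensorCell_naturality {X X' Y Y' : D} (f : X ⟶ X') (g : Y ⟶ Y') :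
    Sq.Cube (trans.naturality (f ⊠₁ g)) (sqT (trans.naturality f) (trans.naturality g))
      (𝟙 _) (tensorCell X Y).hom (tensorCell X' Y').hom (𝟙 _)
  tensorCell_assoc (X Y Z : D) :
    (trans.naturality (as X Y Z)).hom ≫
      ((tensorCell (X ⊠ Y) Z).hom ≫ (tensorCell X Y).hom ⊠₂ 𝟙 _) ▷ as X Y Z ≫
        (assocNat (trans.app X) (trans.app Y) (trans.app Z)).hom =
    as X Y Z ◁ ((tensorCell X (Y ⊠ Z)).hom ≫ 𝟙 _ ⊠₂ (tensorCell Y Z).hom)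
  tensorCell_lUnit (X : D) :
    (trans.naturality (lUnit X).hom).hom ≫
      ((tensorCell one X).hom ≫ unitCell.hom ⊠₂ 𝟙 _) ▷ (lUnit X).hom ≫
        (lUnitNat (trans.app X)).hom = 𝟙 _
  tensorCell_rUnit (X : D) :
    (trans.naturality (rUnit X).hom).hom ≫
      ((tensorCell X one).hom ≫ 𝟙 _ ⊠₂ unitCell.hom) ▷ (rUnit X).hom ≫
        (rUnitNat (trans.app X)).hom = 𝟙 _

namespace MonoidalIdTrans

open Displayed

section

variable {D : Type u} [Bicategory.{w, v} D] [MonoidalBicategory D] (S : MonoidalIdTrans D)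

/-- The component of the transformation at an object. -/
def s (X : D) : X ⟶ X := S.trans.app X

/-- The pseudonaturality square of the transformation at a 1-morphism. -/
def sn {X Y : D} (f : X ⟶ Y) : Sq f (S.s X) (S.s Y) f := S.trans.naturality f

end

variable {C : Type u} [Bicategory.{w, v} C] [MonoidalBicategory C]

/-- The inclusion of objects between cores. -/
abbrev coreObj {P Q : C → Prop} (h : ∀ X, P X → Q X) (X : CoreOn P) : CoreOn Q :=
  ⟨X.base, ⟨h _ X.fib.down⟩⟩

/-- The inclusion of 1-morphisms between cores. -/
abbrev coreMap {P Q : C → Prop} (h : ∀ X, P X → Q X) {X Y : CoreOn P} (f : X ⟶ Y) :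
    coreObj h X ⟶ coreObj h Y :=
  mk₁ (b₁ f : X.base ⟶ Y.base) ⟨(fib₁ f).down⟩

/-- The restriction of a monoidal transformation of the identity to a smaller core. -/
def restrict {P Q : C → Prop} [TensorClosed P] [TensorClosed Q] (h : ∀ X, P X → Q X)
    (S : MonoidalIdTrans (CoreOn Q)) : MonoidalIdTrans (CoreOn P) where
  trans :=
    { app X := mk₁ (X := X) (Y := X)
        (b₁ (X := coreObj h X) (Y := coreObj h X) (S.s (coreObj h X)))
        ⟨(fib₁ (X := coreObj h X) (Y := coreObj h X) (S.s (coreObj h X))).down⟩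
      naturality f := liftIso (baseIso (S.sn (coreMap h f)) :)
      naturality_naturality {X Y f g} η := ext₂ (congrArg b₂
        (S.trans.naturality_naturality (f := coreMap h f) (g := coreMap h g)
          (mk₂ (b₂ η : b₁ f ⟶ b₁ g) (prop₂ η))) :)
      naturality_id X := ext₂ (congrArg b₂ (S.trans.naturality_id (coreObj h X)) :)
      naturality_comp f g := ext₂ (congrArg b₂
        (S.trans.naturality_comp (coreMap h f) (coreMap h g)) :) }
  tensorCell X Y := liftIso (baseIso (S.tensorCell (coreObj h X) (coreObj h Y)) :)
  unitCell := liftIso (baseIso S.unitCell :)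
  tensorCell_naturality f g := ext₂ (congrArg b₂
    (S.tensorCell_naturality (coreMap h f) (coreMap h g)) :)
  tensorCell_assoc X Y Z := ext₂ (congrArg b₂
    (S.tensorCell_assoc (coreObj h X) (coreObj h Y) (coreObj h Z)) :)
  tensorCell_lUnit X := ext₂ (congrArg b₂ (S.tensorCell_lUnit (coreObj h X)) :)
  tensorCell_rUnit X := ext₂ (congrArg b₂ (S.tensorCell_rUnit (coreObj h X)) :)

end MonoidalIdTrans

/-! ### The Serre automorphism -/

/-- The Serre automorphism of a fully dualizable object. -/
def FullDuality.serre {C : Type u} [Bicategory.{w, v} C] [SymmetricMonoidalBicategory C] {X : C}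
    (d : FullDuality X) : X ⟶ X :=
  (rUnit X).inv ≫ wl X d.evR ≫ as' X X d.dual ≫ wr (br X X) d.dual ≫ as X X d.dual ≫
    wl X d.ev ≫ (rUnit X).hom

namespace MonoidalIdTrans

variable {D : Type u} [Bicategory.{w, v} D] [MonoidalBicategory D] (S : MonoidalIdTrans D)

/-- The compatibility with tensor products. -/
def tc (a b : D) : S.s (a ⊠ b) ≅ S.s a ⊠₁ S.s b := S.tensorCell a b

/-- The compatibility with the unit. -/
def uc : S.s one ≅ 𝟙 (one : D) := S.unitCell

theorem sn_naturality {X Y : D} {f g : X ⟶ Y} (η : f ⟶ g) :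
    η ▷ S.s Y ≫ (S.sn g).hom = (S.sn f).hom ≫ S.s X ◁ η :=
  S.trans.naturality_naturality η

theorem sn_id (X : D) : (S.sn (𝟙 X)).hom = (λ_ (S.s X)).hom ≫ (ρ_ (S.s X)).inv := by
  have h : (S.sn (𝟙 X)).hom ≫ S.s X ◁ 𝟙 (𝟙 X) =
    𝟙 (𝟙 X) ▷ S.s X ≫ (λ_ (S.s X)).hom ≫ (ρ_ (S.s X)).inv := S.trans.naturality_id X
  simpa using h

theorem sn_comp {X Y Z : D} (f : X ⟶ Y) (g : Y ⟶ Z) : (S.sn (f ≫ g)).hom =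
    (α_ f g (S.s Z)).hom ≫ f ◁ (S.sn g).hom ≫ (α_ f (S.s Y) g).inv ≫ (S.sn f).hom ▷ g ≫
      (α_ (S.s X) f g).hom := by
  have h : (S.sn (f ≫ g)).hom ≫ S.s X ◁ 𝟙 (f ≫ g) = 𝟙 (f ≫ g) ▷ S.s Z ≫
    (α_ f g (S.s Z)).hom ≫ f ◁ (S.sn g).hom ≫ (α_ f (S.s Y) g).inv ≫ (S.sn f).hom ▷ g ≫
      (α_ (S.s X) f g).hom := S.trans.naturality_comp f g
  simpa using h

/-- The 2-morphism `f ≫ s b ⟶ f` given by a trivialization `l` of `s a`. -/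
def lHom {a b : D} (l : S.s a ≅ 𝟙 a) (f : a ⟶ b) : f ≫ S.s b ⟶ f :=
  (S.sn f).hom ≫ l.hom ▷ f ≫ (λ_ f).hom

/-- Compatibility of a 1-morphism with trivializations of the components of the transformation. -/
def LCond {a b : D} (l : S.s a ≅ 𝟙 a) (l' : S.s b ≅ 𝟙 b) (f : a ⟶ b) : Prop :=
  S.lHom l f = f ◁ l'.hom ≫ (ρ_ f).hom

theorem lHom_naturality {a b : D} (l : S.s a ≅ 𝟙 a) {f g : a ⟶ b} (η : f ⟶ g) :
    η ▷ S.s b ≫ S.lHom l g = S.lHom l f ≫ η := by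
  simp only [lHom, ← Category.assoc, sn_naturality]
  simp only [Category.assoc, whisker_exchange_assoc, id_whiskerLeft, Iso.inv_hom_id, comp_id]

theorem lCond_id {a : D} (l : S.s a ≅ 𝟙 a) : S.LCond l l (𝟙 a) := by
  simp [LCond, lHom, sn_id, unitors_equal]

theorem LCond.of_iso {a b : D} {l : S.s a ≅ 𝟙 a} {l' : S.s b ≅ 𝟙 b} {f g : a ⟶ b}
    (h : S.LCond l l' f) (e : f ≅ g) : S.LCond l l' g := by
  have h' := S.lHom_naturality l e.inv
  rw [h] at h'
  rw [LCond, ← cancel_mono e.inv, ← h', ← whisker_exchange_assoc]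
  simp

theorem lHom_comp {a b c : D} {l : S.s a ≅ 𝟙 a} {l' : S.s b ≅ 𝟙 b} {f : a ⟶ b}
    (h : S.LCond l l' f) (g : b ⟶ c) : S.lHom l (f ≫ g) = (α_ f g _).hom ≫ f ◁ S.lHom l' g := by
  calc
    _ = (α_ f g _).hom ≫ f ◁ (S.sn g).hom ≫ (α_ _ _ _).inv ≫ S.lHom l f ▷ g := by
      simp [lHom, sn_comp]
    _ = _ := by
      rw [h]
      simp [lHom]

theorem LCond.comp {a b c : D} {l : S.s a ≅ 𝟙 a} {l' : S.s b ≅ 𝟙 b} {l'' : S.s c ≅ 𝟙 c}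
    {f : a ⟶ b} {g : b ⟶ c} (h : S.LCond l l' f) (h' : S.LCond l' l'' g) :
    S.LCond l l'' (f ≫ g) := by
  rw [LCond, lHom_comp S h, h']
  simp

theorem LCond.inv {a b : D} {l : S.s a ≅ 𝟙 a} {l' : S.s b ≅ 𝟙 b} {e : a ≌ b}
    (h : S.LCond l l' e.hom) : S.LCond l' l e.inv := by
  have h₁ : S.LCond l l (e.hom ≫ e.inv) := (S.lCond_id l).of_iso _ e.unit
  rw [LCond, lHom_comp S h] at h₁
  have h₂ : e.hom ◁ S.lHom l' e.inv = e.hom ◁ (e.inv ◁ l.hom ≫ (ρ_ e.inv).hom) := by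
    rw [← cancel_epi (α_ _ _ _).hom, h₁]
    simp
  have h₃ : (e.inv ≫ e.hom) ◁ S.lHom l' e.inv =
      (e.inv ≫ e.hom) ◁ (e.inv ◁ l.hom ≫ (ρ_ e.inv).hom) := by
    rw [comp_whiskerLeft, h₂, ← comp_whiskerLeft]
  have h₄ : 𝟙 b ◁ S.lHom l' e.inv = 𝟙 b ◁ (e.inv ◁ l.hom ≫ (ρ_ e.inv).hom) := by
    rw [← cancel_epi (e.counit.hom ▷ _), ← whisker_exchange, h₃, whisker_exchange]
  rw [LCond]
  simpa only [id_whiskerLeft, cancel_epi, cancel_mono] using h₄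

end MonoidalIdTrans

/-! ### Actions of the circle group -/

/-- An action of the circle group on a monoidal bicategory by monoidal transformations of the
identity. The fundamental 2-groupoid of the circle group is replaced by the equivalent monoidal
bicategory with one object, the integers as 1-morphisms, and only identity 2-morphisms. The object
acts by the identity pseudofunctor, and the integer `n` acts by the transformation `act n`. The
invertible modifications `zero` and `add` express that the action is functorial on 1-morphisms.
The argument `m + n = k` of `add` avoids a transport along the associativity of addition. -/
structure CircleAction (D : Type u) [Bicategory.{w, v} D] [MonoidalBicategory D] where
  /-- The transformation by which an integer acts. -/
  act (n : ℤ) : MonoidalIdTrans D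
  /-- The components of the compatibility with identities. -/
  zero (X : D) : (act 0).s X ≅ 𝟙 X
  /-- The components of the compatibility with composition. -/
  add {m n k : ℤ} (h : m + n = k) (X : D) : (act k).s X ≅ (act m).s X ≫ (act n).s X
  -- `zero` and `add` are modifications
  zero_naturality {X Y : D} (f : X ⟶ Y) :
    ((act 0).sn f).hom ≫ (zero X).hom ▷ f ≫ (λ_ f).hom = f ◁ (zero Y).hom ≫ (ρ_ f).hom
  add_naturality {m n k : ℤ} (h : m + n = k) {X Y : D} (f : X ⟶ Y) :
    ((act k).sn f).hom ≫ (add h X).hom ▷ f =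
      f ◁ (add h Y).hom ≫ (Sq.hcomp ((act m).sn f) ((act n).sn f)).hom
  -- `zero` and `add` are monoidal
  zero_tensor (X Y : D) : ((act 0).tc X Y).hom ≫ ((zero X).hom ⊠₂ (zero Y).hom) ≫ (tId X Y).hom =
    (zero (X ⊠ Y)).hom
  zero_one : (act 0).uc.hom = (zero one).hom
  add_tensor {m n k : ℤ} (h : m + n = k) (X Y : D) :
    ((act k).tc X Y).hom ≫ ((add h X).hom ⊠₂ (add h Y).hom) ≫ (tComp _ _ _ _).hom =
      (add h (X ⊠ Y)).hom ≫ ((act m).tc X Y).hom ▷ (act n).s (X ⊠ Y) ≫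
        ((act m).s X ⊠₁ (act m).s Y) ◁ ((act n).tc X Y).hom
  add_one {m n k : ℤ} (h : m + n = k) : (act k).uc.hom =
    (add h one).hom ≫ (act m).uc.hom ▷ (act n).s one ≫ (λ_ _).hom ≫ (act n).uc.hom
  -- unitality and associativity
  add_left_unit {n : ℤ} (h : 0 + n = n) (X : D) :
    (add h X).hom ≫ (zero X).hom ▷ (act n).s X ≫ (λ_ _).hom = 𝟙 _
  add_right_unit {n : ℤ} (h : n + 0 = n) (X : D) :
    (add h X).hom ≫ (act n).s X ◁ (zero X).hom ≫ (ρ_ _).hom = 𝟙 _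
  add_assoc {m n p k l q : ℤ} (h₁ : m + n = k) (h₂ : k + p = q) (h₃ : n + p = l) (h₄ : m + l = q)
    (X : D) : (add h₂ X).hom ≫ (add h₁ X).hom ▷ (act p).s X ≫ (α_ _ _ _).hom =
      (add h₄ X).hom ≫ (act m).s X ◁ (add h₃ X).hom

namespace CircleAction

open Displayed MonoidalIdTrans

/-- The restriction of an action to a smaller core. -/
def restrict {C : Type u} [Bicategory.{w, v} C] [MonoidalBicategory C] {P Q : C → Prop}
    [TensorClosed P] [TensorClosed Q] (h : ∀ X, P X → Q X) (A : CircleAction (CoreOn Q)) :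
    CircleAction (CoreOn P) where
  act n := (A.act n).restrict h
  zero X := liftIso (baseIso (A.zero (coreObj h X)) :)
  add e X := liftIso (baseIso (A.add e (coreObj h X)) :)
  zero_naturality f := ext₂ (congrArg b₂ (A.zero_naturality (coreMap h f)) :)
  add_naturality e _ _ f := ext₂ (congrArg b₂ (A.add_naturality e (coreMap h f)) :)
  zero_tensor X Y := ext₂ (congrArg b₂ (A.zero_tensor (coreObj h X) (coreObj h Y)) :)
  zero_one := ext₂ (congrArg b₂ A.zero_one :)
  add_tensor e X Y := ext₂ (congrArg b₂ (A.add_tensor e (coreObj h X) (coreObj h Y)) :)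
  add_one e := ext₂ (congrArg b₂ (A.add_one e) :)
  add_left_unit e X := ext₂ (congrArg b₂ (A.add_left_unit e (coreObj h X)) :)
  add_right_unit e X := ext₂ (congrArg b₂ (A.add_right_unit e (coreObj h X)) :)
  add_assoc h₁ h₂ h₃ h₄ X := ext₂ (congrArg b₂ (A.add_assoc h₁ h₂ h₃ h₄ (coreObj h X)) :)

/-- A trivialization of the components of an action at an object, compatible with addition. -/
@[ext]
structure Triv {D : Type u} [Bicategory.{w, v} D] [MonoidalBicategory D] (A : CircleAction D)
    (c : D) where
  /-- The trivialization of the component of `act n`. -/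
  l (n : ℤ) : (A.act n).s c ≅ 𝟙 c
  l_zero : (l 0).hom = (A.zero c).hom
  l_add {m n k : ℤ} (h : m + n = k) : (l k).hom =
    (A.add h c).hom ≫ (l m).hom ▷ (A.act n).s c ≫ (λ_ _).hom ≫ (l n).hom

end CircleAction

/-! ### Homotopy fixed points -/

/-- The structure of a homotopy fixed point on an object `c`, for an action of the circle group:
the data of a tritransformation from the constant trifunctor at the terminal bicategory to the
trifunctor given by the action. -/
structure FixedPoint {D : Type u} [Bicategory.{w, v} D] [MonoidalBicategory D]
    (A : CircleAction D) (c : D) where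
  /-- The 1-morphism `Θ`; it is an equivalence because of `unit`. -/
  Θ : c ⟶ c
  /-- The 2-morphism `Θ_n`, the pseudonaturality of `Θ` at the integer `n`. -/
  nat (n : ℤ) : Θ ≫ (A.act n).s c ≅ Θ
  /-- The 2-morphism `Π`. -/
  mul : Θ ≫ Θ ≅ Θ
  /-- The 2-morphism `M`. -/
  unit : Θ ≅ 𝟙 c
  -- pseudonaturality
  nat_zero : (nat 0).hom = Θ ◁ (A.zero c).hom ≫ (ρ_ Θ).hom
  nat_add {m n k : ℤ} (h : m + n = k) : (nat k).hom = Θ ◁ (A.add h c).hom ≫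
    (α_ Θ ((A.act m).s c) ((A.act n).s c)).inv ≫ (nat m).hom ▷ (A.act n).s c ≫ (nat n).hom
  -- `Π` is a modification
  mul_nat {m n k : ℤ} (h : m + n = k) :
    Θ ◁ (Θ ◁ (A.add h c).hom ≫ (α_ Θ ((A.act m).s c) ((A.act n).s c)).inv ≫
      ((A.act m).sn Θ).hom ▷ (A.act n).s c ≫ (α_ ((A.act m).s c) Θ ((A.act n).s c)).hom ≫
      (A.act m).s c ◁ (nat n).hom) ≫
      (α_ Θ ((A.act m).s c) Θ).inv ≫ (nat m).hom ▷ Θ ≫ mul.hom =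
    (α_ Θ Θ ((A.act k).s c)).inv ≫ mul.hom ▷ (A.act k).s c ≫ (nat k).hom
  -- the equations for `Π` and `M`
  mul_assoc : mul.hom ▷ Θ ≫ mul.hom = (α_ Θ Θ Θ).hom ≫ Θ ◁ mul.hom ≫ mul.hom
  mul_left : mul.hom = Θ ◁ unit.hom ≫ (ρ_ Θ).hom
  mul_right : mul.hom = unit.hom ▷ Θ ≫ (λ_ Θ).hom

/-- The structure of a 1-morphism of homotopy fixed points on a 1-morphism `f`. -/
@[ext]
structure FixedPointHom {D : Type u} [Bicategory.{w, v} D] [MonoidalBicategory D]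
    {A : CircleAction D} {a b : D} (x : FixedPoint A a) (y : FixedPoint A b) (f : a ⟶ b) where
  /-- The 2-morphism `m`. -/
  m : x.Θ ≫ f ≅ f ≫ y.Θ
  -- `m` is a modification
  m_nat (n : ℤ) : x.Θ ◁ ((A.act n).sn f).hom ≫ (α_ x.Θ ((A.act n).s a) f).inv ≫
      (x.nat n).hom ▷ f ≫ m.hom =
    (α_ x.Θ f ((A.act n).s b)).inv ≫ m.hom ▷ (A.act n).s b ≫ (α_ f y.Θ ((A.act n).s b)).hom ≫
      f ◁ (y.nat n).hom
  -- the compatibility with `Π` and `M`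
  m_mul : x.mul.hom ▷ f ≫ m.hom = (α_ x.Θ x.Θ f).hom ≫ x.Θ ◁ m.hom ≫ (α_ x.Θ f y.Θ).inv ≫
    m.hom ▷ y.Θ ≫ (α_ f y.Θ y.Θ).hom ≫ f ◁ y.mul.hom
  m_unit : m.hom ≫ f ◁ y.unit.hom ≫ (ρ_ f).hom = x.unit.hom ▷ f ≫ (λ_ f).hom

namespace FixedPoint

variable {D : Type u} [Bicategory.{w, v} D]

theorem unit_exchange {c : D} {Θ : c ⟶ c} (M : Θ ≅ 𝟙 c) :
    Θ ◁ M.hom ≫ (ρ_ Θ).hom = M.hom ▷ Θ ≫ (λ_ Θ).hom := by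
  have h := whisker_exchange M.hom M.hom
  rw [← cancel_mono M.hom, Category.assoc, Category.assoc, ← rightUnitor_naturality,
    ← leftUnitor_naturality, ← Category.assoc, ← Category.assoc, h, unitors_equal]

theorem unit_exchange' {c d : D} {Θ : c ⟶ c} (M : Θ ≅ 𝟙 c) (f : c ⟶ d) :
    M.hom ▷ (Θ ≫ f) ≫ (λ_ (Θ ≫ f)).hom = Θ ◁ (M.hom ▷ f ≫ (λ_ f).hom) := by
  have h := congrArg (fun t => (α_ Θ Θ f).inv ≫ t ▷ f) (unit_exchange M)
  simp only [comp_whiskerRight] at h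
  calc
    _ = (α_ Θ Θ f).inv ≫ M.hom ▷ Θ ▷ f ≫ (λ_ Θ).hom ▷ f := by simp
    _ = _ := by
      rw [← h]
      simp

theorem unit_naturality {c d : D} {Θ : c ⟶ c} {f g : c ⟶ d} (M : Θ ≅ 𝟙 c) (η : f ⟶ g) :
    Θ ◁ η ≫ M.hom ▷ g ≫ (λ_ g).hom = M.hom ▷ f ≫ (λ_ f).hom ≫ η := by
  rw [whisker_exchange_assoc]
  simp

variable [MonoidalBicategory D]

/-- The 2-morphism `Θ ≫ s c ≅ Θ` given by a trivialization. -/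
def natOfTriv {S : MonoidalIdTrans D} {c : D} {Θ : c ⟶ c} (M : Θ ≅ 𝟙 c) (l : S.s c ≅ 𝟙 c) :
    Θ ≫ S.s c ≅ Θ :=
  whiskerRightIso M (S.s c) ≪≫ λ_ (S.s c) ≪≫ l ≪≫ M.symm

theorem natOfTriv_eq {S : MonoidalIdTrans D} {c : D} {Θ : c ⟶ c} (M : Θ ≅ 𝟙 c)
    (l : S.s c ≅ 𝟙 c) : (natOfTriv M l).hom = S.lHom l Θ := by
  have h₁ := S.lHom_naturality l M.hom
  have h₂ : S.lHom l (𝟙 c) = (λ_ _).hom ≫ l.hom := by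
    simp [MonoidalIdTrans.lHom, MonoidalIdTrans.sn_id, unitors_equal]
  rw [h₂] at h₁
  rw [← cancel_mono M.hom, ← h₁]
  simp [natOfTriv]

variable {A : CircleAction D}

/-- The 2-morphism `s c ≅ 𝟙 c` given by a homotopy fixed point and an integer. -/
def trivIso {c : D} (x : FixedPoint A c) (n : ℤ) : (A.act n).s c ≅ 𝟙 c :=
  (λ_ _).symm ≪≫ whiskerRightIso x.unit.symm _ ≪≫ x.nat n ≪≫ x.unit

theorem natOfTriv_trivIso {c : D} (x : FixedPoint A c) (n : ℤ) :
    natOfTriv x.unit (x.trivIso n) = x.nat n := by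
  ext
  simp [natOfTriv, trivIso]

/-- The trivialization given by a homotopy fixed point. -/
@[simps]
def triv {c : D} (x : FixedPoint A c) : A.Triv c where
  l := x.trivIso
  l_zero := by
    simp only [trivIso, Iso.trans_hom, x.nat_zero]
    have h := whisker_exchange x.unit.inv (A.zero c).hom
    simp only [Iso.symm_hom, whiskerRightIso_hom, Category.assoc]
    rw [← reassoc_of% h]
    simp
  l_add {m n k} h := by
    have h₁ := whisker_exchange x.unit.inv (A.add h c).hom
    simp only [trivIso, Iso.trans_hom, x.nat_add h, Iso.symm_hom, whiskerRightIso_hom,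
      Category.assoc]
    rw [← reassoc_of% h₁]
    simp

theorem natOfTriv_add {c : D} {Θ : c ⟶ c} (M : Θ ≅ 𝟙 c) (t : A.Triv c) {m n k : ℤ}
    (h : m + n = k) : (natOfTriv M (t.l k)).hom = Θ ◁ (A.add h c).hom ≫
      (α_ Θ ((A.act m).s c) ((A.act n).s c)).inv ≫
      (natOfTriv M (t.l m)).hom ▷ (A.act n).s c ≫ (natOfTriv M (t.l n)).hom := by
  have h₁ := whisker_exchange M.hom (A.add h c).hom
  calc
    _ = (M.hom ▷ (A.act k).s c ≫ 𝟙 c ◁ (A.add h c).hom) ≫ (λ_ _).hom ≫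
        (t.l m).hom ▷ (A.act n).s c ≫ (λ_ _).hom ≫ (t.l n).hom ≫ M.inv := by
      simp [natOfTriv, t.l_add h]
    _ = _ := by
      rw [← h₁]
      simp [natOfTriv]

/-- The homotopy fixed point given by a trivialization. -/
@[simps]
def ofTriv {c : D} (Θ : c ⟶ c) (M : Θ ≅ 𝟙 c) (t : A.Triv c) : FixedPoint A c where
  Θ := Θ
  nat n := natOfTriv M (t.l n)
  mul := whiskerRightIso M Θ ≪≫ λ_ Θ
  unit := M
  nat_zero := by
    rw [← cancel_mono M.hom]
    have h := whisker_exchange M.hom (A.zero c).hom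
    calc
      _ = M.hom ▷ (A.act 0).s c ≫ 𝟙 c ◁ (A.zero c).hom ≫ (λ_ _).hom := by
        simp [natOfTriv, t.l_zero]
      _ = _ := by
        rw [← reassoc_of% h]
        simp [unitors_equal]
  nat_add {m n k} h := natOfTriv_add M t h
  mul_assoc := by
    dsimp only [Iso.trans_hom, whiskerRightIso_hom]
    have h := unit_exchange' M Θ
    calc
      _ = (α_ Θ Θ Θ).hom ≫ (M.hom ▷ (Θ ≫ Θ) ≫ (λ_ (Θ ≫ Θ)).hom) ≫ M.hom ▷ Θ ≫ (λ_ Θ).hom := by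
        simp
      _ = _ := by rw [h]; rfl
  mul_left := (unit_exchange M).symm
  mul_right := rfl
  mul_nat {m n k} h := by
    calc
      _ = Θ ◁ (Θ ◁ (A.add h c).hom ≫ (α_ Θ ((A.act m).s c) ((A.act n).s c)).inv ≫
          ((A.act m).sn Θ).hom ▷ (A.act n).s c ≫ (α_ ((A.act m).s c) Θ ((A.act n).s c)).hom ≫
          (A.act m).s c ◁ (natOfTriv M (t.l n)).hom) ≫
          (M.hom ▷ ((A.act m).s c ≫ Θ) ≫ (λ_ _).hom) ≫ (t.l m).hom ▷ Θ ≫ (λ_ Θ).hom := by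
        simp [natOfTriv]
      _ = M.hom ▷ (Θ ≫ (A.act k).s c) ≫ (λ_ _).hom ≫ (Θ ◁ (A.add h c).hom ≫
          (α_ Θ ((A.act m).s c) ((A.act n).s c)).inv ≫ ((A.act m).sn Θ).hom ▷ (A.act n).s c ≫
          (α_ ((A.act m).s c) Θ ((A.act n).s c)).hom ≫
          ((A.act m).s c ◁ (natOfTriv M (t.l n)).hom ≫ (t.l m).hom ▷ Θ) ≫ (λ_ Θ).hom) := by
        rw [Category.assoc, reassoc_of% (unit_naturality M)]
        simp only [Category.assoc]
      _ = M.hom ▷ (Θ ≫ (A.act k).s c) ≫ (λ_ _).hom ≫ (Θ ◁ (A.add h c).hom ≫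
          (α_ Θ ((A.act m).s c) ((A.act n).s c)).inv ≫
          ((A.act m).lHom (t.l m) Θ) ▷ (A.act n).s c ≫ (natOfTriv M (t.l n)).hom) := by
        rw [whisker_exchange]
        simp [MonoidalIdTrans.lHom]
      _ = _ := by
        rw [← natOfTriv_eq M (t.l m), ← natOfTriv_add M t h]
        simp

theorem triv_ofTriv {c : D} (Θ : c ⟶ c) (M : Θ ≅ 𝟙 c) (t : A.Triv c) :
    (ofTriv Θ M t).triv = t := by
  ext n
  change (λ_ _).inv ≫ M.inv ▷ _ ≫
    (M.hom ▷ _ ≫ (λ_ _).hom ≫ (t.l n).hom ≫ M.inv) ≫ M.hom = (t.l n).hom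
  simp

end FixedPoint

namespace FixedPointHom

variable {D : Type u} [Bicategory.{w, v} D] [MonoidalBicategory D] {A : CircleAction D}

theorem cond_iff {a b : D} {x : FixedPoint A a} {y : FixedPoint A b} {f : a ⟶ b}
    (m : x.Θ ≫ f ≅ f ≫ y.Θ)
    (h : m.hom ≫ f ◁ y.unit.hom ≫ (ρ_ f).hom = x.unit.hom ▷ f ≫ (λ_ f).hom) (n : ℤ) :
    x.Θ ◁ ((A.act n).sn f).hom ≫ (α_ x.Θ ((A.act n).s a) f).inv ≫ (x.nat n).hom ▷ f ≫ m.hom =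
      (α_ x.Θ f ((A.act n).s b)).inv ≫ m.hom ▷ (A.act n).s b ≫
        (α_ f y.Θ ((A.act n).s b)).hom ≫ f ◁ (y.nat n).hom ↔
    (A.act n).LCond (x.trivIso n) (y.trivIso n) f := by
  have hx : (x.nat n).hom ≫ x.unit.hom =
      x.unit.hom ▷ (A.act n).s a ≫ (λ_ _).hom ≫ (x.trivIso n).hom := by
    simp [FixedPoint.trivIso]
  have hy : (y.nat n).hom ≫ y.unit.hom =
      y.unit.hom ▷ (A.act n).s b ≫ (λ_ _).hom ≫ (y.trivIso n).hom := by
    simp [FixedPoint.trivIso]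
  generalize x.nat n = xn at *
  generalize y.nat n = yn at *
  generalize x.trivIso n = xt at *
  generalize y.trivIso n = yt at *
  generalize A.act n = S at *
  have e₁ : (x.Θ ◁ (S.sn f).hom ≫ (α_ x.Θ (S.s a) f).inv ≫ xn.hom ▷ f ≫ m.hom) ≫
      f ◁ y.unit.hom ≫ (ρ_ f).hom =
      (x.unit.hom ▷ (f ≫ S.s b) ≫ (λ_ _).hom) ≫ S.lHom xt f := by
    calc
      _ = x.Θ ◁ (S.sn f).hom ≫ (α_ x.Θ (S.s a) f).inv ≫ (xn.hom ≫ x.unit.hom) ▷ f ≫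
          (λ_ f).hom := by simp [h]
      _ = x.Θ ◁ (S.sn f).hom ≫ (x.unit.hom ▷ (S.s a ≫ f) ≫ (λ_ (S.s a ≫ f)).hom) ≫
          xt.hom ▷ f ≫ (λ_ f).hom := by rw [hx]; simp
      _ = _ := by
        rw [Category.assoc, whisker_exchange_assoc]
        simp [MonoidalIdTrans.lHom]
  have e₂ : ((α_ x.Θ f (S.s b)).inv ≫ m.hom ▷ S.s b ≫ (α_ f y.Θ (S.s b)).hom ≫
      f ◁ yn.hom) ≫ f ◁ y.unit.hom ≫ (ρ_ f).hom =
      (x.unit.hom ▷ (f ≫ S.s b) ≫ (λ_ _).hom) ≫ f ◁ yt.hom ≫ (ρ_ f).hom := by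
    calc
      _ = (α_ x.Θ f (S.s b)).inv ≫ m.hom ▷ S.s b ≫ (α_ f y.Θ (S.s b)).hom ≫
          f ◁ (yn.hom ≫ y.unit.hom) ≫ (ρ_ f).hom := by simp
      _ = (α_ x.Θ f (S.s b)).inv ≫ (m.hom ≫ f ◁ y.unit.hom ≫ (ρ_ f).hom) ▷ S.s b ≫
          f ◁ yt.hom ≫ (ρ_ f).hom := by rw [hy]; simp
      _ = _ := by rw [h]; simp
  rw [← cancel_mono (f ◁ y.unit.hom ≫ (ρ_ f).hom), e₁, e₂, cancel_epi]
  rfl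

/-- The 1-morphism of homotopy fixed points given by a 1-morphism compatible with the
trivializations. -/
def ofCond {a b : D} (x : FixedPoint A a) (y : FixedPoint A b) {f : a ⟶ b}
    (h : ∀ n, (A.act n).LCond (x.triv.l n) (y.triv.l n) f) : FixedPointHom x y f where
  m := whiskerRightIso x.unit f ≪≫ λ_ f ≪≫ (ρ_ f).symm ≪≫ whiskerLeftIso f y.unit.symm
  m_nat n := (cond_iff _ (by simp) n).2 (h n)
  m_mul := by
    have h₀ := FixedPoint.unit_naturality x.unit (x.unit.hom ▷ f ≫ (λ_ f).hom ≫ (ρ_ f).inv ≫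
      f ◁ y.unit.inv)
    rw [x.mul_right, y.mul_right]
    calc
      _ = (α_ x.Θ x.Θ f).hom ≫ (x.unit.hom ▷ (x.Θ ≫ f) ≫ (λ_ _).hom ≫
          (x.unit.hom ▷ f ≫ (λ_ f).hom ≫ (ρ_ f).inv ≫ f ◁ y.unit.inv)) := by simp
      _ = _ := by
        rw [← h₀]
        simp
  m_unit := by simp

theorem cond {a b : D} {x : FixedPoint A a} {y : FixedPoint A b} {f : a ⟶ b}
    (p : FixedPointHom x y f) (n : ℤ) :
    (A.act n).LCond (x.triv.l n) (y.triv.l n) f :=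
  (cond_iff p.m p.m_unit n).1 (p.m_nat n)

theorem two {a b : D} {x : FixedPoint A a} {y : FixedPoint A b} {f g : a ⟶ b}
    (p : FixedPointHom x y f) (q : FixedPointHom x y g) (η : f ⟶ g) :
    p.m.hom ≫ η ▷ y.Θ = x.Θ ◁ η ≫ q.m.hom := by
  rw [← cancel_mono (g ◁ y.unit.hom ≫ (ρ_ g).hom)]
  have h := p.m_unit
  have h' := q.m_unit
  rw [Category.assoc, Category.assoc]
  rw [h', ← whisker_exchange_assoc, FixedPoint.unit_naturality x.unit η, rightUnitor_naturality,
    reassoc_of% h]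

instance {a b : D} (x : FixedPoint A a) (y : FixedPoint A b) (f : a ⟶ b) :
    Subsingleton (FixedPointHom x y f) where
  allEq p q := by
    ext
    simpa using p.two q (𝟙 f)

end FixedPointHom

section

variable {D : Type u} [Bicategory.{w, v} D] [MonoidalBicategory D] (A : CircleAction D)

/-- Homotopy fixed points as additional structure on objects and 1-morphisms. -/
def fixedDisplayed : Displayed D where
  Ob := FixedPoint A
  Hm := FixedPointHom
  Two {_ _ x y _ _} p q η := p.m.hom ≫ η ▷ y.Θ = x.Θ ◁ η ≫ q.m.hom
  idH x := FixedPointHom.ofCond x x fun n => (A.act n).lCond_id _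
  compH p q := FixedPointHom.ofCond _ _ fun n => (p.cond n).comp _ (q.cond n)
  invH _ p := FixedPointHom.ofCond _ _ fun n => (p.cond n).inv _
  two_iso p q e := p.two q e.hom
  two_comp _ _ := FixedPointHom.two _ _ _
  two_whiskerLeft _ _ _ _ _ _ _ := FixedPointHom.two _ _ _
  two_whiskerRight _ _ _ := FixedPointHom.two _ _ _

/-- The bicategory of homotopy fixed points. -/
abbrev HomotopyFixedPoints := (fixedDisplayed A).Total

end

namespace TensorBicategory

variable {C : Type u} [Bicategory.{w, v} C] [TensorBicategory C]

theorem tComp_whiskerRight {X X' X'' Y Y' Y'' : C} {f f' : X ⟶ X'} {g g' : Y ⟶ Y'} (η : f ⟶ f')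
    (θ : g ⟶ g') (h : X' ⟶ X'') (k : Y' ⟶ Y'') :
    (tComp f h g k).hom ≫ (η ⊠₂ θ) ▷ (h ⊠₁ k) =
      ((η ▷ h) ⊠₂ (θ ▷ k)) ≫ (tComp f' h g' k).hom := by
  have H : (η ▷ h) ⊠₂ (θ ▷ k) = (tComp f h g k).hom ≫ (η ⊠₂ θ) ▷ (h ⊠₁ k) ≫
      (tComp f' h g' k).inv :=
    (tensor (C := C)).map₂_whisker_right (a := (X, Y)) (b := (X', Y')) (c := (X'', Y''))
      (f := (f, g)) (g := (f', g')) (η, θ) (h, k)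
  rw [H]
  simp

theorem tComp_whiskerLeft {X X' X'' Y Y' Y'' : C} (h : X ⟶ X') (k : Y ⟶ Y') {f f' : X' ⟶ X''}
    {g g' : Y' ⟶ Y''} (η : f ⟶ f') (θ : g ⟶ g') :
    (tComp h f k g).inv ≫ ((h ◁ η) ⊠₂ (k ◁ θ)) =
      (h ⊠₁ k) ◁ (η ⊠₂ θ) ≫ (tComp h f' k g').inv := by
  have H : (h ◁ η) ⊠₂ (k ◁ θ) = (tComp h f k g).hom ≫ (h ⊠₁ k) ◁ (η ⊠₂ θ) ≫
      (tComp h f' k g').inv :=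
    (tensor (C := C)).map₂_whisker_left (a := (X, Y)) (b := (X', Y')) (c := (X'', Y'')) (h, k)
      (g := (f, g)) (h := (f', g')) (η, θ)
  rw [H]
  simp

theorem tComp_leftUnitor {X X' Y Y' : C} (f : X ⟶ X') (g : Y ⟶ Y') :
    (tComp (𝟙 X) f (𝟙 Y) g).hom ≫ (tId X Y).hom ▷ (f ⊠₁ g) ≫ (λ_ (f ⊠₁ g)).hom =
      (λ_ f).hom ⊠₂ (λ_ g).hom :=
  ((tensor (C := C)).map₂_left_unitor (a := (X, Y)) (b := (X', Y')) (f, g)).symm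

theorem tComp_rightUnitor {X X' Y Y' : C} (f : X ⟶ X') (g : Y ⟶ Y') :
    (f ⊠₁ g) ◁ (tId X' Y').hom ≫ (ρ_ (f ⊠₁ g)).hom =
      (tComp f (𝟙 X') g (𝟙 Y')).inv ≫ ((ρ_ f).hom ⊠₂ (ρ_ g).hom) := by
  have H : (ρ_ f).hom ⊠₂ (ρ_ g).hom = (tComp f (𝟙 X') g (𝟙 Y')).hom ≫
      (f ⊠₁ g) ◁ (tId X' Y').hom ≫ (ρ_ (f ⊠₁ g)).hom :=
    (tensor (C := C)).map₂_right_unitor (a := (X, Y)) (b := (X', Y')) (f, g)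
  rw [H]
  simp

end TensorBicategory

namespace MonoidalIdTrans

variable {D : Type u} [Bicategory.{w, v} D] [MonoidalBicategory D] (S : MonoidalIdTrans D)

/-- The tensor product of trivializations of components of the transformation. -/
def tTriv {a b : D} (l : S.s a ≅ 𝟙 a) (l' : S.s b ≅ 𝟙 b) : S.s (a ⊠ b) ≅ 𝟙 (a ⊠ b) :=
  S.tc a b ≪≫ tIso l l' ≪≫ tId a b

theorem LCond.tensor {a a' b b' : D} {l : S.s a ≅ 𝟙 a} {l' : S.s a' ≅ 𝟙 a'} {m : S.s b ≅ 𝟙 b}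
    {m' : S.s b' ≅ 𝟙 b'} {f : a ⟶ a'} {g : b ⟶ b'} (h : S.LCond l l' f) (h' : S.LCond m m' g) :
    S.LCond (S.tTriv l m) (S.tTriv l' m') (f ⊠₁ g) := by
  have hN : (𝟙 (f ⊠₁ g) ▷ S.s (a' ⊠ b') ≫ (f ⊠₁ g) ◁ (S.tc a' b').hom) ≫
      (tComp _ _ _ _).inv ≫ ((S.sn f).hom ⊠₂ (S.sn g).hom) ≫ (tComp _ _ _ _).hom =
      (S.sn (f ⊠₁ g)).hom ≫ S.s (a ⊠ b) ◁ 𝟙 (f ⊠₁ g) ≫ (S.tc a b).hom ▷ (f ⊠₁ g) :=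
    S.tensorCell_naturality f g
  simp only [id_whiskerRight, whiskerLeft_id, Category.id_comp] at hN
  unfold LCond lHom at *
  calc
    _ = (S.sn (f ⊠₁ g)).hom ≫ (S.tc a b).hom ▷ (f ⊠₁ g) ≫
        (l.hom ⊠₂ m.hom) ▷ (f ⊠₁ g) ≫ (tId a b).hom ▷ (f ⊠₁ g) ≫ (λ_ _).hom := by
      simp [tTriv]
    _ = (f ⊠₁ g) ◁ (S.tc a' b').hom ≫ (tComp _ _ _ _).inv ≫
        (((S.sn f).hom ≫ l.hom ▷ f ≫ (λ_ f).hom) ⊠₂ ((S.sn g).hom ≫ m.hom ▷ g ≫ (λ_ g).hom)) := by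
      rw [← reassoc_of% hN, reassoc_of% (tComp_whiskerRight l.hom m.hom f g), tComp_leftUnitor,
        tHom₂_comp, tHom₂_comp]
    _ = _ := by
      rw [h, h', tHom₂_comp, reassoc_of% (tComp_whiskerLeft f g l'.hom m'.hom),
        ← tComp_rightUnitor]
      simp [tTriv]

theorem lCond_assoc {a b c : D} (l : S.s a ≅ 𝟙 a) (m : S.s b ≅ 𝟙 b) (n : S.s c ≅ 𝟙 c) :
    S.LCond (S.tTriv (S.tTriv l m) n) (S.tTriv l (S.tTriv m n)) (as a b c) := by
  have h₁ : (S.sn (as a b c)).hom ≫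
      ((S.tc (a ⊠ b) c).hom ≫ (S.tc a b).hom ⊠₂ 𝟙 (S.s c)) ▷ as a b c ≫
        (assocNat (S.s a) (S.s b) (S.s c)).hom =
    as a b c ◁ ((S.tc a (b ⊠ c)).hom ≫ 𝟙 (S.s a) ⊠₂ (S.tc b c).hom) :=
    S.tensorCell_assoc a b c
  have h₂ : (((l.hom ⊠₂ m.hom) ⊠₂ n.hom) ▷ as a b c ≫ ((𝟙 a ⊠₁ 𝟙 b) ⊠₁ 𝟙 c) ◁ 𝟙 (as a b c)) ≫
      (assocNat (𝟙 a) (𝟙 b) (𝟙 c)).hom = (assocNat (S.s a) (S.s b) (S.s c)).hom ≫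
      as a b c ◁ (l.hom ⊠₂ (m.hom ⊠₂ n.hom)) ≫ 𝟙 (as a b c) ▷ (𝟙 a ⊠₁ (𝟙 b ⊠₁ 𝟙 c)) :=
    MonoidalBicategory.assoc_naturality l.hom m.hom n.hom
  have h₃ : (((tId a b).hom ⊠₂ 𝟙 (𝟙 c) ≫ (tId (a ⊠ b) c).hom) ▷ as a b c ≫
      𝟙 _ ◁ 𝟙 (as a b c)) ≫ (λ_ (as a b c)).hom ≫ (ρ_ (as a b c)).inv =
      (assocNat (𝟙 a) (𝟙 b) (𝟙 c)).hom ≫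
      as a b c ◁ (𝟙 (𝟙 a) ⊠₂ (tId b c).hom ≫ (tId a (b ⊠ c)).hom) ≫ 𝟙 (as a b c) ▷ 𝟙 _ :=
    MonoidalBicategory.assoc_id a b c
  simp only [whiskerLeft_id, id_whiskerRight, Category.comp_id] at h₂ h₃
  rw [← Category.assoc, Iso.comp_inv_eq] at h₃
  have e₁ : (S.tTriv (S.tTriv l m) n).hom = ((S.tc (a ⊠ b) c).hom ≫
      (S.tc a b).hom ⊠₂ 𝟙 (S.s c)) ≫ ((l.hom ⊠₂ m.hom) ⊠₂ n.hom) ≫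
      ((tId a b).hom ⊠₂ 𝟙 (𝟙 c) ≫ (tId (a ⊠ b) c).hom) := by
    simp only [tTriv, Iso.trans_hom, tIso_hom, Category.assoc]
    rw [← reassoc_of% tHom₂_comp, ← reassoc_of% tHom₂_comp]
    simp
  have e₂ : (S.tTriv l (S.tTriv m n)).hom = ((S.tc a (b ⊠ c)).hom ≫
      𝟙 (S.s a) ⊠₂ (S.tc b c).hom) ≫ (l.hom ⊠₂ (m.hom ⊠₂ n.hom)) ≫
      (𝟙 (𝟙 a) ⊠₂ (tId b c).hom ≫ (tId a (b ⊠ c)).hom) := by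
    simp only [tTriv, Iso.trans_hom, tIso_hom, Category.assoc]
    rw [← reassoc_of% tHom₂_comp, ← reassoc_of% tHom₂_comp]
    simp
  rw [LCond, lHom, e₁, e₂]
  generalize (S.tc (a ⊠ b) c).hom ≫ (S.tc a b).hom ⊠₂ 𝟙 (S.s c) = A at *
  generalize (S.tc a (b ⊠ c)).hom ≫ 𝟙 (S.s a) ⊠₂ (S.tc b c).hom = B at *
  generalize (l.hom ⊠₂ m.hom) ⊠₂ n.hom = A' at *
  generalize l.hom ⊠₂ (m.hom ⊠₂ n.hom) = B' at *
  generalize (tId a b).hom ⊠₂ 𝟙 (𝟙 c) ≫ (tId (a ⊠ b) c).hom = A'' at *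
  generalize 𝟙 (𝟙 a) ⊠₂ (tId b c).hom ≫ (tId a (b ⊠ c)).hom = B'' at *
  simp only [comp_whiskerRight, Bicategory.whiskerLeft_comp, Category.assoc] at h₃ ⊢
  rw [← h₁]
  simp only [Category.assoc]
  rw [← reassoc_of% h₂, h₃]

theorem lCond_lUnit {a : D} (l : S.s a ≅ 𝟙 a) :
    S.LCond (S.tTriv S.uc l) l (lUnit a).hom := by
  have h₁ : (S.sn (lUnit a).hom).hom ≫
      ((S.tc one a).hom ≫ S.uc.hom ⊠₂ 𝟙 (S.s a)) ▷ (lUnit a).hom ≫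
        (lUnitNat (S.s a)).hom = 𝟙 _ := S.tensorCell_lUnit a
  have h₂ : ((𝟙 (𝟙 one) ⊠₂ l.hom) ▷ (lUnit a).hom ≫ (𝟙 one ⊠₁ 𝟙 a) ◁ 𝟙 (lUnit a).hom) ≫
      (lUnitNat (𝟙 a)).hom = (lUnitNat (S.s a)).hom ≫
      (lUnit a).hom ◁ l.hom ≫ 𝟙 (lUnit a).hom ▷ 𝟙 a :=
    MonoidalBicategory.lUnit_naturality l.hom
  have h₃ : ((tId one a).hom ▷ (lUnit a).hom ≫ 𝟙 _ ◁ 𝟙 (lUnit a).hom) ≫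
      (λ_ (lUnit a).hom).hom ≫ (ρ_ (lUnit a).hom).inv =
      (lUnitNat (𝟙 a)).hom ≫ (lUnit a).hom ◁ 𝟙 _ ≫ 𝟙 (lUnit a).hom ▷ 𝟙 _ :=
    MonoidalBicategory.lUnit_id a
  simp only [whiskerLeft_id, id_whiskerRight, Category.comp_id] at h₂ h₃
  rw [← Category.assoc, Iso.comp_inv_eq] at h₃
  have e₁ : (S.tTriv S.uc l).hom = ((S.tc one a).hom ≫
      S.uc.hom ⊠₂ 𝟙 (S.s a)) ≫ (𝟙 (𝟙 one) ⊠₂ l.hom) ≫ (tId one a).hom := by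
    simp only [tTriv, Iso.trans_hom, tIso_hom, Category.assoc]
    rw [← reassoc_of% tHom₂_comp]
    simp
  rw [LCond, lHom, e₁]
  generalize (S.tc one a).hom ≫ S.uc.hom ⊠₂ 𝟙 (S.s a) = A at *
  simp only [comp_whiskerRight, Category.assoc]
  rw [h₃, reassoc_of% h₂, reassoc_of% h₁]

theorem lCond_rUnit {a : D} (l : S.s a ≅ 𝟙 a) :
    S.LCond (S.tTriv l S.uc) l (rUnit a).hom := by
  have h₁ : (S.sn (rUnit a).hom).hom ≫
      ((S.tc a one).hom ≫ 𝟙 (S.s a) ⊠₂ S.uc.hom) ▷ (rUnit a).hom ≫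
        (rUnitNat (S.s a)).hom = 𝟙 _ := S.tensorCell_rUnit a
  have h₂ : ((l.hom ⊠₂ 𝟙 (𝟙 one)) ▷ (rUnit a).hom ≫ (𝟙 a ⊠₁ 𝟙 one) ◁ 𝟙 (rUnit a).hom) ≫
      (rUnitNat (𝟙 a)).hom = (rUnitNat (S.s a)).hom ≫
      (rUnit a).hom ◁ l.hom ≫ 𝟙 (rUnit a).hom ▷ 𝟙 a :=
    MonoidalBicategory.rUnit_naturality l.hom
  have h₃ : ((tId a one).hom ▷ (rUnit a).hom ≫ 𝟙 _ ◁ 𝟙 (rUnit a).hom) ≫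
      (λ_ (rUnit a).hom).hom ≫ (ρ_ (rUnit a).hom).inv =
      (rUnitNat (𝟙 a)).hom ≫ (rUnit a).hom ◁ 𝟙 _ ≫ 𝟙 (rUnit a).hom ▷ 𝟙 _ :=
    MonoidalBicategory.rUnit_id a
  simp only [whiskerLeft_id, id_whiskerRight, Category.comp_id] at h₂ h₃
  rw [← Category.assoc, Iso.comp_inv_eq] at h₃
  have e₁ : (S.tTriv l S.uc).hom = ((S.tc a one).hom ≫
      𝟙 (S.s a) ⊠₂ S.uc.hom) ≫ (l.hom ⊠₂ 𝟙 (𝟙 one)) ≫ (tId a one).hom := by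
    simp only [tTriv, Iso.trans_hom, tIso_hom, Category.assoc]
    rw [← reassoc_of% tHom₂_comp]
    simp
  rw [LCond, lHom, e₁]
  generalize (S.tc a one).hom ≫ 𝟙 (S.s a) ⊠₂ S.uc.hom = A at *
  simp only [comp_whiskerRight, Category.assoc]
  rw [h₃, reassoc_of% h₂, reassoc_of% h₁]

end MonoidalIdTrans

namespace CircleAction

variable {D : Type u} [Bicategory.{w, v} D] [MonoidalBicategory D] {A : CircleAction D}

/-- The tensor product of trivializations. -/
@[simps]
def Triv.tensor {a b : D} (t : A.Triv a) (t' : A.Triv b) : A.Triv (a ⊠ b) where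
  l n := (A.act n).tTriv (t.l n) (t'.l n)
  l_zero := by
    simp only [MonoidalIdTrans.tTriv, Iso.trans_hom, tIso_hom, t.l_zero, t'.l_zero]
    exact A.zero_tensor a b
  l_add {m n k} h := by
    have hA := A.add_tensor h a b
    calc
      _ = ((A.act k).tc a b).hom ≫ ((A.add h a).hom ⊠₂ (A.add h b).hom) ≫
          (((t.l m).hom ▷ (A.act n).s a) ⊠₂ ((t'.l m).hom ▷ (A.act n).s b)) ≫
          ((λ_ ((A.act n).s a)).hom ⊠₂ (λ_ ((A.act n).s b)).hom) ≫
          ((t.l n).hom ⊠₂ (t'.l n).hom) ≫ (tId a b).hom := by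
        simp only [MonoidalIdTrans.tTriv, Iso.trans_hom, tIso_hom, t.l_add h, t'.l_add h,
          tHom₂_comp, Category.assoc]
      _ = (((A.act k).tc a b).hom ≫ ((A.add h a).hom ⊠₂ (A.add h b).hom) ≫
          (tComp _ _ _ _).hom) ≫ ((t.l m).hom ⊠₂ (t'.l m).hom) ▷ _ ≫
          (tId a b).hom ▷ _ ≫ (λ_ _).hom ≫
          ((t.l n).hom ⊠₂ (t'.l n).hom) ≫ (tId a b).hom := by
        rw [← tComp_leftUnitor]
        simp only [Category.assoc]
        rw [← reassoc_of% (tComp_whiskerRight (t.l m).hom (t'.l m).hom ((A.act n).s a)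
          ((A.act n).s b))]
      _ = (A.add h (a ⊠ b)).hom ≫ ((A.act m).tc a b).hom ▷ (A.act n).s (a ⊠ b) ≫
          (((A.act m).s a ⊠₁ (A.act m).s b) ◁ ((A.act n).tc a b).hom ≫
          (((t.l m).hom ⊠₂ (t'.l m).hom) ≫ (tId a b).hom) ▷ _) ≫ (λ_ _).hom ≫
          ((t.l n).hom ⊠₂ (t'.l n).hom) ≫ (tId a b).hom := by
        rw [hA]
        simp
      _ = _ := by
        rw [whisker_exchange]
        simp [MonoidalIdTrans.tTriv]

variable (A) in
/-- The trivialization at the unit object. -/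
@[simps]
def Triv.one : A.Triv (one : D) where
  l n := (A.act n).uc
  l_zero := A.zero_one
  l_add h := A.add_one h

variable (A)

/-- The tensor product of homotopy fixed points: it is given by the tensor products of the
1-morphisms `Θ`, of the 2-morphisms `M`, and of the trivializations. The remaining structure is
uniquely determined. -/
def fixedMonoidal : (fixedDisplayed A).Monoidal where
  obT {a b} (x : FixedPoint A a) (y : FixedPoint A b) :=
    FixedPoint.ofTriv (x.Θ ⊠₁ y.Θ) (tIso x.unit y.unit ≪≫ tId a b) (x.triv.tensor y.triv)
  obOne := FixedPoint.ofTriv (𝟙 one) (Iso.refl _) (Triv.one A)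
  hmT p q := FixedPointHom.ofCond _ _ fun n => by
    rw [FixedPoint.triv_ofTriv, FixedPoint.triv_ofTriv]
    exact (FixedPointHom.cond p n).tensor _ (FixedPointHom.cond q n)
  two_tensor _ _ := FixedPointHom.two _ _ _
  hmAssoc x y z := FixedPointHom.ofCond _ _ fun n => by
    simp only [FixedPoint.triv_ofTriv]
    exact (A.act n).lCond_assoc _ _ _
  hmLUnit x := FixedPointHom.ofCond _ _ fun n => by
    rw [FixedPoint.triv_ofTriv, FixedPoint.triv_ofTriv]
    exact (A.act n).lCond_lUnit _
  hmRUnit x := FixedPointHom.ofCond _ _ fun n => by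
    rw [FixedPoint.triv_ofTriv, FixedPoint.triv_ofTriv]
    exact (A.act n).lCond_rUnit _

instance : MonoidalBicategory (HomotopyFixedPoints A) := (fixedMonoidal A).monoidalBicategory

end CircleAction

/-! ### Equivalences of monoidal bicategories -/

/-- A biequivalence: a pseudofunctor that is surjective on objects up to equivalence, locally
essentially surjective, and bijective on 2-morphisms. -/
structure IsBiequivalence {D : Type u} [Bicategory.{w, v} D] {E : Type u'} [Bicategory.{w', v'} E]
    (F : D ⥤ᵖ E) : Prop where
  obj_surj (Y : E) : ∃ X : D, Nonempty (F.obj X ≌ Y)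
  map_surj {X X' : D} (g : F.obj X ⟶ F.obj X') : ∃ f : X ⟶ X', Nonempty (F.map f ≅ g)
  map₂_bij {X X' : D} (f g : X ⟶ X') :
    Function.Bijective (fun η : f ⟶ g => (F.map₂ η : F.map f ⟶ F.map g))

/-- The image of a square under a pseudofunctor. -/
def Sq.map {D : Type u} [Bicategory.{w, v} D] {E : Type u'} [Bicategory.{w', v'} E] (F : D ⥤ᵖ E)
    {a a' b b' : D} {f : a ⟶ a'} {p : a ⟶ b} {p' : a' ⟶ b'} {g : b ⟶ b'} (s : Sq f p p' g) :
    Sq (F.map f) (F.map p) (F.map p') (F.map g) :=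
  (F.mapComp f p').symm ≪≫ F.map₂Iso s ≪≫ F.mapComp p g

/-- The data of a monoidal pseudofunctor. -/
structure MonoidalPseudofunctorData (D : Type u) [Bicategory.{w, v} D] [MonoidalBicategory D]
    (E : Type u') [Bicategory.{w', v'} E] [MonoidalBicategory E] where
  /-- The underlying pseudofunctor. -/
  F : D ⥤ᵖ E
  /-- The compatibility with tensor products. -/
  χ (X Y : D) : F.obj X ⊠ F.obj Y ≌ F.obj (X ⊠ Y)
  /-- The pseudonaturality squares of `χ`. -/
  χNat {X X' Y Y' : D} (f : X ⟶ X') (g : Y ⟶ Y') :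
    Sq (F.map f ⊠₁ F.map g) (χ X Y).hom (χ X' Y').hom (F.map (f ⊠₁ g))
  /-- The compatibility with the unit. -/
  ι : (one : E) ≌ F.obj one
  /-- The compatibility with the associativity. -/
  ω (X Y Z : D) : wr (χ X Y).hom (F.obj Z) ≫ (χ (X ⊠ Y) Z).hom ≫ F.map (as X Y Z) ≅
    as (F.obj X) (F.obj Y) (F.obj Z) ≫ wl (F.obj X) (χ Y Z).hom ≫ (χ X (Y ⊠ Z)).hom
  /-- The compatibility with the left unit. -/
  γ (X : D) : wr ι.hom (F.obj X) ≫ (χ one X).hom ≫ F.map (lUnit X).hom ≅ (lUnit (F.obj X)).hom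
  /-- The compatibility with the right unit. -/
  δ (X : D) : wl (F.obj X) ι.hom ≫ (χ X one).hom ≫ F.map (rUnit X).hom ≅ (rUnit (F.obj X)).hom

namespace MonoidalPseudofunctorData

variable {D : Type u} [Bicategory.{w, v} D] [MonoidalBicategory D] {E : Type u'}
  [Bicategory.{w', v'} E] [MonoidalBicategory E] (T : MonoidalPseudofunctorData D E)

/-- Naturality of `χ` in the first variable. -/
def χNat₁ {X X' : D} (f : X ⟶ X') (Y : D) : Sq (wr (T.F.map f) (T.F.obj Y)) (T.χ X Y).hom
    (T.χ X' Y).hom (T.F.map (wr f Y)) :=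
  whiskerRightIso (tIso (Iso.refl _) (T.F.mapId Y).symm) _ ≪≫ T.χNat f (𝟙 Y)

/-- Naturality of `χ` in the second variable. -/
def χNat₂ (X : D) {Y Y' : D} (f : Y ⟶ Y') : Sq (wl (T.F.obj X) (T.F.map f)) (T.χ X Y).hom
    (T.χ X Y').hom (T.F.map (wl X f)) :=
  whiskerRightIso (tIso (T.F.mapId X).symm (Iso.refl _)) _ ≪≫ T.χNat (𝟙 X) f

/-- The naturality square of `ι` at the identity of the unit. -/
def ιNat : Sq (𝟙 (one : E)) T.ι.hom T.ι.hom (T.F.map (𝟙 one)) :=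
  Sq.idTop _ ≪≫ whiskerLeftIso _ (T.F.mapId one).symm

end MonoidalPseudofunctorData

/-- A monoidal pseudofunctor. -/
structure MonoidalPseudofunctor (D : Type u) [Bicategory.{w, v} D] [MonoidalBicategory D]
    (E : Type u') [Bicategory.{w', v'} E] [MonoidalBicategory E] extends
    MonoidalPseudofunctorData D E where
  -- pseudonaturality of `χ`
  χ_naturality {X X' Y Y' : D} {f f' : X ⟶ X'} {g g' : Y ⟶ Y'} (η : f ⟶ f') (θ : g ⟶ g') :
    Sq.Cube (χNat f g) (χNat f' g') (F.map₂ η ⊠₂ F.map₂ θ) (𝟙 _) (𝟙 _) (F.map₂ (η ⊠₂ θ))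
  χ_id (X Y : D) : Sq.Cube (χNat (𝟙 X) (𝟙 Y)) (Sq.idTop (χ X Y).hom)
    ((F.mapId X).hom ⊠₂ (F.mapId Y).hom ≫ (tId _ _).hom) (𝟙 _) (𝟙 _)
    (F.map₂ (tId X Y).hom ≫ (F.mapId _).hom)
  χ_comp {X X' X'' Y Y' Y'' : D} (f : X ⟶ X') (f' : X' ⟶ X'') (g : Y ⟶ Y') (g' : Y' ⟶ Y'') :
    Sq.Cube (χNat (f ≫ f') (g ≫ g')) (Sq.vcomp (χNat f g) (χNat f' g'))
      ((F.mapComp f f').hom ⊠₂ (F.mapComp g g').hom ≫ (tComp _ _ _ _).hom) (𝟙 _) (𝟙 _)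
      (F.map₂ (tComp f f' g g').hom ≫ (F.mapComp _ _).hom)
  -- `ω`, `γ` and `δ` are modifications
  ω_naturality {X X' Y Y' Z Z' : D} (f : X ⟶ X') (g : Y ⟶ Y') (h : Z ⟶ Z') :
    Sq.Cube
      (Sq.hcomp (sqR (χNat f g) (F.map h)) (Sq.hcomp (χNat (f ⊠₁ g) h) (Sq.map F (assocNat f g h))))
      (Sq.hcomp (assocNat (F.map f) (F.map g) (F.map h))
        (Sq.hcomp (sqL (F.map f) (χNat g h)) (χNat f (g ⊠₁ h))))
      (𝟙 _) (ω X Y Z).hom (ω X' Y' Z').hom (𝟙 _)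
  γ_naturality {X X' : D} (f : X ⟶ X') :
    Sq.Cube
      (Sq.hcomp (sqR (toMonoidalPseudofunctorData.ιNat) (F.map f))
        (Sq.hcomp (χNat (𝟙 one) f) (Sq.map F (lUnitNat f))))
      (lUnitNat (F.map f)) (𝟙 _) (γ X).hom (γ X').hom (𝟙 _)
  δ_naturality {X X' : D} (f : X ⟶ X') :
    Sq.Cube
      (Sq.hcomp (sqL (F.map f) (toMonoidalPseudofunctorData.ιNat))
        (Sq.hcomp (χNat f (𝟙 one)) (Sq.map F (rUnitNat f))))
      (rUnitNat (F.map f)) (𝟙 _) (δ X).hom (δ X').hom (𝟙 _)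
  /-- The compatibility of `ω` with the pentagonators. -/
  ω_pent (X Y Z W : D) :
    𝟙 (wr (wr (χ X Y).hom (F.obj Z)) (F.obj W) ≫ wr (χ (X ⊠ Y) Z).hom (F.obj W) ≫
        (χ ((X ⊠ Y) ⊠ Z) W).hom ≫ F.map (as (X ⊠ Y) Z W) ≫ F.map (as X Y (Z ⊠ W))) ⊗≫
      wr (wr (χ X Y).hom (F.obj Z)) (F.obj W) ◁
        ((ω (X ⊠ Y) Z W).hom ▷ F.map (as X Y (Z ⊠ W))) ⊗≫
      (asNat₁ (χ X Y).hom (F.obj Z) (F.obj W)).hom ▷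
        (wl (F.obj (X ⊠ Y)) (χ Z W).hom ≫ (χ (X ⊠ Y) (Z ⊠ W)).hom ≫
          F.map (as X Y (Z ⊠ W))) ⊗≫
      as (F.obj X ⊠ F.obj Y) (F.obj Z) (F.obj W) ◁
        ((interchange (χ X Y).hom (χ Z W).hom).hom ▷ ((χ (X ⊠ Y) (Z ⊠ W)).hom ≫
          F.map (as X Y (Z ⊠ W)))) ⊗≫
      as (F.obj X ⊠ F.obj Y) (F.obj Z) (F.obj W) ◁ wl (F.obj X ⊠ F.obj Y) (χ Z W).hom ◁
        (ω X Y (Z ⊠ W)).hom ⊗≫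
      as (F.obj X ⊠ F.obj Y) (F.obj Z) (F.obj W) ◁
        ((asNat₃ (F.obj X) (F.obj Y) (χ Z W).hom).hom ▷
          (wl (F.obj X) (χ Y (Z ⊠ W)).hom ≫ (χ X (Y ⊠ (Z ⊠ W))).hom)) ⊗≫
      (pent (F.obj X) (F.obj Y) (F.obj Z) (F.obj W)).hom ▷
        (wl (F.obj X) (wl (F.obj Y) (χ Z W).hom) ≫ wl (F.obj X) (χ Y (Z ⊠ W)).hom ≫
          (χ X (Y ⊠ (Z ⊠ W))).hom) ⊗≫
      𝟙 (wr (as (F.obj X) (F.obj Y) (F.obj Z)) (F.obj W) ≫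
        as (F.obj X) (F.obj Y ⊠ F.obj Z) (F.obj W) ≫
        wl (F.obj X) (as (F.obj Y) (F.obj Z) (F.obj W)) ≫
        wl (F.obj X) (wl (F.obj Y) (χ Z W).hom) ≫ wl (F.obj X) (χ Y (Z ⊠ W)).hom ≫
          (χ X (Y ⊠ (Z ⊠ W))).hom) =
    𝟙 (wr (wr (χ X Y).hom (F.obj Z)) (F.obj W) ≫ wr (χ (X ⊠ Y) Z).hom (F.obj W) ≫
        (χ ((X ⊠ Y) ⊠ Z) W).hom ≫ F.map (as (X ⊠ Y) Z W) ≫ F.map (as X Y (Z ⊠ W))) ⊗≫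
      wr (wr (χ X Y).hom (F.obj Z)) (F.obj W) ◁ wr (χ (X ⊠ Y) Z).hom (F.obj W) ◁
        (χ ((X ⊠ Y) ⊠ Z) W).hom ◁ ((F.mapComp _ _).inv ≫ F.map₂ (pent X Y Z W).hom ≫
          (F.mapComp _ _).hom ≫ F.map (wr (as X Y Z) W) ◁ (F.mapComp _ _).hom) ⊗≫
      wr (wr (χ X Y).hom (F.obj Z)) (F.obj W) ◁ wr (χ (X ⊠ Y) Z).hom (F.obj W) ◁
        ((toMonoidalPseudofunctorData.χNat₁ (as X Y Z) W).inv ▷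
          (F.map (as X (Y ⊠ Z) W) ≫ F.map (wl X (as Y Z W)))) ⊗≫
      ((wrComp₃ _ _ _ (F.obj W)).inv ≫ (wrIso (ω X Y Z) (F.obj W)).hom ≫
        (wrComp₃ _ _ _ (F.obj W)).hom) ▷
          ((χ (X ⊠ (Y ⊠ Z)) W).hom ≫ F.map (as X (Y ⊠ Z) W) ≫ F.map (wl X (as Y Z W))) ⊗≫
      wr (as (F.obj X) (F.obj Y) (F.obj Z)) (F.obj W) ◁
        wr (wl (F.obj X) (χ Y Z).hom) (F.obj W) ◁
          ((ω X (Y ⊠ Z) W).hom ▷ F.map (wl X (as Y Z W))) ⊗≫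
      wr (as (F.obj X) (F.obj Y) (F.obj Z)) (F.obj W) ◁
        wr (wl (F.obj X) (χ Y Z).hom) (F.obj W) ◁ as (F.obj X) (F.obj (Y ⊠ Z)) (F.obj W) ◁
          wl (F.obj X) (χ (Y ⊠ Z) W).hom ◁
            (toMonoidalPseudofunctorData.χNat₂ X (as Y Z W)).inv ⊗≫
      wr (as (F.obj X) (F.obj Y) (F.obj Z)) (F.obj W) ◁
        ((asNat₂ (F.obj X) (χ Y Z).hom (F.obj W)).hom ▷
          (wl (F.obj X) (χ (Y ⊠ Z) W).hom ≫ wl (F.obj X) (F.map (as Y Z W)) ≫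
            (χ X (Y ⊠ (Z ⊠ W))).hom)) ⊗≫
      wr (as (F.obj X) (F.obj Y) (F.obj Z)) (F.obj W) ◁
        as (F.obj X) (F.obj Y ⊠ F.obj Z) (F.obj W) ◁
          (((wlComp₃ (F.obj X) _ _ _).inv ≫ (wlIso (F.obj X) (ω Y Z W)).hom ≫
            (wlComp₃ (F.obj X) _ _ _).hom) ▷ (χ X (Y ⊠ (Z ⊠ W))).hom) ⊗≫
      𝟙 (wr (as (F.obj X) (F.obj Y) (F.obj Z)) (F.obj W) ≫
        as (F.obj X) (F.obj Y ⊠ F.obj Z) (F.obj W) ≫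
        wl (F.obj X) (as (F.obj Y) (F.obj Z) (F.obj W)) ≫
        wl (F.obj X) (wl (F.obj Y) (χ Z W).hom) ≫ wl (F.obj X) (χ Y (Z ⊠ W)).hom ≫
          (χ X (Y ⊠ (Z ⊠ W))).hom)
  /-- The compatibility of `ω`, `γ` and `δ` with the middle 2-unitors. -/
  ω_unit (X Y : D) :
    𝟙 (wr (wl (F.obj X) ι.hom) (F.obj Y) ≫ wr (χ X one).hom (F.obj Y) ≫ (χ (X ⊠ one) Y).hom ≫
        F.map (as X one Y) ≫ F.map (wl X (lUnit Y).hom)) ⊗≫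
      wr (wl (F.obj X) ι.hom) (F.obj Y) ◁ wr (χ X one).hom (F.obj Y) ◁ (χ (X ⊠ one) Y).hom ◁
        ((F.mapComp _ _).inv ≫ F.map₂ (midUnitor X Y).hom) ⊗≫
      wr (wl (F.obj X) ι.hom) (F.obj Y) ◁ wr (χ X one).hom (F.obj Y) ◁
        (toMonoidalPseudofunctorData.χNat₁ (rUnit X).hom Y).inv ⊗≫
      ((wrComp₃ _ _ _ (F.obj Y)).inv ≫ (wrIso (δ X) (F.obj Y)).hom) ▷ (χ X Y).hom =
    𝟙 (wr (wl (F.obj X) ι.hom) (F.obj Y) ≫ wr (χ X one).hom (F.obj Y) ≫ (χ (X ⊠ one) Y).hom ≫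
        F.map (as X one Y) ≫ F.map (wl X (lUnit Y).hom)) ⊗≫
      wr (wl (F.obj X) ι.hom) (F.obj Y) ◁ ((ω X one Y).hom ▷ F.map (wl X (lUnit Y).hom)) ⊗≫
      wr (wl (F.obj X) ι.hom) (F.obj Y) ◁ as (F.obj X) (F.obj one) (F.obj Y) ◁
        wl (F.obj X) (χ one Y).hom ◁
          (toMonoidalPseudofunctorData.χNat₂ X (lUnit Y).hom).inv ⊗≫
      (asNat₂ (F.obj X) ι.hom (F.obj Y)).hom ▷ (wl (F.obj X) (χ one Y).hom ≫
        wl (F.obj X) (F.map (lUnit Y).hom) ≫ (χ X Y).hom) ⊗≫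
      as (F.obj X) one (F.obj Y) ◁ (((wlComp₃ (F.obj X) _ _ _).inv ≫
        (wlIso (F.obj X) (γ Y)).hom) ▷ (χ X Y).hom) ⊗≫
      (midUnitor (F.obj X) (F.obj Y)).hom ▷ (χ X Y).hom

/-- An equivalence of monoidal bicategories: a monoidal pseudofunctor whose underlying
pseudofunctor is a biequivalence. -/
structure MonoidalBiequivalence (D : Type u) [Bicategory.{w, v} D] [MonoidalBicategory D]
    (E : Type u') [Bicategory.{w', v'} E] [MonoidalBicategory E] extends
    MonoidalPseudofunctor D E where
  isBiequivalence : IsBiequivalence F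

/-! ### Corresponding 2-morphisms -/

/-! Both sides of the equivalence have the same description: an invertible object of `C` together
with trivializations of the components of the action that are compatible with addition. In a fixed
point, the 2-morphism `M` identifies `Θ` with the identity, so the remaining structure on an object
amounts to a family `CircleAction.Triv`. A fixed point structure on a 1-morphism is then unique, and
exists exactly when the condition `LCond` holds for every integer; the condition on 2-morphisms is
automatic (`FixedPointHom.two`). None of this depends on which core containing the object is used.
Invertible objects are fully dualizable, so they lie in the larger core, and fixed point structures
on them can be restricted to the Picard groupoid and extended back.

What has to be proved is that a homotopy fixed point is invertible as soon as its underlying object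
is (`CircleAction.invertible_homotopyFixedPoint`); the converse follows by forgetting. Let `X` be a
fixed point over an invertible object, with an equivalence from its tensor product with `c` to the
unit. Tensoring with an invertible object is fully faithful on Hom categories
(`Invertible₀.wlFunctor_full_faithful`). Hence the canonical trivialization at the unit, pulled back
along the equivalence, is the tensor product of that of `X` with a unique family at `c`. Uniqueness
forces this family to be compatible with addition, so `c` becomes a fixed point, and the equivalence
lifts to fixed points. A right inverse of this right inverse is equivalent to `X`, which makes the
inverse two-sided.

The comparison pseudofunctor lies over the identity of `C`. Equations of 2-morphisms in the
bicategories of cores and fixed points are equations in `C`, so the monoidal structure and its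
axioms are inherited from the identity monoidal pseudofunctor `idMonoidal`. The axioms of the latter
are not pure bicategorical coherence, because the tensor product of identity 1-morphisms is only
isomorphic to an identity. The relation `Corr` replaces every such tensor product by an actual
identity, compatibly on all cells of a pasting diagram, after which coherence in a bicategory
finishes the verification. -/

section Corr

variable {C : Type u} [Bicategory.{w, v} C]

/-- The horizontal composite of invertible 2-morphisms. -/
def hcIso {a b c : C} {f f' : a ⟶ b} {g g' : b ⟶ c} (e : f ≅ f') (e' : g ≅ g') :
    f ≫ g ≅ f' ≫ g' :=
  whiskerRightIso e g ≪≫ whiskerLeftIso f' e'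

theorem hcIso_hom {a b c : C} {f f' : a ⟶ b} {g g' : b ⟶ c} (e : f ≅ f') (e' : g ≅ g') :
    (hcIso e e').hom = e.hom ▷ g ≫ f' ◁ e'.hom := rfl

/-- Two 2-morphisms that correspond to each other under isomorphisms of their sources and
targets. -/
def Corr {a b : C} {f f' g g' : a ⟶ b} (e : f ≅ f') (e' : g ≅ g') (θ : f ⟶ g) (θ' : f' ⟶ g') :
    Prop :=
  θ ≫ e'.hom = e.hom ≫ θ'

namespace Corr

/-- The reduction principle: if both sides of an equation are transported along the same boundary
isomorphisms, it suffices to compare the transported 2-morphisms. -/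
theorem eq {a b : C} {f f' g g' : a ⟶ b} {e : f ≅ f'} {e' : g ≅ g'} {θ κ : f ⟶ g}
    {θ' κ' : f' ⟶ g'} (h : Corr e e' θ θ') (h' : Corr e e' κ κ') (H : θ' = κ') : θ = κ := by
  rw [← cancel_mono e'.hom, h, h', H]

theorem id {a b : C} {f f' : a ⟶ b} (e : f ≅ f') : Corr e e (𝟙 f) (𝟙 f') := by
  simp [Corr]

theorem refl {a b : C} {f g : a ⟶ b} (θ : f ⟶ g) : Corr (Iso.refl f) (Iso.refl g) θ θ := by
  simp [Corr]

theorem comp {a b : C} {f f' g g' h h' : a ⟶ b} {e : f ≅ f'} {e' : g ≅ g'} {e'' : h ≅ h'}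
    {θ : f ⟶ g} {θ' : f' ⟶ g'} {κ : g ⟶ h} {κ' : g' ⟶ h'} (H : Corr e e' θ θ')
    (K : Corr e' e'' κ κ') : Corr e e'' (θ ≫ κ) (θ' ≫ κ') := by
  unfold Corr at *
  rw [Category.assoc, K, reassoc_of% H]

theorem symm {a b : C} {f f' g g' : a ⟶ b} {e : f ≅ f'} {e' : g ≅ g'} {θ : f ≅ g} {θ' : f' ≅ g'}
    (H : Corr e e' θ.hom θ'.hom) : Corr e' e θ.inv θ'.inv := by
  unfold Corr at *
  rw [Iso.inv_comp_eq, ← Category.assoc, H]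
  simp

/-- An instance of the interchange law. The 1-morphism used for whiskering may be replaced as well,
which allows all factors of a long composite to be simplified at once. -/
theorem whiskerLeft {a b c : C} {p p' : a ⟶ b} {f f' g g' : b ⟶ c} (d : p ≅ p') {e : f ≅ f'}
    {e' : g ≅ g'} {θ : f ⟶ g} {θ' : f' ⟶ g'} (H : Corr e e' θ θ') :
    Corr (hcIso d e) (hcIso d e') (p ◁ θ) (p' ◁ θ') := by
  unfold Corr at *
  rw [hcIso_hom, hcIso_hom, whisker_exchange_assoc, Category.assoc,
    ← Bicategory.whiskerLeft_comp, ← Bicategory.whiskerLeft_comp, H]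

theorem whiskerRight {a b c : C} {p p' : b ⟶ c} {f f' g g' : a ⟶ b} {e : f ≅ f'}
    {e' : g ≅ g'} {θ : f ⟶ g} {θ' : f' ⟶ g'} (H : Corr e e' θ θ') (d : p ≅ p') :
    Corr (hcIso e d) (hcIso e' d) (θ ▷ p) (θ' ▷ p') := by
  unfold Corr at *
  rw [hcIso_hom, hcIso_hom, Category.assoc, whisker_exchange, ← Category.assoc,
    ← Category.assoc, ← comp_whiskerRight, ← comp_whiskerRight, H]

theorem associator_hom {a b c d : C} {f f' : a ⟶ b} {g g' : b ⟶ c} {h h' : c ⟶ d} (e : f ≅ f')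
    (e' : g ≅ g') (e'' : h ≅ h') : Corr (hcIso (hcIso e e') e'') (hcIso e (hcIso e' e''))
      (α_ f g h).hom (α_ f' g' h').hom := by
  simp [Corr, hcIso_hom]

theorem associator_inv {a b c d : C} {f f' : a ⟶ b} {g g' : b ⟶ c} {h h' : c ⟶ d} (e : f ≅ f')
    (e' : g ≅ g') (e'' : h ≅ h') : Corr (hcIso e (hcIso e' e'')) (hcIso (hcIso e e') e'')
      (α_ f g h).inv (α_ f' g' h').inv :=
  symm (associator_hom e e' e'')

end Corr

end Corr

/-! ### Naturality and unit laws of the tensor constraints, in terms of `Corr` -/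

section

variable {C : Type u} [Bicategory.{w, v} C] [MonoidalBicategory C]

namespace TensorBicategory

/-- The two one-sided whiskering laws of the tensor pseudofunctor, applied one after the other in
the order in which `hcIso` composes its factors. -/
theorem tComp_naturality {X X' X'' Y Y' Y'' : C} {f f' : X ⟶ X'} {h h' : X' ⟶ X''}
    {g g' : Y ⟶ Y'} {k k' : Y' ⟶ Y''} (e₁ : f ≅ f') (e₂ : h ≅ h') (e₃ : g ≅ g') (e₄ : k ≅ k') :
    Corr (tIso (hcIso e₁ e₂) (hcIso e₃ e₄)) (hcIso (tIso e₁ e₃) (tIso e₂ e₄))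
      (tComp f h g k).hom (tComp f' h' g' k').hom := by
  have h₂ : (tComp f' h g' k).hom ≫ (f' ⊠₁ g') ◁ (e₂.hom ⊠₂ e₄.hom) =
      ((f' ◁ e₂.hom) ⊠₂ (g' ◁ e₄.hom)) ≫ (tComp f' h' g' k').hom := by
    rw [← Iso.eq_inv_comp, ← Category.assoc, ← Iso.comp_inv_eq]
    exact (tComp_whiskerLeft f' g' e₂.hom e₄.hom).symm
  simp only [Corr, hcIso_hom, tIso_hom]
  rw [reassoc_of% (tComp_whiskerRight e₁.hom e₃.hom h k), h₂, tHom₂_comp, Category.assoc]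

theorem wrComp_naturality {X X' X'' : C} {f f' : X ⟶ X'} {g g' : X' ⟶ X''} (e : f ≅ f')
    (e' : g ≅ g') (Y : C) : Corr (wrIso (hcIso e e') Y) (hcIso (wrIso e Y) (wrIso e' Y))
      (wrComp f g Y).hom (wrComp f' g' Y).hom := by
  refine Corr.comp (e' := tIso (hcIso e e') (hcIso (Iso.refl _) (Iso.refl _))) ?_
    (tComp_naturality _ _ _ _)
  simp [Corr, ← tHom₂_comp, hcIso_hom]

theorem wlComp_naturality {X X' X'' : C} {f f' : X ⟶ X'} {g g' : X' ⟶ X''} (e : f ≅ f')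
    (e' : g ≅ g') (Y : C) : Corr (wlIso Y (hcIso e e')) (hcIso (wlIso Y e) (wlIso Y e'))
      (wlComp Y f g).hom (wlComp Y f' g').hom := by
  refine Corr.comp (e' := tIso (hcIso (Iso.refl _) (Iso.refl _)) (hcIso e e')) ?_
    (tComp_naturality _ _ _ _)
  simp [Corr, ← tHom₂_comp, hcIso_hom]

theorem wrComp₃_naturality {X X' X'' X''' : C} {f f' : X ⟶ X'} {g g' : X' ⟶ X''}
    {h h' : X'' ⟶ X'''} (e : f ≅ f')
    (e' : g ≅ g') (e'' : h ≅ h') (Y : C) : Corr (wrIso (hcIso e (hcIso e' e'')) Y)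
      (hcIso (wrIso e Y) (hcIso (wrIso e' Y) (wrIso e'' Y)))
      (wrComp₃ f g h Y).hom (wrComp₃ f' g' h' Y).hom :=
  (wrComp_naturality _ _ _).comp ((wrComp_naturality _ _ _).whiskerLeft _)

theorem wlComp₃_naturality {X X' X'' X''' : C} {f f' : X ⟶ X'} {g g' : X' ⟶ X''}
    {h h' : X'' ⟶ X'''} (e : f ≅ f')
    (e' : g ≅ g') (e'' : h ≅ h') (Y : C) : Corr (wlIso Y (hcIso e (hcIso e' e'')))
      (hcIso (wlIso Y e) (hcIso (wlIso Y e') (wlIso Y e'')))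
      (wlComp₃ Y f g h).hom (wlComp₃ Y f' g' h').hom :=
  (wlComp_naturality _ _ _).comp ((wlComp_naturality _ _ _).whiskerLeft _)

theorem _root_.Corr.tensor {X X' Y Y' : C} {f f' g g' : X ⟶ X'} {h h' k k' : Y ⟶ Y'} {e : f ≅ f'}
    {e' : g ≅ g'} {d : h ≅ h'} {d' : k ≅ k'} {θ : f ⟶ g} {θ' : f' ⟶ g'} {κ : h ⟶ k}
    {κ' : h' ⟶ k'} (H : Corr e e' θ θ') (K : Corr d d' κ κ') :
    Corr (tIso e d) (tIso e' d') (θ ⊠₂ κ) (θ' ⊠₂ κ') := by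
  simp only [Corr, tIso_hom] at *
  rw [← tHom₂_comp, ← tHom₂_comp, H, K]

/-- The unit law of the tensor pseudofunctor; the unitor that `wrComp` inserts in the slot of `Y`
cancels against the one produced by this law. -/
theorem wrComp_id_left {X X' : C} (f : X ⟶ X') (Y : C) :
    (wrComp (𝟙 X) f Y).hom ≫ (tId X Y).hom ▷ wr f Y ≫ (λ_ (wr f Y)).hom =
      (wrIso (λ_ f) Y).hom := by
  simp only [wrComp, Iso.trans_hom, Category.assoc, tComp_leftUnitor, tIso_hom]
  simp [← tHom₂_comp]

theorem wlComp_id_left {X X' : C} (f : X ⟶ X') (Y : C) :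
    (wlComp Y (𝟙 X) f).hom ≫ (tId Y X).hom ▷ wl Y f ≫ (λ_ (wl Y f)).hom =
      (wlIso Y (λ_ f)).hom := by
  simp only [wlComp, Iso.trans_hom, Category.assoc, tComp_leftUnitor, tIso_hom]
  simp [← tHom₂_comp]

theorem wrComp_id_right {X X' : C} (f : X ⟶ X') (Y : C) :
    (wrComp f (𝟙 X') Y).hom ≫ wr f Y ◁ (tId X' Y).hom ≫ (ρ_ (wr f Y)).hom =
      (wrIso (ρ_ f) Y).hom := by
  simp only [wrComp, Iso.trans_hom, Category.assoc, tComp_rightUnitor, tIso_hom]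
  simp [← tHom₂_comp]

theorem wlComp_id_right {X X' : C} (f : X ⟶ X') (Y : C) :
    (wlComp Y f (𝟙 X')).hom ≫ wl Y f ◁ (tId Y X').hom ≫ (ρ_ (wl Y f)).hom =
      (wlIso Y (ρ_ f)).hom := by
  simp only [wlComp, Iso.trans_hom, Category.assoc, tComp_rightUnitor, tIso_hom]
  simp [← tHom₂_comp]

/-- The left and right unitors of an identity 1-morphism coincide, so the middle 2-morphism of the
interchange is trivial and the two copies of `tComp` cancel. -/
theorem interchange_id (X Y : C) : interchange (𝟙 X) (𝟙 Y) = Iso.refl _ := by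
  ext
  simp [interchange, tHom₂_id, unitors_equal]

/-- The sides of a tensor product of identity squares are tensor products of identities. Both unit
laws of the tensor pseudofunctor are needed, one for each side. -/
theorem sqT_idSide {X X' Y Y' : C} (f : X ⟶ X') (g : Y ⟶ Y') :
    Corr (hcIso (Iso.refl _) (tId X' Y')) (hcIso (tId X Y) (Iso.refl _))
      (sqT (Sq.idSide f) (Sq.idSide g)).hom (Sq.idSide (f ⊠₁ g)).hom := by
  have h₁ := tComp_leftUnitor f g
  have h₂ := tComp_rightUnitor f g
  rw [← Category.assoc, ← Iso.eq_comp_inv] at h₁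
  simp only [Corr, hcIso_hom, sqT, Sq.idSide, Iso.trans_hom, Iso.symm_hom, tIso_hom, tHom₂_comp,
    Category.assoc, Iso.refl_hom, whiskerLeft_id, Category.comp_id, id_whiskerRight,
    Category.id_comp]
  rw [h₁, reassoc_of% h₂, ← reassoc_of% tHom₂_comp, ← reassoc_of% tHom₂_comp]
  simp

end TensorBicategory

end

/-! ### Compatibility 2-morphisms of the identity pseudofunctor, compared with unitors -/

section

variable {C : Type u} [Bicategory.{w, v} C] [MonoidalBicategory C]

/-- The compatibility of the identity with the associativity, up to identities. -/
def idω₀ (X Y Z : C) : 𝟙 ((X ⊠ Y) ⊠ Z) ≫ 𝟙 ((X ⊠ Y) ⊠ Z) ≫ as X Y Z ≅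
    as X Y Z ≫ 𝟙 (X ⊠ (Y ⊠ Z)) ≫ 𝟙 (X ⊠ (Y ⊠ Z)) :=
  λ_ _ ≪≫ λ_ _ ≪≫ (ρ_ _).symm ≪≫ whiskerLeftIso _ (ρ_ _).symm

/-- The compatibility of the identity with the associativity. -/
def idω (X Y Z : C) : wr (𝟙 (X ⊠ Y)) Z ≫ 𝟙 ((X ⊠ Y) ⊠ Z) ≫ as X Y Z ≅
    as X Y Z ≫ wl X (𝟙 (Y ⊠ Z)) ≫ 𝟙 (X ⊠ (Y ⊠ Z)) :=
  hcIso (tId (X ⊠ Y) Z) (hcIso (Iso.refl (𝟙 _)) (Iso.refl (as X Y Z))) ≪≫ idω₀ X Y Z ≪≫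
    (hcIso (Iso.refl (as X Y Z)) (hcIso (tId X (Y ⊠ Z)) (Iso.refl (𝟙 _)))).symm

/-- The compatibility of the identity with the left unit, up to identities. -/
def idγ₀ (X : C) : 𝟙 (one ⊠ X) ≫ 𝟙 (one ⊠ X) ≫ (lUnit X).hom ≅ (lUnit X).hom := λ_ _ ≪≫ λ_ _

/-- The compatibility of the identity with the left unit. -/
def idγ (X : C) : wr (𝟙 one) X ≫ 𝟙 (one ⊠ X) ≫ (lUnit X).hom ≅ (lUnit X).hom :=
  hcIso (tId one X) (hcIso (Iso.refl (𝟙 _)) (Iso.refl (lUnit X).hom)) ≪≫ idγ₀ X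

/-- The compatibility of the identity with the right unit, up to identities. -/
def idδ₀ (X : C) : 𝟙 (X ⊠ one) ≫ 𝟙 (X ⊠ one) ≫ (rUnit X).hom ≅ (rUnit X).hom := λ_ _ ≪≫ λ_ _

/-- The compatibility of the identity with the right unit. -/
def idδ (X : C) : wl X (𝟙 one) ≫ 𝟙 (X ⊠ one) ≫ (rUnit X).hom ≅ (rUnit X).hom :=
  hcIso (tId X one) (hcIso (Iso.refl (𝟙 _)) (Iso.refl (rUnit X).hom)) ≪≫ idδ₀ X

/-- True by construction: `idω` is the conjugate of the structural 2-morphism `idω₀` by these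
boundary isomorphisms. -/
theorem idω_corr (X Y Z : C) :
    Corr (hcIso (tId (X ⊠ Y) Z) (hcIso (Iso.refl (𝟙 _)) (Iso.refl (as X Y Z))))
      (hcIso (Iso.refl (as X Y Z)) (hcIso (tId X (Y ⊠ Z)) (Iso.refl (𝟙 _))))
      (idω X Y Z).hom (idω₀ X Y Z).hom := by
  simp [idω, Corr]

theorem idγ_corr (X : C) :
    Corr (hcIso (tId one X) (hcIso (Iso.refl (𝟙 _)) (Iso.refl (lUnit X).hom)))
      (Iso.refl _) (idγ X).hom (idγ₀ X).hom := by
  simp [idγ, Corr]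

theorem idδ_corr (X : C) :
    Corr (hcIso (tId X one) (hcIso (Iso.refl (𝟙 _)) (Iso.refl (rUnit X).hom)))
      (Iso.refl _) (idδ X).hom (idδ₀ X).hom := by
  simp [idδ, Corr]

variable (C) in
/-- The data of the identity monoidal pseudofunctor. -/
def idMonoidalData : MonoidalPseudofunctorData C C where
  F := Pseudofunctor.id C
  χ X Y := Bicategory.Equivalence.id (X ⊠ Y)
  χNat f g := Sq.idSide (f ⊠₁ g)
  ι := Bicategory.Equivalence.id one
  ω := idω
  γ := idγ
  δ := idδ

/-- Vertical pasting, as opposed to `Corr.comp`. It is needed where a boundary is simplified in two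
stages: first inside a tensor product, then by `tId` outside. -/
theorem Corr.trans {C : Type u} [Bicategory.{w, v} C] {a b : C} {f f' f'' g g' g'' : a ⟶ b}
    {e : f ≅ f'} {e' : g ≅ g'} {d : f' ≅ f''} {d' : g' ≅ g''} {θ : f ⟶ g} {θ' : f' ⟶ g'}
    {θ'' : f'' ⟶ g''} (H : Corr e e' θ θ') (K : Corr d d' θ' θ'') :
    Corr (e ≪≫ d) (e' ≪≫ d') θ θ'' := by
  unfold Corr at *
  simp [reassoc_of% H, K]

theorem hcIso_trans {C : Type u} [Bicategory.{w, v} C] {a b c : C} {f f' f'' : a ⟶ b}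
    {g g' g'' : b ⟶ c} (e : f ≅ f') (d : f' ≅ f'') (e' : g ≅ g') (d' : g' ≅ g'') :
    hcIso e e' ≪≫ hcIso d d' = hcIso (e ≪≫ d) (e' ≪≫ d') := by
  ext
  simp [hcIso_hom, whisker_exchange_assoc]

theorem hcIso_refl {C : Type u} [Bicategory.{w, v} C] {a b c : C} (f : a ⟶ b) (g : b ⟶ c) :
    hcIso (Iso.refl f) (Iso.refl g) = Iso.refl (f ≫ g) := by
  ext
  simp [hcIso_hom]

theorem wrIso_refl {X X' : C} (f : X ⟶ X') (Y : C) : wrIso (Iso.refl f) Y = Iso.refl (wr f Y) := by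
  ext
  simp [tHom₂_id]

theorem wlIso_refl {X X' : C} (f : X ⟶ X') (Y : C) : wlIso Y (Iso.refl f) = Iso.refl (wl Y f) := by
  ext
  simp [tHom₂_id]

/-- The identity `(1 ⊗ 1) ⊗ 1`. -/
def tIdL (X Y Z : C) : (𝟙 X ⊠₁ 𝟙 Y) ⊠₁ 𝟙 Z ≅ 𝟙 ((X ⊠ Y) ⊠ Z) := wrIso (tId X Y) Z ≪≫ tId _ _

/-- The identity `1 ⊗ (1 ⊗ 1)`. -/
def tIdR (X Y Z : C) : 𝟙 X ⊠₁ (𝟙 Y ⊠₁ 𝟙 Z) ≅ 𝟙 (X ⊠ (Y ⊠ Z)) := wlIso X (tId Y Z) ≪≫ tId _ _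

/-- The axiom `assoc_id`, with its comparison 2-morphisms moved to the boundary. -/
theorem assocNat_id (X Y Z : C) :
    Corr (hcIso (tIdL X Y Z) (Iso.refl (as X Y Z))) (hcIso (Iso.refl (as X Y Z)) (tIdR X Y Z))
      (assocNat (𝟙 X) (𝟙 Y) (𝟙 Z)).hom (Sq.idTop (as X Y Z)).hom := by
  have h := MonoidalBicategory.assoc_id X Y Z
  simp only [Sq.Cube, whiskerLeft_id, Category.comp_id, id_whiskerRight] at h
  simp only [Corr, hcIso_hom, tIdL, tIdR]
  simpa using h.symm

/-- The copy of `tId Y Z` built into `asNat₁` accounts for the inner half of `tIdR`, so only the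
outer half remains on the target. -/
theorem asNat₁_id (X Y Z : C) :
    Corr (hcIso (tIdL X Y Z) (Iso.refl (as X Y Z))) (hcIso (Iso.refl (as X Y Z)) (tId X (Y ⊠ Z)))
      (asNat₁ (𝟙 X) Y Z).hom (Sq.idTop (as X Y Z)).hom := by
  have h := assocNat_id X Y Z
  simp only [Corr, hcIso_hom, tIdR] at h ⊢
  simpa [asNat₁] using h

theorem asNat₂_id (X Y Z : C) :
    Corr (hcIso (tIdL X Y Z) (Iso.refl (as X Y Z))) (hcIso (Iso.refl (as X Y Z)) (tIdR X Y Z))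
      (asNat₂ X (𝟙 Y) Z).hom (Sq.idTop (as X Y Z)).hom :=
  assocNat_id X Y Z

/-- The inverse of `tId X Y` built into `asNat₃` cancels the inner half of `tIdL`, so only the outer
half remains on the source. -/
theorem asNat₃_id (X Y Z : C) :
    Corr (hcIso (tId (X ⊠ Y) Z) (Iso.refl (as X Y Z))) (hcIso (Iso.refl (as X Y Z)) (tIdR X Y Z))
      (asNat₃ X Y (𝟙 Z)).hom (Sq.idTop (as X Y Z)).hom := by
  have h := assocNat_id X Y Z
  simp only [Corr, hcIso_hom, tIdL] at h ⊢
  simp only [asNat₃, Iso.trans_hom, Category.assoc, h]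
  simp only [whiskerRightIso_hom, tIso_hom, Iso.symm_hom, ← comp_whiskerRight_assoc]
  simp [← reassoc_of% tHom₂_comp, tHom₂_id]

theorem interchange_corr (X Y : C) :
    Corr (hcIso (tId X Y) (tId X Y)) (hcIso (tId X Y) (tId X Y))
      (interchange (𝟙 X) (𝟙 Y)).hom (𝟙 _) := by
  rw [interchange_id]
  exact Corr.id _

/-- The left unit law, used twice, removes the two leading identity factors of a threefold
composite. -/
theorem wrComp₃_left_corr {X X' : C} (f : X ⟶ X') (W : C) :
    Corr (hcIso (tId X W) (hcIso (tId X W) (Iso.refl (wr f W)))) (Iso.refl _)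
      ((wrComp₃ (𝟙 X) (𝟙 X) f W).inv ≫ (wrIso (λ_ (𝟙 X ≫ f) ≪≫ λ_ f) W).hom)
      ((λ_ (𝟙 _ ≫ wr f W)).hom ≫ (λ_ (wr f W)).hom) := by
  have h₁ := wrComp_id_left (𝟙 X ≫ f) W
  have h₂ := wrComp_id_left f W
  have h₃ : (wrIso (λ_ (𝟙 X ≫ f) ≪≫ λ_ f) W).hom =
    (wrIso (λ_ (𝟙 X ≫ f)) W).hom ≫ (wrIso (λ_ f) W).hom := by simp [← tHom₂_comp]
  rw [h₃, ← h₁, ← h₂]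
  simp only [Corr, hcIso_hom, wrComp₃, Iso.trans_inv, whiskerLeftIso_inv, Category.assoc,
    Iso.inv_hom_id_assoc, whisker_exchange_assoc]
  simp

theorem wlComp₃_left_corr {X X' : C} (f : X ⟶ X') (W : C) :
    Corr (hcIso (tId W X) (hcIso (tId W X) (Iso.refl (wl W f)))) (Iso.refl _)
      ((wlComp₃ W (𝟙 X) (𝟙 X) f).inv ≫ (wlIso W (λ_ (𝟙 X ≫ f) ≪≫ λ_ f)).hom)
      ((λ_ (𝟙 _ ≫ wl W f)).hom ≫ (λ_ (wl W f)).hom) := by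
  have h₁ := wlComp_id_left (𝟙 X ≫ f) W
  have h₂ := wlComp_id_left f W
  have h₃ : (wlIso W (λ_ (𝟙 X ≫ f) ≪≫ λ_ f)).hom =
    (wlIso W (λ_ (𝟙 X ≫ f))).hom ≫ (wlIso W (λ_ f)).hom := by simp [← tHom₂_comp]
  rw [h₃, ← h₁, ← h₂]
  simp only [Corr, hcIso_hom, wlComp₃, Iso.trans_inv, whiskerLeftIso_inv, Category.assoc,
    Iso.inv_hom_id_assoc, whisker_exchange_assoc]
  simp

/-- The mirror image of `wrComp₃_left_corr`. It is less direct because the two identity factors are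
first combined with each other and then with `f`. -/
theorem wrComp₃_right_corr {X X' : C} (f : X ⟶ X') (W : C) :
    Corr (hcIso (Iso.refl (wr f W)) (hcIso (tId X' W) (tId X' W))) (Iso.refl _)
      ((wrComp₃ f (𝟙 X') (𝟙 X') W).inv ≫ (wrIso (whiskerLeftIso f (ρ_ (𝟙 X')) ≪≫ ρ_ f) W).hom)
      (wr f W ◁ (ρ_ (𝟙 _)).hom ≫ (ρ_ (wr f W)).hom) := by
  have h₁ := wrComp_id_right f W
  have h₂ := wrComp_id_right (𝟙 X') W
  have h₃ : (wrIso (whiskerLeftIso f (ρ_ (𝟙 X')) ≪≫ ρ_ f) W).hom =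
    (wrIso (hcIso (Iso.refl f) (ρ_ (𝟙 X'))) W).hom ≫ (wrIso (ρ_ f) W).hom := by
      simp [← tHom₂_comp, hcIso_hom]
  have h₄ := wrComp_naturality (Iso.refl f) (ρ_ (𝟙 X')) W
  rw [wrIso_refl, Corr, hcIso_hom, Iso.refl_hom, id_whiskerRight, Category.id_comp] at h₄
  -- The unit law `h₂` collapses the second of the two identity factors, whereas `hcIso` begins with
  -- the first. Both collapses agree for an endomorphism isomorphic to an identity.
  have h₅ := congrArg (fun t => wr f W ◁ t) (FixedPoint.unit_exchange (tId X' W))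
  simp only [Bicategory.whiskerLeft_comp] at h₅
  rw [h₃, ← h₁, ← reassoc_of% h₄, ← h₂]
  simp only [Corr, hcIso_hom, wrComp₃, Iso.trans_inv, whiskerLeftIso_inv, Category.assoc,
    Iso.inv_hom_id_assoc, Bicategory.whiskerLeft_comp, whiskerLeft_inv_hom_assoc]
  rw [reassoc_of% h₅]
  simp

theorem wlComp₃_right_corr {X X' : C} (f : X ⟶ X') (W : C) :
    Corr (hcIso (Iso.refl (wl W f)) (hcIso (tId W X') (tId W X'))) (Iso.refl _)
      ((wlComp₃ W f (𝟙 X') (𝟙 X')).inv ≫ (wlIso W (whiskerLeftIso f (ρ_ (𝟙 X')) ≪≫ ρ_ f)).hom)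
      (wl W f ◁ (ρ_ (𝟙 _)).hom ≫ (ρ_ (wl W f)).hom) := by
  have h₁ := wlComp_id_right f W
  have h₂ := wlComp_id_right (𝟙 X') W
  have h₃ : (wlIso W (whiskerLeftIso f (ρ_ (𝟙 X')) ≪≫ ρ_ f)).hom =
    (wlIso W (hcIso (Iso.refl f) (ρ_ (𝟙 X')))).hom ≫ (wlIso W (ρ_ f)).hom := by
      simp [← tHom₂_comp, hcIso_hom]
  have h₄ := wlComp_naturality (Iso.refl f) (ρ_ (𝟙 X')) W
  rw [wlIso_refl, Corr, hcIso_hom, Iso.refl_hom, id_whiskerRight, Category.id_comp] at h₄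
  have h₅ := congrArg (fun t => wl W f ◁ t) (FixedPoint.unit_exchange (tId W X'))
  simp only [Bicategory.whiskerLeft_comp] at h₅
  rw [h₃, ← h₁, ← reassoc_of% h₄, ← h₂]
  simp only [Corr, hcIso_hom, wlComp₃, Iso.trans_inv, whiskerLeftIso_inv, Category.assoc,
    Iso.inv_hom_id_assoc, Bicategory.whiskerLeft_comp, whiskerLeft_inv_hom_assoc]
  rw [reassoc_of% h₅]
  simp

/-- The associativity cell tensored with an object on the right is treated in two stages: naturality
of `wrComp₃` replaces the inner tensor products of identities, and the unit laws replace the outer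
ones. -/
theorem wr_idω_corr (X Y Z W : C) :
    Corr (hcIso (tIdL (X ⊠ Y) Z W) (hcIso (tId _ W) (Iso.refl (wr (as X Y Z) W))))
      (hcIso (Iso.refl (wr (as X Y Z) W)) (hcIso (tIdL X (Y ⊠ Z) W) (tId _ W)))
      ((wrComp₃ _ _ _ W).inv ≫ (wrIso (idω X Y Z) W).hom ≫ (wrComp₃ _ _ _ W).hom)
      (((λ_ (𝟙 _ ≫ wr (as X Y Z) W)).hom ≫ (λ_ (wr (as X Y Z) W)).hom) ≫
        ((ρ_ (wr (as X Y Z) W)).inv ≫ wr (as X Y Z) W ◁ (ρ_ (𝟙 _)).inv)) := by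
  have h₁ : Corr _ _ ((wrComp₃ _ _ _ W).inv ≫ (wrIso (idω X Y Z) W).hom ≫ (wrComp₃ _ _ _ W).hom)
      _ := (Corr.symm (wrComp₃_naturality _ _ _ W)).comp
    (((idω_corr X Y Z).tensor (Corr.id (Iso.refl (𝟙 W)))).comp (wrComp₃_naturality _ _ _ W))
  -- `idω₀` first removes the identities before `as` and then inserts those after it. Splitting
  -- there gives a cell treated by `wrComp₃_left_corr` and the inverse of one treated by
  -- `wrComp₃_right_corr`.
  have h₂ : ((wrComp₃ _ _ _ W).inv ≫ (wrIso (idω₀ X Y Z) W).hom ≫ (wrComp₃ _ _ _ W).hom) =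
      ((wrComp₃ _ _ _ W).inv ≫ (wrIso (λ_ (𝟙 _ ≫ as X Y Z) ≪≫ λ_ (as X Y Z)) W).hom) ≫
      ((wrComp₃ _ _ _ W).symm ≪≫ wrIso (whiskerLeftIso (as X Y Z) (ρ_ (𝟙 _)) ≪≫
        ρ_ (as X Y Z)) W).inv := by
    simp only [idω₀, Iso.trans_hom, Iso.trans_inv, tIso_hom, tIso_inv, Iso.symm_inv,
      Category.assoc, ← reassoc_of% tHom₂_comp]
    simp
  have h₃ := (wrComp₃_left_corr (as X Y Z) W).comp (Corr.symm
      (θ := (wrComp₃ (as X Y Z) (𝟙 _) (𝟙 _) W).symm ≪≫ wrIso _ W)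
      (θ' := whiskerLeftIso _ (ρ_ _) ≪≫ ρ_ _) (wrComp₃_right_corr (as X Y Z) W))
  rw [← h₂] at h₃
  have h₄ := h₁.trans h₃
  -- The two stages on the boundary merge factor by factor; an inner `tId` followed by an outer one
  -- is the definition of `tIdL`.
  simp only [hcIso_trans, wrIso_refl, Iso.refl_trans] at h₄
  exact h₄

theorem wl_idω_corr (X Y Z W : C) :
    Corr (hcIso (tIdR W (X ⊠ Y) Z) (hcIso (tId W _) (Iso.refl (wl W (as X Y Z)))))
      (hcIso (Iso.refl (wl W (as X Y Z))) (hcIso (tIdR W X (Y ⊠ Z)) (tId W _)))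
      ((wlComp₃ W _ _ _).inv ≫ (wlIso W (idω X Y Z)).hom ≫ (wlComp₃ W _ _ _).hom)
      (((λ_ (𝟙 _ ≫ wl W (as X Y Z))).hom ≫ (λ_ (wl W (as X Y Z))).hom) ≫
        ((ρ_ (wl W (as X Y Z))).inv ≫ wl W (as X Y Z) ◁ (ρ_ (𝟙 _)).inv)) := by
  have h₁ : Corr _ _ ((wlComp₃ W _ _ _).inv ≫ (wlIso W (idω X Y Z)).hom ≫ (wlComp₃ W _ _ _).hom)
      _ := (Corr.symm (wlComp₃_naturality _ _ _ W)).comp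
    (((Corr.id (Iso.refl (𝟙 W))).tensor (idω_corr X Y Z)).comp (wlComp₃_naturality _ _ _ W))
  have h₂ : ((wlComp₃ W _ _ _).inv ≫ (wlIso W (idω₀ X Y Z)).hom ≫ (wlComp₃ W _ _ _).hom) =
      ((wlComp₃ W _ _ _).inv ≫ (wlIso W (λ_ (𝟙 _ ≫ as X Y Z) ≪≫ λ_ (as X Y Z))).hom) ≫
      ((wlComp₃ W _ _ _).symm ≪≫ wlIso W (whiskerLeftIso (as X Y Z) (ρ_ (𝟙 _)) ≪≫
        ρ_ (as X Y Z))).inv := by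
    simp only [idω₀, Iso.trans_hom, Iso.trans_inv, tIso_hom, tIso_inv, Iso.symm_inv,
      Category.assoc, ← reassoc_of% tHom₂_comp]
    simp
  have h₃ := (wlComp₃_left_corr (as X Y Z) W).comp (Corr.symm
      (θ := (wlComp₃ W (as X Y Z) (𝟙 _) (𝟙 _)).symm ≪≫ wlIso W _)
      (θ' := whiskerLeftIso _ (ρ_ _) ≪≫ ρ_ _) (wlComp₃_right_corr (as X Y Z) W))
  rw [← h₂] at h₃
  have h₄ := h₁.trans h₃
  simp only [hcIso_trans, wlIso_refl, Iso.refl_trans] at h₄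
  exact h₄

/-- Only the left unit laws enter, since no identity factors remain after the right unit has been
applied. -/
theorem wr_idδ_corr (X W : C) :
    Corr (hcIso (tIdL X one W) (hcIso (tId _ W) (Iso.refl (wr (rUnit X).hom W)))) (Iso.refl _)
      ((wrComp₃ _ _ _ W).inv ≫ (wrIso (idδ X) W).hom)
      ((λ_ (𝟙 _ ≫ wr (rUnit X).hom W)).hom ≫ (λ_ (wr (rUnit X).hom W)).hom) := by
  have h₁ : Corr _ _ ((wrComp₃ _ _ _ W).inv ≫ (wrIso (idδ X) W).hom) _ :=
    (Corr.symm (wrComp₃_naturality _ _ _ W)).comp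
      ((idδ_corr X).tensor (Corr.id (Iso.refl (𝟙 W))))
  have h₂ := h₁.trans (wrComp₃_left_corr (rUnit X).hom W)
  simp only [hcIso_trans, wrIso_refl, Iso.refl_trans] at h₂
  exact h₂

theorem wl_idγ_corr (X W : C) :
    Corr (hcIso (tIdR W one X) (hcIso (tId W _) (Iso.refl (wl W (lUnit X).hom)))) (Iso.refl _)
      ((wlComp₃ W _ _ _).inv ≫ (wlIso W (idγ X)).hom)
      ((λ_ (𝟙 _ ≫ wl W (lUnit X).hom)).hom ≫ (λ_ (wl W (lUnit X).hom)).hom) := by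
  have h₁ : Corr _ _ ((wlComp₃ W _ _ _).inv ≫ (wlIso W (idγ X)).hom) _ :=
    (Corr.symm (wlComp₃_naturality _ _ _ W)).comp
      ((Corr.id (Iso.refl (𝟙 W))).tensor (idγ_corr X))
  have h₂ := h₁.trans (wlComp₃_left_corr (lUnit X).hom W)
  simp only [hcIso_trans, wlIso_refl, Iso.refl_trans] at h₂
  exact h₂

end

/-! ### The identity as a monoidal pseudofunctor -/

section

variable {C : Type u} [Bicategory.{w, v} C] [MonoidalBicategory C]

/-- The correction in `χNat₁` comes from the unit constraint of the pseudofunctor, which is an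
identity here. -/
theorem idMonoidalData_χNat₁ {X X' : C} (f : X ⟶ X') (Y : C) :
    ((idMonoidalData C).χNat₁ f Y) = Sq.idSide (wr f Y) := by
  ext
  change (𝟙 f ⊠₂ 𝟙 (𝟙 Y)) ▷ 𝟙 _ ≫ (Sq.idSide (f ⊠₁ 𝟙 Y)).hom = _
  simp [tHom₂_id]

theorem idMonoidalData_χNat₂ (X : C) {Y Y' : C} (f : Y ⟶ Y') :
    ((idMonoidalData C).χNat₂ X f) = Sq.idSide (wl X f) := by
  ext
  change (𝟙 (𝟙 X) ⊠₂ 𝟙 f) ▷ 𝟙 _ ≫ (Sq.idSide (𝟙 X ⊠₁ f)).hom = _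
  simp [tHom₂_id]

/-- No boundary changes here. The reflexivities are written factor by factor, as `hcIso` of
reflexivities, so that they unify with the boundaries of the neighbouring cells in a pasting; the
same holds for the similar lemmas on the pentagonator, the 2-unitor and the naturality squares. -/
theorem χNat₁_corr {X X' : C} (f : X ⟶ X') (Y : C) :
    Corr (hcIso (Iso.refl (𝟙 (X ⊠ Y))) (Iso.refl (wr f Y)))
      (hcIso (Iso.refl (wr f Y)) (Iso.refl (𝟙 (X' ⊠ Y)))) ((idMonoidalData C).χNat₁ f Y).inv
      (Sq.idSide (wr f Y)).inv := by
  rw [idMonoidalData_χNat₁, hcIso_refl, hcIso_refl]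
  exact Corr.refl _

theorem χNat₂_corr (X : C) {Y Y' : C} (f : Y ⟶ Y') :
    Corr (hcIso (Iso.refl (𝟙 (X ⊠ Y))) (Iso.refl (wl X f)))
      (hcIso (Iso.refl (wl X f)) (Iso.refl (𝟙 (X ⊠ Y')))) ((idMonoidalData C).χNat₂ X f).inv
      (Sq.idSide (wl X f)).inv := by
  rw [idMonoidalData_χNat₂, hcIso_refl, hcIso_refl]
  exact Corr.refl _

theorem pent_corr (X Y Z W : C) :
    Corr (hcIso (Iso.refl (as (X ⊠ Y) Z W)) (Iso.refl (as X Y (Z ⊠ W))))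
      (hcIso (Iso.refl (wr (as X Y Z) W)) (hcIso (Iso.refl (as X (Y ⊠ Z) W))
        (Iso.refl (wl X (as Y Z W))))) (pent X Y Z W).hom (pent X Y Z W).hom := by
  rw [hcIso_refl, hcIso_refl, hcIso_refl]
  exact Corr.refl _

theorem midUnitor_corr (X Y : C) :
    Corr (hcIso (Iso.refl (as X one Y)) (Iso.refl (wl X (lUnit Y).hom)))
      (Iso.refl (wr (rUnit X).hom Y)) (midUnitor X Y).hom (midUnitor X Y).hom := by
  rw [hcIso_refl]
  exact Corr.refl _

theorem assocNat_corr {X X' Y Y' Z Z' : C} (f : X ⟶ X') (g : Y ⟶ Y') (h : Z ⟶ Z') :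
    Corr (hcIso (Iso.refl ((f ⊠₁ g) ⊠₁ h)) (Iso.refl (as X' Y' Z')))
      (hcIso (Iso.refl (as X Y Z)) (Iso.refl (f ⊠₁ (g ⊠₁ h)))) (assocNat f g h).hom
      (assocNat f g h).hom := by
  rw [hcIso_refl, hcIso_refl]
  exact Corr.refl _

theorem lUnitNat_corr {X X' : C} (f : X ⟶ X') :
    Corr (hcIso (Iso.refl (wl one f)) (Iso.refl (lUnit X').hom))
      (hcIso (Iso.refl (lUnit X).hom) (Iso.refl f)) (lUnitNat f).hom (lUnitNat f).hom := by
  rw [hcIso_refl, hcIso_refl]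
  exact Corr.refl _

theorem rUnitNat_corr {X X' : C} (f : X ⟶ X') :
    Corr (hcIso (Iso.refl (wr f one)) (Iso.refl (rUnit X').hom))
      (hcIso (Iso.refl (rUnit X).hom) (Iso.refl f)) (rUnitNat f).hom (rUnitNat f).hom := by
  rw [hcIso_refl, hcIso_refl]
  exact Corr.refl _

theorem idSide_corr {C : Type u} [Bicategory.{w, v} C] {a b : C} (f : a ⟶ b) :
    Corr (hcIso (Iso.refl f) (Iso.refl (𝟙 b))) (hcIso (Iso.refl (𝟙 a)) (Iso.refl f))
      (Sq.idSide f).hom (Sq.idSide f).hom := by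
  rw [hcIso_refl, hcIso_refl]
  exact Corr.refl _

/-- The two kinds of identity square agree on an identity 1-morphism because its left and right
unitors coincide. -/
theorem idMonoidalData_ιNat : (idMonoidalData C).ιNat = Sq.idSide (𝟙 one) := by
  ext
  change ((λ_ _).hom ≫ (ρ_ _).inv) ≫ 𝟙 _ ◁ 𝟙 (𝟙 _) = (ρ_ _).hom ≫ (λ_ _).inv
  simp [unitors_equal]

theorem idMonoidalData_map {a a' b b' : C} {f : a ⟶ a'} {p : a ⟶ b} {p' : a' ⟶ b'} {g : b ⟶ b'}
    (s : Sq f p p' g) : Sq.map (idMonoidalData C).F s = s := by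
  ext
  change 𝟙 _ ≫ s.hom ≫ 𝟙 _ = s.hom
  simp

variable (C) in
set_option maxHeartbeats 4000000 in
/-- The identity monoidal pseudofunctor. -/
def idMonoidal : MonoidalPseudofunctor C C where
  toMonoidalPseudofunctorData := idMonoidalData C
  χ_naturality {X X' Y Y' f f' g g'} η θ := by
    change ((η ⊠₂ θ) ▷ 𝟙 _ ≫ (f' ⊠₁ g') ◁ 𝟙 _) ≫ (Sq.idSide _).hom =
      (Sq.idSide _).hom ≫ 𝟙 _ ◁ (η ⊠₂ θ) ≫ 𝟙 (𝟙 _) ▷ _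
    simp [Sq.idSide]
  χ_id X Y := by
    change ((𝟙 _ ⊠₂ 𝟙 _ ≫ (tId X Y).hom) ▷ 𝟙 _ ≫ (𝟙 _) ◁ 𝟙 _) ≫ (Sq.idTop _).hom =
      (Sq.idSide (𝟙 X ⊠₁ 𝟙 Y)).hom ≫ 𝟙 _ ◁ ((tId X Y).hom ≫ 𝟙 _) ≫ 𝟙 (𝟙 _) ▷ _
    simp [Sq.idSide, Sq.idTop, tHom₂_id, unitors_equal]
  χ_comp {X X' X'' Y Y' Y''} f f' g g' := by
    change ((𝟙 _ ⊠₂ 𝟙 _ ≫ (tComp f f' g g').hom) ▷ 𝟙 _ ≫ (_) ◁ 𝟙 _) ≫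
      (Sq.vcomp (Sq.idSide (f ⊠₁ g)) (Sq.idSide (f' ⊠₁ g'))).hom =
      (Sq.idSide ((f ≫ f') ⊠₁ (g ≫ g'))).hom ≫ 𝟙 _ ◁ ((tComp f f' g g').hom ≫ 𝟙 _) ≫ 𝟙 (𝟙 _) ▷ _
    simp [Sq.idSide, Sq.vcomp, tHom₂_id]
  ω_naturality {X X' Y Y' Z Z'} f g h := by
    rw [idMonoidalData_map]
    change (𝟙 ((f ⊠₁ g) ⊠₁ h) ▷ (wr (𝟙 (X' ⊠ Y')) Z' ≫ 𝟙 ((X' ⊠ Y') ⊠ Z') ≫ as X' Y' Z') ≫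
        ((f ⊠₁ g) ⊠₁ h) ◁ (idω X' Y' Z').hom) ≫
      (Sq.hcomp (assocNat f g h) (Sq.hcomp (sqT (Sq.idSide f) (Sq.idSide (g ⊠₁ h)))
        (Sq.idSide (f ⊠₁ (g ⊠₁ h))))).hom =
      (Sq.hcomp (sqT (Sq.idSide (f ⊠₁ g)) (Sq.idSide h)) (Sq.hcomp (Sq.idSide ((f ⊠₁ g) ⊠₁ h))
        (assocNat f g h))).hom ≫ (wr (𝟙 (X ⊠ Y)) Z ≫ 𝟙 ((X ⊠ Y) ⊠ Z) ≫ as X Y Z) ◁ 𝟙 _ ≫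
        (idω X Y Z).hom ▷ (f ⊠₁ (g ⊠₁ h))
    simp only [Sq.hcomp, Iso.trans_hom, whiskerLeftIso_hom, whiskerRightIso_hom,
      Iso.symm_hom, id_whiskerRight, whiskerLeft_id, Category.id_comp]
    -- The boundary isomorphisms are assembled factor by factor: `tId` where a tensor product of
    -- identities stands, and a reflexivity elsewhere.
    apply Corr.eq
      (e := hcIso (Iso.refl ((f ⊠₁ g) ⊠₁ h))
        (hcIso (tId _ _) (hcIso (Iso.refl (𝟙 _)) (Iso.refl (as X' Y' Z')))))
      (e' := hcIso (hcIso (Iso.refl (as X Y Z)) (hcIso (tId _ _) (Iso.refl (𝟙 _))))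
        (Iso.refl (f ⊠₁ (g ⊠₁ h))))
    -- The search follows the syntax of the pasting: composites, whiskerings and associators are
    -- decomposed, and every remaining cell has its own correspondence, which determines the
    -- transported right-hand side.
    · repeat' first
        | exact idω_corr _ _ _
        | exact assocNat_corr _ _ _
        | exact sqT_idSide _ _
        | exact idSide_corr _
        | apply Corr.associator_hom
        | apply Corr.associator_inv
        | apply Corr.whiskerLeft
        | apply Corr.whiskerRight
        | apply Corr.comp
    · repeat' first
        | exact idω_corr _ _ _
        | exact assocNat_corr _ _ _
        | exact sqT_idSide _ _
        | exact idSide_corr _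
        | apply Corr.associator_hom
        | apply Corr.associator_inv
        | apply Corr.whiskerLeft
        | apply Corr.whiskerRight
        | apply Corr.comp
    -- All identity factors are now genuine identities, and `assocNat` occurs once on each side. The
    -- rest is structural, so coherence applies.
    · simp only [idω₀, Sq.idSide, Iso.trans_hom, Iso.symm_hom,
        whiskerLeftIso_hom]
      bicategory
  γ_naturality {X X'} f := by
    rw [idMonoidalData_map, idMonoidalData_ιNat]
    change (𝟙 (wl one f) ▷ (wr (𝟙 one) X' ≫ 𝟙 (one ⊠ X') ≫ (lUnit X').hom) ≫
        (wl one f) ◁ (idγ X').hom) ≫ (lUnitNat f).hom =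
      (Sq.hcomp (sqT (Sq.idSide (𝟙 one)) (Sq.idSide f)) (Sq.hcomp (Sq.idSide (wl one f))
        (lUnitNat f))).hom ≫ (wr (𝟙 one) X ≫ 𝟙 (one ⊠ X) ≫ (lUnit X).hom) ◁ 𝟙 f ≫
        (idγ X).hom ▷ f
    simp only [Sq.hcomp, Iso.trans_hom, whiskerLeftIso_hom, whiskerRightIso_hom,
      Iso.symm_hom, id_whiskerRight, whiskerLeft_id, Category.id_comp]
    apply Corr.eq
      (e := hcIso (Iso.refl (wl one f))
        (hcIso (tId _ _) (hcIso (Iso.refl (𝟙 _)) (Iso.refl (lUnit X').hom))))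
      (e' := hcIso (Iso.refl (lUnit X).hom) (Iso.refl f))
    · repeat' first
        | exact idγ_corr _
        | exact lUnitNat_corr _
        | apply Corr.whiskerLeft
        | apply Corr.comp
    · repeat' first
        | exact idγ_corr _
        | exact lUnitNat_corr _
        | exact sqT_idSide _ _
        | exact idSide_corr _
        | apply Corr.associator_hom
        | apply Corr.associator_inv
        | apply Corr.whiskerLeft
        | apply Corr.whiskerRight
        | apply Corr.comp
    · simp only [idγ₀, Sq.idSide, Iso.trans_hom, Iso.symm_hom]
      bicategory
  δ_naturality {X X'} f := by
    rw [idMonoidalData_map, idMonoidalData_ιNat]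
    change (𝟙 (wr f one) ▷ (wl X' (𝟙 one) ≫ 𝟙 (X' ⊠ one) ≫ (rUnit X').hom) ≫
        (wr f one) ◁ (idδ X').hom) ≫ (rUnitNat f).hom =
      (Sq.hcomp (sqT (Sq.idSide f) (Sq.idSide (𝟙 one))) (Sq.hcomp (Sq.idSide (wr f one))
        (rUnitNat f))).hom ≫ (wl X (𝟙 one) ≫ 𝟙 (X ⊠ one) ≫ (rUnit X).hom) ◁ 𝟙 f ≫
        (idδ X).hom ▷ f
    simp only [Sq.hcomp, Iso.trans_hom, whiskerLeftIso_hom, whiskerRightIso_hom,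
      Iso.symm_hom, id_whiskerRight, whiskerLeft_id, Category.id_comp]
    apply Corr.eq
      (e := hcIso (Iso.refl (wr f one))
        (hcIso (tId _ _) (hcIso (Iso.refl (𝟙 _)) (Iso.refl (rUnit X').hom))))
      (e' := hcIso (Iso.refl (rUnit X).hom) (Iso.refl f))
    · repeat' first
        | exact idδ_corr _
        | exact rUnitNat_corr _
        | apply Corr.whiskerLeft
        | apply Corr.comp
    · repeat' first
        | exact idδ_corr _
        | exact rUnitNat_corr _
        | exact sqT_idSide _ _
        | exact idSide_corr _
        | apply Corr.associator_hom
        | apply Corr.associator_inv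
        | apply Corr.whiskerLeft
        | apply Corr.whiskerRight
        | apply Corr.comp
    · simp only [idδ₀, Sq.idSide, Iso.trans_hom, Iso.symm_hom]
      bicategory
  ω_pent X Y Z W := by
    -- The coherence isomorphisms hidden in `⊗≫` are expanded into whiskered associators, for which
    -- correspondences are available.
    simp only [bicategoricalComp, BicategoricalCoherence.assoc_iso, BicategoricalCoherence.refl_iso,
      BicategoricalCoherence.assoc'_iso, BicategoricalCoherence.whiskerLeft_iso, Iso.trans_hom,
      BicategoricalCoherence.whiskerRight_iso, whiskerLeftIso_hom, whiskerRightIso_hom,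
      Iso.refl_hom, Iso.symm_hom, id_whiskerRight, Category.id_comp,
      Category.comp_id]
    -- The doubly nested tensor products of identities require `tIdL` in the source and `tIdR` in
    -- the target; the simply nested ones require `tId`.
    apply Corr.eq
      (e := hcIso (tIdL (X ⊠ Y) Z W) (hcIso (tId _ W) (hcIso (Iso.refl (𝟙 _))
        (hcIso (Iso.refl (as (X ⊠ Y) Z W)) (Iso.refl (as X Y (Z ⊠ W)))))))
      (e' := hcIso (Iso.refl (wr (as X Y Z) W)) (hcIso (Iso.refl (as X (Y ⊠ Z) W))
        (hcIso (Iso.refl (wl X (as Y Z W))) (hcIso (tIdR X Y (Z ⊠ W))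
          (hcIso (tId X _) (Iso.refl (𝟙 _)))))))

    · repeat' first
        | exact Corr.id _
        | exact idω_corr _ _ _
        | exact asNat₁_id _ _ _
        | exact asNat₃_id _ _ _
        | exact interchange_corr _ _
        | exact pent_corr _ _ _ _
        | apply Corr.associator_hom
        | apply Corr.associator_inv
        | apply Corr.whiskerLeft
        | apply Corr.whiskerRight
        | apply Corr.comp
    · repeat' first
        | exact Corr.id _
        | exact idω_corr _ _ _
        | exact asNat₂_id _ _ _
        | exact χNat₁_corr _ _
        | exact χNat₂_corr _ _
        | exact wr_idω_corr _ _ _ _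
        | exact wl_idω_corr _ _ _ _
        | exact pent_corr _ _ _ _
        | apply Corr.associator_hom
        | apply Corr.associator_inv
        | apply Corr.whiskerLeft
        | apply Corr.whiskerRight
        | apply Corr.comp
    -- What is left is the pentagonator, once on each side, pasted with unitors and associators.
    · simp only [idω₀, Sq.idTop, Sq.idSide, Iso.trans_hom, Iso.symm_hom,
        whiskerLeftIso_hom, Iso.trans_inv, Iso.symm_inv]
      bicategory
  ω_unit X Y := by
    simp only [bicategoricalComp, BicategoricalCoherence.assoc_iso, BicategoricalCoherence.refl_iso,
      BicategoricalCoherence.assoc'_iso, BicategoricalCoherence.whiskerLeft_iso, Iso.trans_hom,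
      BicategoricalCoherence.whiskerRight_iso, whiskerLeftIso_hom, whiskerRightIso_hom,
      Iso.refl_hom, Iso.symm_hom, id_whiskerRight, Category.id_comp,
      Category.comp_id]
    apply Corr.eq
      (e := hcIso (tIdL X one Y) (hcIso (tId _ Y) (hcIso (Iso.refl (𝟙 _))
        (hcIso (Iso.refl (as X one Y)) (Iso.refl (wl X (lUnit Y).hom))))))
      (e' := hcIso (Iso.refl (wr (rUnit X).hom Y)) (Iso.refl (𝟙 _)))
    · repeat' first
        | exact Corr.id _
        | exact midUnitor_corr _ _
        | exact χNat₁_corr _ _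
        | exact wr_idδ_corr _ _
        | apply Corr.associator_hom
        | apply Corr.associator_inv
        | apply Corr.whiskerLeft
        | apply Corr.whiskerRight
        | apply Corr.comp
    · repeat' first
        | exact Corr.id _
        | exact midUnitor_corr _ _
        | exact idω_corr _ _ _
        | exact asNat₂_id _ _ _
        | exact χNat₂_corr _ _
        | exact wl_idγ_corr _ _
        | apply Corr.associator_hom
        | apply Corr.associator_inv
        | apply Corr.whiskerLeft
        | apply Corr.whiskerRight
        | apply Corr.comp
    -- As for the pentagonator: the middle 2-unitor occurs once on each side, and everything else is
    -- structural.
    · simp only [idω₀, Sq.idTop, Sq.idSide, Iso.trans_hom, Iso.symm_hom,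
        whiskerLeftIso_hom, Iso.trans_inv, Iso.symm_inv]
      bicategory
end

/-! ### Tensoring with an invertible object is fully faithful on Hom categories -/

section

variable {C : Type u} [Bicategory.{w, v} C]

/-- A quasi-inverse is composition with `e.inv`; the unit and counit of `e` give the natural
isomorphisms. This and its counterpart for precomposition allow equivalences to be cancelled from
equations of 2-morphisms. -/
theorem postcomp_isEquivalence (a : C) {b c : C} (e : b ≌ c) :
    (postcomp a e.hom).IsEquivalence :=
  (CategoryTheory.Equivalence.mk (postcomp a e.hom) (postcomp a e.inv)
    (NatIso.ofComponents (fun f : a ⟶ b =>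
      ((ρ_ f).symm ≪≫ whiskerLeftIso f e.unit ≪≫ (α_ _ _ _).symm :))
      (fun {f g} η => by
        change η ≫ (ρ_ g).inv ≫ g ◁ e.unit.hom ≫ (α_ _ _ _).inv =
          ((ρ_ f).inv ≫ f ◁ e.unit.hom ≫ (α_ _ _ _).inv) ≫ η ▷ e.hom ▷ e.inv
        simp only [Category.assoc, ← associator_inv_naturality_left, whisker_exchange_assoc,
          whiskerRight_id, Iso.inv_hom_id_assoc]))
    (NatIso.ofComponents (fun f : a ⟶ c =>
      (α_ _ _ _ ≪≫ whiskerLeftIso f e.counit ≪≫ ρ_ f :))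
      (fun {f g} η => by
        have h : η ▷ e.inv ▷ e.hom ≫ (α_ _ _ _).hom ≫ g ◁ e.counit.hom ≫ (ρ_ g).hom =
            ((α_ _ _ _).hom ≫ f ◁ e.counit.hom ≫ (ρ_ f).hom) ≫ η := by
          rw [associator_naturality_left_assoc, ← whisker_exchange_assoc, rightUnitor_naturality]
          simp only [Category.assoc]
        exact h))).isEquivalence_functor

theorem precomp_isEquivalence {a b : C} (c : C) (e : a ≌ b) :
    (precomp c e.hom).IsEquivalence :=
  (CategoryTheory.Equivalence.mk (precomp c e.hom) (precomp c e.inv)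
    (NatIso.ofComponents (fun f : b ⟶ c =>
      ((λ_ f).symm ≪≫ whiskerRightIso e.counit.symm f ≪≫ α_ _ _ _ :))
      (fun {f g} η => by
        change η ≫ (λ_ g).inv ≫ e.counit.inv ▷ g ≫ (α_ _ _ _).hom =
          ((λ_ f).inv ≫ e.counit.inv ▷ f ≫ (α_ _ _ _).hom) ≫ e.inv ◁ e.hom ◁ η
        simp only [Category.assoc, ← associator_naturality_right, ← whisker_exchange_assoc,
          id_whiskerLeft, Iso.inv_hom_id_assoc]))
    (NatIso.ofComponents (fun f : a ⟶ c =>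
      ((α_ _ _ _).symm ≪≫ whiskerRightIso e.unit.symm f ≪≫ λ_ f :))
      (fun {f g} η => by
        have h : e.hom ◁ e.inv ◁ η ≫ (α_ _ _ _).inv ≫ e.unit.inv ▷ g ≫ (λ_ g).hom =
            ((α_ _ _ _).inv ≫ e.unit.inv ▷ f ≫ (λ_ f).hom) ≫ η := by
          rw [associator_inv_naturality_right_assoc, whisker_exchange_assoc,
            leftUnitor_naturality]
          simp only [Category.assoc]
        exact h))).isEquivalence_functor

variable [MonoidalBicategory C]

/-- The functor on 1-morphisms given by the tensor product with an object on the left. -/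
@[simps]
def wlFunctor (c a b : C) : (a ⟶ b) ⥤ (c ⊠ a ⟶ c ⊠ b) where
  obj f := wl c f
  map η := 𝟙 (𝟙 c) ⊠₂ η
  map_id f := tHom₂_id _ _
  map_comp η θ := by rw [← tHom₂_comp, Category.id_comp]

/-- Naturality of `tComp` moves the 2-morphism past both compositors; the unitors between them are
natural. -/
theorem interchange_naturality {X X' Y Y' : C} (f : X ⟶ X') {g g' : Y ⟶ Y'} (η : g ⟶ g') :
    wr f Y ◁ (𝟙 (𝟙 X') ⊠₂ η) ≫ (interchange f g').hom =
      (interchange f g).hom ≫ (𝟙 (𝟙 X) ⊠₂ η) ▷ wr f Y' := by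
  simp only [interchange, Iso.trans_hom, Iso.symm_hom, Category.assoc, tIso_hom]
  rw [tComp_whiskerRight, ← reassoc_of% (tComp_whiskerLeft f (𝟙 Y) (𝟙 (𝟙 X')) η)]
  rw [← reassoc_of% tHom₂_comp, ← reassoc_of% tHom₂_comp]
  simp

/-- The functors given by equivalent objects agree up to equivalences. -/
def wlFunctorInterchange {X X' : C} (f : X ⟶ X') (a b : C) :
    wlFunctor X' a b ⋙ precomp _ (wr f a) ≅ wlFunctor X a b ⋙ postcomp _ (wr f b) :=
  NatIso.ofComponents (fun g => interchange f g) fun η => interchange_naturality f η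

/-- The functor given by the unit is the identity up to equivalences. -/
def wlFunctorOne (a b : C) :
    wlFunctor one a b ⋙ postcomp _ (lUnit b).hom ≅ precomp _ (lUnit a).hom :=
  NatIso.ofComponents (fun g => lUnitNat g) fun {f g} η => by
    have h : ((𝟙 (𝟙 one) ⊠₂ η) ▷ (lUnit b).hom ≫ wl one g ◁ 𝟙 (lUnit b).hom) ≫
      (lUnitNat g).hom = (lUnitNat f).hom ≫
      (lUnit a).hom ◁ η ≫ 𝟙 (lUnit a).hom ▷ g :=
      MonoidalBicategory.lUnit_naturality η
    simp only [whiskerLeft_id, id_whiskerRight, Category.comp_id] at h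
    exact h

/-- The functor given by a tensor product is a composite up to equivalences. -/
def wlFunctorAssoc (X Y a b : C) :
    wlFunctor (X ⊠ Y) a b ⋙ postcomp _ (as X Y b) ≅
      (wlFunctor Y a b ⋙ wlFunctor X _ _) ⋙ precomp _ (as X Y a) :=
  NatIso.ofComponents (fun g => asNat₃ X Y g) fun {f g} η => by
    have h : (((𝟙 (𝟙 X) ⊠₂ 𝟙 (𝟙 Y)) ⊠₂ η) ▷ as X Y b ≫ ((𝟙 X ⊠₁ 𝟙 Y) ⊠₁ g) ◁ 𝟙 (as X Y b)) ≫
      (assocNat (𝟙 X) (𝟙 Y) g).hom = (assocNat (𝟙 X) (𝟙 Y) f).hom ≫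
      as X Y a ◁ (𝟙 (𝟙 X) ⊠₂ (𝟙 (𝟙 Y) ⊠₂ η)) ≫ 𝟙 (as X Y a) ▷ (𝟙 X ⊠₁ (𝟙 Y ⊠₁ g)) :=
      MonoidalBicategory.assoc_naturality (𝟙 (𝟙 X)) (𝟙 (𝟙 Y)) η
    simp only [whiskerLeft_id, id_whiskerRight, Category.comp_id, tHom₂_id] at h
    change (𝟙 (𝟙 (X ⊠ Y)) ⊠₂ η) ▷ as X Y b ≫ ((tId X Y).inv ⊠₂ 𝟙 g) ▷ as X Y b ≫
      (assocNat (𝟙 X) (𝟙 Y) g).hom = (((tId X Y).inv ⊠₂ 𝟙 f) ▷ as X Y b ≫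
      (assocNat (𝟙 X) (𝟙 Y) f).hom) ≫ as X Y a ◁ (𝟙 (𝟙 X) ⊠₂ (𝟙 (𝟙 Y) ⊠₂ η))
    rw [Category.assoc, ← h, ← comp_whiskerRight_assoc, ← comp_whiskerRight_assoc, ← tHom₂_comp,
      ← tHom₂_comp]
    simp

/-- Full faithfulness passes between opposite sides of a square of functors that commutes up to
isomorphism when the other two sides are equivalences. -/
theorem full_faithful_of_iso {A B B' E : Type*} [Category A] [Category B] [Category B']
    [Category E] {F : A ⥤ B} {G : B ⥤ E} {F' : A ⥤ B'} {G' : B' ⥤ E} (i : F ⋙ G ≅ F' ⋙ G')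
    (hG : G.IsEquivalence) (hG' : G'.IsEquivalence) (hF : F.Full ∧ F.Faithful) :
    F'.Full ∧ F'.Faithful := by
  obtain ⟨_, _⟩ := hF
  exact ⟨Functor.Full.of_comp_faithful_iso i.symm, Functor.Faithful.of_comp_iso i.symm⟩

theorem exists_equivalence_wr {a b : C} (e : a ≌ b) (c : C) :
    ∃ e' : a ⊠ c ≌ b ⊠ c, e'.hom = wr e.hom c :=
  ((isEquivalence₁_hom e).tensor (isEquivalence₁_id c)).exists_equivalence

/-- By naturality of the left unit, this functor is the identity up to composition with
equivalences. -/
theorem wlFunctor_one_full_faithful (a b : C) :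
    (wlFunctor one a b).Full ∧ (wlFunctor one a b).Faithful :=
  full_faithful_of_iso (F := 𝟭 (a ⟶ b)) ((Functor.leftUnitor _) ≪≫ (wlFunctorOne a b).symm)
    (precomp_isEquivalence _ _) (postcomp_isEquivalence _ _) ⟨inferInstance, inferInstance⟩

/-- The interchange with `e` gives a square relating `X` to the unit; its other two sides are
composition with equivalences. -/
theorem wlFunctor_full_faithful_of_equivalence {X : C} (e : X ≌ one) (a b : C) :
    (wlFunctor X a b).Full ∧ (wlFunctor X a b).Faithful := by
  obtain ⟨p, hp⟩ := exists_equivalence_wr e a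
  obtain ⟨q, hq⟩ := exists_equivalence_wr e b
  exact full_faithful_of_iso (wlFunctorInterchange e.hom a b)
    (hp ▸ precomp_isEquivalence _ _) (hq ▸ postcomp_isEquivalence _ _)
    (wlFunctor_one_full_faithful a b)

/-- Associativity replaces the iterated tensor product by tensoring with `X ⊠ Y`, which is
equivalent to the unit. -/
theorem wlFunctor_comp_full_faithful {X Y : C} (e : X ⊠ Y ≌ one) (a b : C) :
    (wlFunctor Y a b ⋙ wlFunctor X _ _).Full ∧ (wlFunctor Y a b ⋙ wlFunctor X _ _).Faithful :=
  full_faithful_of_iso (wlFunctorAssoc X Y a b) (postcomp_isEquivalence _ _)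
    (precomp_isEquivalence _ _) (wlFunctor_full_faithful_of_equivalence e a b)

/-- Two-out-of-six: both composites of tensoring with `X` and with an inverse `Y` are fully
faithful. The first factor of a faithful composite is faithful, and it is full if the composite is
full and the second factor is faithful. -/
theorem Invertible₀.wlFunctor_full_faithful {X : C} (h : Invertible₀ X) (a b : C) :
    (wlFunctor X a b).Full ∧ (wlFunctor X a b).Faithful := by
  obtain ⟨Y, ⟨e⟩, ⟨e'⟩⟩ := h
  obtain ⟨h₁, h₂⟩ := wlFunctor_comp_full_faithful e' a b
  obtain ⟨h₃, h₄⟩ := wlFunctor_comp_full_faithful e (X ⊠ a) (X ⊠ b)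
  -- The composite in the other order is used only to make the second factor of the first composite
  -- faithful.
  have := Functor.Faithful.of_comp (wlFunctor Y (X ⊠ a) (X ⊠ b)) (wlFunctor X _ _)
  exact ⟨Functor.Full.of_comp_faithful (wlFunctor X a b) (wlFunctor Y _ _),
    Functor.Faithful.of_comp (wlFunctor X a b) (wlFunctor Y _ _)⟩

end

/-! ### Cancelling equivalences and invertible objects from trivializations -/

open Displayed MonoidalIdTrans

namespace MonoidalIdTrans

variable {D : Type u} [Bicategory.{w, v} D] [MonoidalBicategory D] {S : MonoidalIdTrans D}

/-- The condition determines the whiskering of the left trivialization with `e.hom`, and whiskering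
with an equivalence is faithful. -/
theorem LCond.eq_left {a b : D} {l l₁ : S.s a ≅ 𝟙 a} {l' : S.s b ≅ 𝟙 b} {e : a ≌ b}
    (h : S.LCond l l' e.hom) (h₁ : S.LCond l₁ l' e.hom) : l = l₁ := by
  have := postcomp_isEquivalence a e
  ext
  apply (postcomp a e.hom).map_injective
  change l.hom ▷ e.hom = l₁.hom ▷ e.hom
  rw [← cancel_mono (λ_ e.hom).hom, ← cancel_epi (S.sn e.hom).hom]
  exact Eq.trans h h₁.symm

/-- Solved for the whiskering of `l` with `e.hom`, the condition prescribes the isomorphism `i`,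
which lifts because whiskering with an equivalence is full and faithful. -/
theorem exists_lCond {a b : D} (e : a ≌ b) (l' : S.s b ≅ 𝟙 b) :
    ∃ l : S.s a ≅ 𝟙 a, S.LCond l l' e.hom := by
  have := postcomp_isEquivalence a e
  let i : S.s a ≫ e.hom ≅ 𝟙 a ≫ e.hom :=
    (S.sn e.hom).symm ≪≫ whiskerLeftIso e.hom l' ≪≫ ρ_ _ ≪≫ (λ_ _).symm
  refine ⟨(postcomp a e.hom).preimageIso i, ?_⟩
  have h : ((postcomp a e.hom).preimageIso i).hom ▷ e.hom = i.hom :=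
    (postcomp a e.hom).map_preimage i.hom
  rw [LCond, lHom, h]
  simp [i]

/-- Isolates the second trivialization as an image under `wlFunctor`, so that full faithfulness
applies to it. -/
theorem tTriv_eq (S : MonoidalIdTrans D) {a b : D} (l : S.s a ≅ 𝟙 a) (l' : S.s b ≅ 𝟙 b) :
    S.tTriv l l' = S.tc a b ≪≫ tIso l (Iso.refl _) ≪≫ tIso (Iso.refl _) l' ≪≫ tId a b := by
  ext
  simp only [tTriv, Iso.trans_hom, tIso_hom, Iso.refl_hom]
  rw [← reassoc_of% tHom₂_comp]
  simp

theorem tTriv_right_injective {a b : D} (ha : Invertible₀ a) {l : S.s a ≅ 𝟙 a}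
    {l₁ l₂ : S.s b ≅ 𝟙 b} (h : S.tTriv l l₁ = S.tTriv l l₂) : l₁ = l₂ := by
  obtain ⟨_, _⟩ := ha.wlFunctor_full_faithful b b
  have h₁ := congrArg Iso.hom h
  rw [tTriv_eq, tTriv_eq] at h₁
  simp only [Iso.trans_hom, cancel_epi, cancel_mono] at h₁
  ext
  exact (wlFunctor a b b).map_injective h₁

/-- Existence uses fullness of tensoring with `a`: cancelling the other factors of `tTriv_eq`
prescribes the image `i` of the desired trivialization. -/
theorem exists_tTriv_eq {a b : D} (ha : Invertible₀ a) (l : S.s a ≅ 𝟙 a)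
    (t : S.s (a ⊠ b) ≅ 𝟙 (a ⊠ b)) : ∃ l' : S.s b ≅ 𝟙 b, S.tTriv l l' = t := by
  obtain ⟨_, _⟩ := ha.wlFunctor_full_faithful b b
  let i : wl a (S.s b) ≅ wl a (𝟙 b) :=
    (tIso l (Iso.refl _)).symm ≪≫ (S.tc a b).symm ≪≫ t ≪≫ (tId a b).symm
  refine ⟨(wlFunctor a b b).preimageIso i, ?_⟩
  have h : 𝟙 (𝟙 a) ⊠₂ ((wlFunctor a b b).preimageIso i).hom = i.hom :=
    (wlFunctor a b b).map_preimage i.hom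
  rw [tTriv_eq]
  ext
  rw [Iso.trans_hom, Iso.trans_hom, Iso.trans_hom, tIso_hom (Iso.refl _), Iso.refl_hom, h]
  simp only [i, Iso.trans_hom, Iso.symm_hom, Category.assoc, Iso.inv_hom_id, Category.comp_id,
    Iso.hom_inv_id_assoc]

end MonoidalIdTrans

/-! ### Fixed points over invertible objects are invertible -/

namespace CircleAction

variable {D : Type u} [Bicategory.{w, v} D] [MonoidalBicategory D] (A : CircleAction D)

/-- The trivialization at a sum of integers given by trivializations at the summands. -/
@[simps!]
def addTriv {m n k : ℤ} (h : m + n = k) {c : D} (l : (A.act m).s c ≅ 𝟙 c)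
    (l' : (A.act n).s c ≅ 𝟙 c) : (A.act k).s c ≅ 𝟙 c :=
  A.add h c ≪≫ whiskerRightIso l ((A.act n).s c) ≪≫ λ_ _ ≪≫ l'

/-- Because `add` is a modification, the naturality square at `k` is the pasting of those at `m` and
`n`, to which the two conditions apply separately. -/
theorem lCond_add {m n k : ℤ} (h : m + n = k) {a b : D} {f : a ⟶ b} {l : (A.act m).s a ≅ 𝟙 a}
    {l' : (A.act n).s a ≅ 𝟙 a} {p : (A.act m).s b ≅ 𝟙 b} {p' : (A.act n).s b ≅ 𝟙 b}
    (hl : (A.act m).LCond l p f) (hl' : (A.act n).LCond l' p' f) :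
    (A.act k).LCond (A.addTriv h l l') (A.addTriv h p p') f := by
  have hA := A.add_naturality h f
  unfold LCond lHom at *
  calc
    _ = (((A.act k).sn f).hom ≫ (A.add h a).hom ▷ f) ≫
        (l.hom ▷ (A.act n).s a ≫ (λ_ _).hom) ▷ f ≫ l'.hom ▷ f ≫ (λ_ f).hom := by
      simp
    _ = f ◁ (A.add h b).hom ≫ (α_ _ _ _).inv ≫ ((A.act m).sn f).hom ▷ (A.act n).s b ≫
        (α_ _ _ _).hom ≫ ((A.act m).s a ◁ ((A.act n).sn f).hom ≫ l.hom ▷ ((A.act n).s a ≫ f)) ≫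
        (λ_ _).hom ≫ l'.hom ▷ f ≫ (λ_ f).hom := by
      rw [hA]
      simp [Sq.hcomp]
    _ = f ◁ (A.add h b).hom ≫ (α_ _ _ _).inv ≫ (((A.act m).sn f).hom ≫ l.hom ▷ f ≫
        (λ_ f).hom) ▷ (A.act n).s b ≫ ((A.act n).sn f).hom ≫ l'.hom ▷ f ≫ (λ_ f).hom := by
      -- The trivialization at `m` is moved before the naturality square at `n`, where it meets the
      -- square at `m`.
      rw [whisker_exchange]
      simp
    _ = _ := by
      rw [hl, hl']
      simp

/-- This is monoidality of `add`. It is stated for arbitrary isomorphisms rather than for a `Triv`,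
since it serves to show that a solution of the tensor equation is a `Triv`. -/
theorem tTriv_add {m n k : ℤ} (h : m + n = k) {a b : D} (l : (A.act m).s a ≅ 𝟙 a)
    (l' : (A.act n).s a ≅ 𝟙 a) (p : (A.act m).s b ≅ 𝟙 b) (p' : (A.act n).s b ≅ 𝟙 b) :
    (A.act k).tTriv (A.addTriv h l l') (A.addTriv h p p') =
      A.addTriv h ((A.act m).tTriv l p) ((A.act n).tTriv l' p') := by
  have hA := A.add_tensor h a b
  ext
  calc
    _ = ((A.act k).tc a b).hom ≫ ((A.add h a).hom ⊠₂ (A.add h b).hom) ≫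
        ((l.hom ▷ (A.act n).s a) ⊠₂ (p.hom ▷ (A.act n).s b)) ≫
        ((λ_ ((A.act n).s a)).hom ⊠₂ (λ_ ((A.act n).s b)).hom) ≫
        (l'.hom ⊠₂ p'.hom) ≫ (tId a b).hom := by
      simp only [tTriv, Iso.trans_hom, tIso_hom, addTriv_hom, tHom₂_comp, Category.assoc]
    _ = (((A.act k).tc a b).hom ≫ ((A.add h a).hom ⊠₂ (A.add h b).hom) ≫
        (tComp _ _ _ _).hom) ≫ (l.hom ⊠₂ p.hom) ▷ _ ≫
        (tId a b).hom ▷ _ ≫ (λ_ _).hom ≫ (l'.hom ⊠₂ p'.hom) ≫ (tId a b).hom := by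
      rw [← tComp_leftUnitor]
      simp only [Category.assoc]
      rw [← reassoc_of% (tComp_whiskerRight l.hom p.hom ((A.act n).s a) ((A.act n).s b))]
    _ = (A.add h (a ⊠ b)).hom ≫ ((A.act m).tc a b).hom ▷ (A.act n).s (a ⊠ b) ≫
        (((A.act m).s a ⊠₁ (A.act m).s b) ◁ ((A.act n).tc a b).hom ≫
        ((l.hom ⊠₂ p.hom) ≫ (tId a b).hom) ▷ _) ≫ (λ_ _).hom ≫
        (l'.hom ⊠₂ p'.hom) ≫ (tId a b).hom := by
      rw [hA]
      simp
    _ = _ := by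
      rw [whisker_exchange]
      simp [tTriv]

variable {A}

theorem Triv.l_zero_eq {c : D} (t : A.Triv c) : t.l 0 = A.zero c := Iso.ext t.l_zero

theorem Triv.l_add_eq {c : D} (t : A.Triv c) {m n k : ℤ} (h : m + n = k) :
    t.l k = A.addTriv h (t.l m) (t.l n) := Iso.ext (t.l_add h)

/-- The trivializations are pulled back one integer at a time. Compatibility with zero and addition
follows from uniqueness: the candidates given by `zero` and `addTriv` satisfy the same condition
along `e`. -/
theorem Triv.exists_lCond {a b : D} (e : a ≌ b) (t : A.Triv b) :
    ∃ t' : A.Triv a, ∀ n, (A.act n).LCond (t'.l n) (t.l n) e.hom := by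
  choose l hl using fun n => MonoidalIdTrans.exists_lCond (S := A.act n) e (t.l n)
  refine ⟨⟨l, ?_, fun {m n k} h => ?_⟩, hl⟩
  · have h₀ : (A.act 0).LCond (A.zero a) (t.l 0) e.hom := by
      rw [t.l_zero_eq]
      exact A.zero_naturality e.hom
    rw [(hl 0).eq_left h₀]
  · have h₀ := A.lCond_add h (hl m) (hl n)
    rw [← t.l_add_eq h] at h₀
    rw [(hl k).eq_left h₀]
    rfl

/-- Division by a trivialization at an invertible object. The pattern is that of
`Triv.exists_lCond`: existence for each integer, then coherence from uniqueness, here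
`tTriv_right_injective`. -/
theorem Triv.exists_tensor_eq {a b : D} (ha : Invertible₀ a) (t : A.Triv a)
    (T : A.Triv (a ⊠ b)) : ∃ t' : A.Triv b, t.tensor t' = T := by
  choose l hl using fun n => MonoidalIdTrans.exists_tTriv_eq (S := A.act n) ha (t.l n) (T.l n)
  refine ⟨⟨l, ?_, fun {m n k} h => ?_⟩, ?_⟩
  · have h₀ : (A.act 0).tTriv (t.l 0) (A.zero b) = T.l 0 := by
      rw [t.l_zero_eq, T.l_zero_eq]
      ext
      exact A.zero_tensor a b
    rw [tTriv_right_injective ha ((hl 0).trans h₀.symm)]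
  · have h₀ : (A.act k).tTriv (t.l k) (A.addTriv h (l m) (l n)) = T.l k := by
      rw [t.l_add_eq h, tTriv_add, hl, hl, ← T.l_add_eq h]
    rw [tTriv_right_injective ha ((hl k).trans h₀.symm)]
    rfl
  · ext n
    exact congrArg Iso.hom (hl n)

/-- The central construction: the inverse object receives the one family of trivializations for
which `e` becomes a 1-morphism of fixed points. -/
theorem exists_tensor_equivalence_one {X : HomotopyFixedPoints A} (h : Invertible₀ X.base) :
    ∃ Y : HomotopyFixedPoints A, Invertible₀ Y.base ∧ Nonempty (X ⊠ Y ≌ one) := by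
  obtain ⟨c, ⟨e⟩, ⟨e'⟩⟩ := id h
  -- `T` is the trivialization at the unit pulled back along `e`; dividing it by that of `X` gives
  -- `t`.
  obtain ⟨T, hT⟩ := (Triv.one A).exists_lCond e
  obtain ⟨t, rfl⟩ := X.fib.triv.exists_tensor_eq h T
  -- Only the trivializations matter, so `Θ` may be taken to be the identity.
  refine ⟨⟨c, FixedPoint.ofTriv (𝟙 c) (Iso.refl _) t⟩, ⟨X.base, ⟨e'⟩, ⟨e⟩⟩, ⟨?_⟩⟩
  refine liftEquiv (X := X ⊠ _) (Y := one) e (FixedPointHom.ofCond _ _ fun n => ?_)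
  change (A.act n).LCond ((FixedPoint.ofTriv _ _ (X.fib.triv.tensor
    (FixedPoint.ofTriv (𝟙 c) (Iso.refl _) t).triv)).triv.l n)
    ((FixedPoint.ofTriv (𝟙 one) (Iso.refl _) (Triv.one A)).triv.l n) e.hom
  rw [FixedPoint.triv_ofTriv, FixedPoint.triv_ofTriv, FixedPoint.triv_ofTriv]
  exact hT n

open MonoidalCategory in
/-- A homotopy fixed point over an invertible object is invertible. -/
theorem invertible_homotopyFixedPoint {X : HomotopyFixedPoints A} (h : Invertible₀ X.base) :
    Invertible₀ X := by
  obtain ⟨Y, hY, ⟨e⟩⟩ := exists_tensor_equivalence_one h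
  -- The construction gives right inverses only, so it is applied again to `Y`.
  obtain ⟨Z, -, ⟨e'⟩⟩ := exists_tensor_equivalence_one hY
  rw [invertible_iff]
  let x : Ho (HomotopyFixedPoints A) := ⟨X⟩
  let y : Ho (HomotopyFixedPoints A) := ⟨Y⟩
  let z : Ho (HomotopyFixedPoints A) := ⟨Z⟩
  let i : x ⊗ y ≅ 𝟙_ _ := Ho.clIso e
  let j : y ⊗ z ≅ 𝟙_ _ := Ho.clIso e'
  -- The monoid argument in the homotopy category: a left inverse and a right inverse of `y` agree,
  -- so `x` is also a right inverse of `y`.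
  let k : x ≅ z := (ρ_ x).symm ≪≫ whiskerLeftIso x j.symm ≪≫ (α_ x y z).symm ≪≫
    whiskerRightIso i z ≪≫ λ_ z
  exact ⟨y, ⟨i⟩, ⟨whiskerLeftIso y k ≪≫ j⟩⟩

end CircleAction

/-! ### Invertibility and forgetting structure -/

namespace Displayed

variable {B : Type u} [Bicategory.{w, v} B] {D : Displayed.{w, v, u, u', v'} B}

/-- The equivalence underlying an equivalence of the total bicategory. -/
def baseEquiv {X Y : D.Total} (e : X ≌ Y) : X.base ≌ Y.base where
  hom := b₁ e.hom
  inv := b₁ e.inv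
  unit := (baseIso e.unit :)
  counit := (baseIso e.counit :)
  left_triangle := Iso.ext (congrArg b₂ e.left_triangle_hom :)

end Displayed

section

variable {C : Type u} [Bicategory.{w, v} C] [MonoidalBicategory C]

theorem Invertible₀.of_core {P : C → Prop} [TensorClosed P] {X : CoreOn P} (h : Invertible₀ X) :
    Invertible₀ X.base := by
  obtain ⟨Y, ⟨e⟩, ⟨e'⟩⟩ := h
  exact ⟨Y.base, ⟨baseEquiv e⟩, ⟨baseEquiv e'⟩⟩

/-- An inverse of an invertible object is itself invertible, hence also lies in the core. -/
theorem Invertible₀.to_core {P : C → Prop} [TensorClosed P] {X : CoreOn P}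
    (hP : ∀ Y : C, Invertible₀ Y → P Y) (h : Invertible₀ X.base) : Invertible₀ X := by
  obtain ⟨Y, ⟨e⟩, ⟨e'⟩⟩ := h
  exact ⟨⟨Y, ⟨hP Y ⟨X.base, ⟨e'⟩, ⟨e⟩⟩⟩⟩, ⟨liftEquiv e ⟨isEquivalence₁_hom e⟩⟩,
    ⟨liftEquiv e' ⟨isEquivalence₁_hom e'⟩⟩⟩

theorem Invertible₀.of_homotopyFixedPoint {A : CircleAction C} {X : HomotopyFixedPoints A}
    (h : Invertible₀ X) : Invertible₀ X.base := by
  obtain ⟨Y, ⟨e⟩, ⟨e'⟩⟩ := h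
  exact ⟨Y.base, ⟨baseEquiv e⟩, ⟨baseEquiv e'⟩⟩

end

/-! ### Restriction and extension of fixed point structures between cores -/

section

variable {C : Type u} [Bicategory.{w, v} C] [MonoidalBicategory C] {P Q : C → Prop}
  [TensorClosed P] [TensorClosed Q] (h : ∀ X, P X → Q X) {A : CircleAction (CoreOn Q)}

/-- The restriction of trivializations to a smaller core. -/
def CircleAction.Triv.restrict {c : CoreOn P} (t : A.Triv (coreObj h c)) :
    (A.restrict h).Triv c where
  l n := liftIso (baseIso (t.l n) :)
  l_zero := ext₂ (congrArg b₂ t.l_zero :)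
  l_add e := ext₂ (congrArg b₂ (t.l_add e) :)

/-- The restriction of homotopy fixed points to a smaller core. -/
def FixedPoint.restrict {c : CoreOn P} (x : FixedPoint A (coreObj h c)) :
    FixedPoint (A.restrict h) c where
  Θ := mk₁ (X := c) (Y := c) (b₁ x.Θ :) ⟨(fib₁ x.Θ).down⟩
  nat n := liftIso (baseIso (x.nat n) :)
  mul := liftIso (baseIso x.mul :)
  unit := liftIso (baseIso x.unit :)
  -- The 2-morphisms of both cores are 2-morphisms of `C`, and the two actions have the same
  -- underlying cells, so each axiom is literally the same equation.
  nat_zero := ext₂ (congrArg b₂ x.nat_zero :)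
  nat_add e := ext₂ (congrArg b₂ (x.nat_add e) :)
  mul_nat e := ext₂ (congrArg b₂ (x.mul_nat e) :)
  mul_assoc := ext₂ (congrArg b₂ x.mul_assoc :)
  mul_left := ext₂ (congrArg b₂ x.mul_left :)
  mul_right := ext₂ (congrArg b₂ x.mul_right :)

/-- The extension of homotopy fixed points to a larger core. -/
def FixedPoint.extend {c : CoreOn P} (x : FixedPoint (A.restrict h) c) :
    FixedPoint A (coreObj h c) where
  Θ := mk₁ (X := coreObj h c) (Y := coreObj h c) (b₁ x.Θ :) ⟨(fib₁ x.Θ).down⟩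
  nat n := liftIso (baseIso (x.nat n) :)
  mul := liftIso (baseIso x.mul :)
  unit := liftIso (baseIso x.unit :)
  nat_zero := ext₂ (congrArg b₂ x.nat_zero :)
  nat_add e := ext₂ (congrArg b₂ (x.nat_add e) :)
  mul_nat e := ext₂ (congrArg b₂ (x.mul_nat e) :)
  mul_assoc := ext₂ (congrArg b₂ x.mul_assoc :)
  mul_left := ext₂ (congrArg b₂ x.mul_left :)
  mul_right := ext₂ (congrArg b₂ x.mul_right :)

theorem FixedPoint.triv_restrict {c : CoreOn P} (x : FixedPoint A (coreObj h c)) :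
    (x.restrict h).triv = x.triv.restrict h := rfl

/-- The restriction of 1-morphisms of homotopy fixed points to a smaller core. -/
def FixedPointHom.restrict {a b : CoreOn P} {x : FixedPoint A (coreObj h a)}
    {y : FixedPoint A (coreObj h b)} {f : a ⟶ b} (p : FixedPointHom x y (coreMap h f)) :
    FixedPointHom (x.restrict h) (y.restrict h) f where
  m := liftIso (baseIso p.m :)
  m_nat n := ext₂ (congrArg b₂ (p.m_nat n) :)
  m_mul := ext₂ (congrArg b₂ p.m_mul :)
  m_unit := ext₂ (congrArg b₂ p.m_unit :)

/-- The extension of 1-morphisms of homotopy fixed points to a larger core. -/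
def FixedPointHom.extend {a b : CoreOn P} {x : FixedPoint A (coreObj h a)}
    {y : FixedPoint A (coreObj h b)} {f : a ⟶ b}
    (p : FixedPointHom (x.restrict h) (y.restrict h) f) :
    FixedPointHom x y (coreMap h f) where
  m := liftIso (baseIso p.m :)
  m_nat n := ext₂ (congrArg b₂ (p.m_nat n) :)
  m_mul := ext₂ (congrArg b₂ p.m_mul :)
  m_unit := ext₂ (congrArg b₂ p.m_unit :)

end

/-! ### The monoidal comparison pseudofunctor, lying over the identity of `C` -/

namespace PicFixed

variable {C : Type u} [Bicategory.{w, v} C] [MonoidalBicategory C] {Q : C → Prop}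
  [TensorClosed Q] (h : ∀ X : C, Invertible₀ X → Q X) (A : CircleAction (CoreOn Q))

/-- The object of the Picard groupoid underlying an invertible homotopy fixed point. -/
def base (X : Pic (HomotopyFixedPoints A)) : Pic C :=
  ⟨X.base.base.base, ⟨X.fib.down.of_homotopyFixedPoint.of_core⟩⟩

/-- The homotopy fixed point of the Picard groupoid given by an invertible homotopy fixed point. -/
def obj (X : Pic (HomotopyFixedPoints A)) : HomotopyFixedPoints (A.restrict h) :=
  ⟨base A X, FixedPoint.restrict h (c := base A X) X.base.fib⟩

variable {A}

/-- The 1-morphism underlying a 1-morphism of invertible homotopy fixed points. -/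
def map₀ {X Y : Pic (HomotopyFixedPoints A)} (f : X ⟶ Y) : X.base.base.base ⟶ Y.base.base.base :=
  b₁ (b₁ (b₁ f))

/-- The 1-morphism of the Picard groupoid underlying a 1-morphism of invertible homotopy fixed
points. -/
def baseMap {X Y : Pic (HomotopyFixedPoints A)} (f : X ⟶ Y) : base A X ⟶ base A Y :=
  mk₁ (X := base A X) (Y := base A Y) (map₀ f) ⟨(fib₁ (b₁ (b₁ f))).down⟩

/-- The 1-morphism of homotopy fixed points of the Picard groupoid given by a 1-morphism of
invertible homotopy fixed points. -/
def map {X Y : Pic (HomotopyFixedPoints A)} (f : X ⟶ Y) : obj h A X ⟶ obj h A Y :=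
  mk₁ (X := obj h A X) (Y := obj h A Y) (baseMap f)
    (FixedPointHom.restrict h (f := baseMap f) (fib₁ (b₁ f)))

/-- The 2-morphism underlying a 2-morphism of invertible homotopy fixed points. -/
def map₂₀ {X Y : Pic (HomotopyFixedPoints A)} {f g : X ⟶ Y} (η : f ⟶ g) : map₀ f ⟶ map₀ g :=
  b₂ (b₂ (b₂ η))

/-- The image of a 2-morphism of invertible homotopy fixed points. -/
def map₂ {X Y : Pic (HomotopyFixedPoints A)} {f g : X ⟶ Y} (η : f ⟶ g) : map h f ⟶ map h g :=
  mk₂ (mk₂ (map₂₀ η) (prop₂ (b₂ (b₂ η)))) (FixedPointHom.two _ _ _)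

variable (A)

/-- The pseudofunctor from invertible homotopy fixed points to homotopy fixed points of the Picard
groupoid. -/
def functor : Pic (HomotopyFixedPoints A) ⥤ᵖ HomotopyFixedPoints (A.restrict h) where
  obj := obj h A
  map := map h
  map₂ := map₂ h
  map₂_id _ := rfl
  map₂_comp _ _ := rfl
  mapId X := liftIso (liftIso (Iso.refl (𝟙 X.base.base.base)))
  mapComp f g := liftIso (liftIso (Iso.refl (map₀ f ≫ map₀ g)))
  -- The two uses of `ext₂` forget the fixed point structure and the core of the target, leaving the
  -- axioms of the identity pseudofunctor of `C`.
  map₂_whisker_left f _ _ η := ext₂ (ext₂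
    ((Pseudofunctor.id C).map₂_whisker_left (map₀ f) (map₂₀ η)))
  map₂_whisker_right η f := ext₂ (ext₂
    ((Pseudofunctor.id C).map₂_whisker_right (map₂₀ η) (map₀ f)))
  map₂_associator f g k := ext₂ (ext₂
    ((Pseudofunctor.id C).map₂_associator (map₀ f) (map₀ g) (map₀ k)))
  map₂_left_unitor f := ext₂ (ext₂ ((Pseudofunctor.id C).map₂_left_unitor (map₀ f)))
  map₂_right_unitor f := ext₂ (ext₂ ((Pseudofunctor.id C).map₂_right_unitor (map₀ f)))

theorem triv_restrict_ofTriv {c : Pic C} (Θ : coreObj h c ⟶ coreObj h c) (M : Θ ≅ 𝟙 _)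
    (t : A.Triv (coreObj h c)) :
    ((FixedPoint.ofTriv Θ M t).restrict h).triv = t.restrict h := by
  rw [FixedPoint.triv_restrict, FixedPoint.triv_ofTriv]

theorem restrict_tensor {a b : Pic C} (t : A.Triv (coreObj h a)) (t' : A.Triv (coreObj h b)) :
    (t.restrict h).tensor (t'.restrict h) =
      CircleAction.Triv.restrict h (c := a ⊠ b) (t.tensor t') := by
  ext n
  exact ext₂ rfl

theorem restrict_one : CircleAction.Triv.one (A.restrict h) =
      CircleAction.Triv.restrict h (c := (one : Pic C)) (CircleAction.Triv.one A) := by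
  ext n
  exact ext₂ rfl

/-- Restriction commutes with tensor products of trivializations. Comparing trivializations is
enough, because 1-morphisms of fixed points are governed by `LCond`, which sees nothing else. -/
theorem triv_tensor (X Y : Pic (HomotopyFixedPoints A)) :
    FixedPoint.triv (obj h A X ⊠ obj h A Y).fib = FixedPoint.triv (obj h A (X ⊠ Y)).fib := by
  have h₁ : FixedPoint.triv (obj h A X ⊠ obj h A Y).fib =
      (FixedPoint.triv (obj h A X).fib).tensor (FixedPoint.triv (obj h A Y).fib) :=
    FixedPoint.triv_ofTriv _ _ ((FixedPoint.triv (obj h A X).fib).tensor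
      (FixedPoint.triv (obj h A Y).fib))
  have h₂ : FixedPoint.triv (obj h A (X ⊠ Y)).fib =
      CircleAction.Triv.restrict h (c := base A X ⊠ base A Y)
      (CircleAction.Triv.tensor (FixedPoint.triv X.base.fib) (FixedPoint.triv Y.base.fib)) :=
    triv_restrict_ofTriv h A (c := base A X ⊠ base A Y)
      (TensorBicategory.tHom (C := CoreOn Q) (FixedPoint.Θ X.base.fib) (FixedPoint.Θ Y.base.fib))
      (tIso (C := CoreOn Q) (FixedPoint.unit X.base.fib) (FixedPoint.unit Y.base.fib) ≪≫ tId _ _)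
      (CircleAction.Triv.tensor (FixedPoint.triv X.base.fib) (FixedPoint.triv Y.base.fib))
  have h₃ : (FixedPoint.triv (obj h A X).fib).tensor (FixedPoint.triv (obj h A Y).fib) =
      CircleAction.Triv.restrict h (c := base A X ⊠ base A Y)
      (CircleAction.Triv.tensor (FixedPoint.triv X.base.fib) (FixedPoint.triv Y.base.fib)) :=
    restrict_tensor h A (a := base A X) (b := base A Y) (FixedPoint.triv X.base.fib)
      (FixedPoint.triv Y.base.fib)
  exact h₁.trans (h₃.trans h₂.symm)

theorem triv_one : FixedPoint.triv (one : HomotopyFixedPoints (A.restrict h)).fib =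
    FixedPoint.triv (obj h A one).fib := by
  have h₁ : FixedPoint.triv (one : HomotopyFixedPoints (A.restrict h)).fib =
      CircleAction.Triv.one (A.restrict h) :=
    FixedPoint.triv_ofTriv _ _ (CircleAction.Triv.one (A.restrict h))
  have h₂ : FixedPoint.triv (obj h A one).fib =
      CircleAction.Triv.restrict h (c := (one : Pic C)) (CircleAction.Triv.one A) :=
    triv_restrict_ofTriv h A (c := (one : Pic C)) (𝟙 (one : CoreOn Q)) (Iso.refl _)
      (CircleAction.Triv.one A)
  exact h₁.trans ((restrict_one h A).trans h₂.symm)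

/-- Since the trivializations agree, the identity 1-morphism of the underlying object satisfies the
condition. This puts the tensor comparison `χ` over an identity. -/
theorem tensor_cond (X Y : Pic (HomotopyFixedPoints A)) (n : ℤ) :
    ((A.restrict h).act n).LCond ((FixedPoint.triv (obj h A X ⊠ obj h A Y).fib).l n)
      ((FixedPoint.triv (obj h A (X ⊠ Y)).fib).l n) (𝟙 (base A X ⊠ base A Y)) :=
  (triv_tensor h A X Y) ▸ lCond_id _ _

theorem one_cond (n : ℤ) :
    ((A.restrict h).act n).LCond
      ((FixedPoint.triv (one : HomotopyFixedPoints (A.restrict h)).fib).l n)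
      ((FixedPoint.triv (obj h A one).fib).l n) (𝟙 one) :=
  (triv_one h A) ▸ lCond_id _ _

/-- The data of the monoidal pseudofunctor. -/
def monoidalData :
    MonoidalPseudofunctorData (Pic (HomotopyFixedPoints A))
      (HomotopyFixedPoints (A.restrict h)) where
  F := functor h A
  χ X Y := liftEquiv (X := obj h A X ⊠ obj h A Y) (Y := obj h A (X ⊠ Y))
    (liftEquiv (X := base A X ⊠ base A Y) (Y := base A X ⊠ base A Y)
      ((idMonoidalData C).χ X.base.base.base Y.base.base.base) ⟨isEquivalence₁_id _⟩)
    (FixedPointHom.ofCond _ _ (tensor_cond h A X Y))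
  χNat f g := liftIso (liftIso ((idMonoidalData C).χNat (map₀ f) (map₀ g)))
  ι := liftEquiv (X := one) (Y := obj h A one)
    (liftEquiv (X := one) (Y := one) (idMonoidalData C).ι ⟨isEquivalence₁_id _⟩)
    (FixedPointHom.ofCond _ _ (one_cond h A))
  ω X Y Z := liftIso (liftIso ((idMonoidalData C).ω X.base.base.base Y.base.base.base
    Z.base.base.base))
  γ X := liftIso (liftIso ((idMonoidalData C).γ X.base.base.base))
  δ X := liftIso (liftIso ((idMonoidalData C).δ X.base.base.base))

/-- The monoidal pseudofunctor from invertible homotopy fixed points to homotopy fixed points of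
the Picard groupoid. -/
def monoidal :
    MonoidalPseudofunctor (Pic (HomotopyFixedPoints A)) (HomotopyFixedPoints (A.restrict h)) where
  toMonoidalPseudofunctorData := monoidalData h A
  -- All data lie over those of `idMonoidalData`, so each axiom is that of `idMonoidal` evaluated at
  -- the underlying objects and morphisms.
  χ_naturality η θ := ext₂ (ext₂ ((idMonoidal C).χ_naturality (map₂₀ η) (map₂₀ θ)))
  χ_id X Y := ext₂ (ext₂ ((idMonoidal C).χ_id X.base.base.base Y.base.base.base))
  χ_comp f f' g g' := ext₂ (ext₂ ((idMonoidal C).χ_comp (map₀ f) (map₀ f') (map₀ g) (map₀ g')))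
  ω_naturality f g k := ext₂ (ext₂ ((idMonoidal C).ω_naturality (map₀ f) (map₀ g) (map₀ k)))
  γ_naturality f := ext₂ (ext₂ ((idMonoidal C).γ_naturality (map₀ f)))
  δ_naturality f := ext₂ (ext₂ ((idMonoidal C).δ_naturality (map₀ f)))
  ω_pent X Y Z W := ext₂ (ext₂ ((idMonoidal C).ω_pent X.base.base.base Y.base.base.base
    Z.base.base.base W.base.base.base))
  ω_unit X Y := ext₂ (ext₂ ((idMonoidal C).ω_unit X.base.base.base Y.base.base.base))

end PicFixed

/-- A displayed bicategory contains inverses over equivalences and lifts all invertible 2-morphisms,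
so nothing obstructs lifting an adjoint equivalence. -/
theorem Displayed.isEquivalence₁_of_base {B : Type u} [Bicategory.{w, v} B]
    {D : Displayed.{w, v, u, u', v'} B} {X Y : D.Total} (f : X ⟶ Y)
    (h : IsEquivalence₁ (b₁ f)) : IsEquivalence₁ f := by
  obtain ⟨e, he⟩ := h.exists_equivalence
  obtain ⟨f, p⟩ := f
  obtain rfl : e.hom = f := he
  exact isEquivalence₁_hom (liftEquiv (X := X) (Y := Y) e p)

/-! ### The comparison is a biequivalence -/

namespace PicFixed

variable {C : Type u} [Bicategory.{w, v} C] [MonoidalBicategory C] {Q : C → Prop}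
  [TensorClosed Q] (h : ∀ X : C, Invertible₀ X → Q X) (A : CircleAction (CoreOn Q))

theorem functor_isBiequivalence : IsBiequivalence (functor h A) where
  obj_surj Y := by
    -- Invertibility of the fixed point is where `invertible_homotopyFixedPoint` enters. Restricting
    -- the extension of `Y` returns `Y` itself, so the identity equivalence suffices.
    have hY : Invertible₀ (coreObj h Y.base) := Invertible₀.to_core h Y.base.fib.down
    exact ⟨⟨⟨coreObj h Y.base, FixedPoint.extend h Y.fib⟩,
      ⟨CircleAction.invertible_homotopyFixedPoint hY⟩⟩, ⟨Bicategory.Equivalence.id Y⟩⟩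
  map_surj {X X'} g := by
    let g₀ : X.base ⟶ X'.base := mk₁ (X := X.base) (Y := X'.base)
      (coreMap h (X := base A X) (Y := base A X') (b₁ g))
      (FixedPointHom.extend h (a := base A X) (b := base A X') (fib₁ g))
    -- The 1-morphism underlying `g` is an equivalence in `C` because it belongs to a core. This
    -- lifts through the larger core and then through its fixed points, as a 1-morphism of the
    -- Picard groupoid requires.
    have hg : IsEquivalence₁ g₀ :=
      isEquivalence₁_of_base _ (isEquivalence₁_of_base _ (fib₁ (b₁ g)).down)
    exact ⟨mk₁ (X := X) (Y := X') g₀ ⟨hg⟩, ⟨Iso.refl g⟩⟩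
  map₂_bij {X X'} f g := by
    refine ⟨fun η θ e => ?_, fun (μ : map h f ⟶ map h g) => ?_⟩
    · exact ext₂ (ext₂ (ext₂ (congrArg (fun t : map h f ⟶ map h g => b₂ (b₂ t)) e)))
    -- A 2-morphism in the target is invertible in `C`, hence lifts through all three layers of the
    -- source. Injectivity holds because a 2-morphism is determined by the underlying one in `C`.
    · let ν : baseMap f ⟶ baseMap g := b₂ (X := obj h A X) (Y := obj h A X') μ
      have hν : IsIso (b₂ (X := base A X) (Y := base A X') ν) :=
        prop₂ (X := base A X) (Y := base A X') ν
      let i : map₀ f ≅ map₀ g := @asIso _ _ _ _ (b₂ (X := base A X) (Y := base A X') ν) hν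
      let j : f ≅ g := liftIso (liftIso (liftIso i))
      exact ⟨j.hom, rfl⟩

/-- The Picard groupoid of the homotopy fixed points is equivalent to the homotopy fixed points of
the Picard groupoid. -/
def biequivalence :
    MonoidalBiequivalence (Pic (HomotopyFixedPoints A)) (HomotopyFixedPoints (A.restrict h)) where
  toMonoidalPseudofunctor := monoidal h A
  isBiequivalence := functor_isBiequivalence h A

end PicFixed

/-- The general comparison for the core on the fully dualizable objects, which include the
invertible ones: an equivalence with the unit can be improved to an adjoint one, which provides a
duality whose evaluation and coevaluation are equivalences. -/
theorem mainTheorem11 {C : Type u} [Bicategory.{w, v} C] [SymmetricMonoidalBicategory C]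
    (d : ∀ X : CoreFD C, FullDuality X.base) (A : CircleAction (CoreFD C))
    (hA : ∀ X : CoreFD C, Displayed.b₁ ((A.act 1).s X) = (d X).serre) :
    Nonempty (MonoidalBiequivalence (Pic (HomotopyFixedPoints A))
      (HomotopyFixedPoints
        (A.restrict (P := Invertible₀ (C := C)) fun _ h => h.fullyDualizable))) :=
  ⟨PicFixed.biequivalence (fun _ h => h.fullyDualizable) A⟩
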